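/- All manifolds are smooth, Hausdorff and second countable; $d$ is normalised by $d\eta(X,Y)=X\eta(Y)-Y\eta(X)-\eta([X,Y])$ and wedge products accordingly, $\eta\wedge d\eta(X,Y,Z)=\eta(X)d\eta(Y,Z)+\eta(Y)d\eta(Z,X)+\eta(Z)d\eta(X,Y)$. An almost contact metric structure $(g,\xi,\eta,\varphi)$ on $M$ consists of a Riemannian metric $g$, a unit vector field $\xi$, $\eta=g(\xi,\cdot)$ and an endomorphism $\varphi$ of $TM$ with $\varphi(\xi)=0$, $\varphi^2=-1+\eta\otimes\xi$ and $g(\varphi X,\varphi Y)=g(X,Y)-\eta(X)\eta(Y)$. It is normal if $$[\varphi X,\varphi Y]+\varphi^2[X,Y]-\varphi[\varphi X,Y]-\varphi[X,\varphi Y]+d\eta(X,Y)\xi=0$$ for all vector fields $X,Y$, and ST (Sasaki with torsion) if it is normal and $\xi$ is a Killing field. With $F=g(\varphi\cdot,\cdot)$, its torsion $3$-form is $c=\eta\wedge d\eta+dF(\varphi\cdot,\varphi\cdot,\varphi\cdot)$. Let a compact Lie group $G$ with Lie algebra $\mathfrak g$ act smoothly and freely on $M$, preserving the structure; $A^*$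 denotes the fundamental vector field of $A\in\mathfrak g$. A $G$-moment map is a smooth map $\mu\colon M\to\mathfrak g^*$, equivariant for the coadjoint action, such that (i) $d\mu_p(\varphi(A^*))\ne0$ for all $p\in\mu^{-1}(0)$ and all non-zero $A\in\mathfrak g$, and (ii) $d\mu(\xi)=0$. **Proposition.** Let $(M,g,\xi,\eta,\varphi)$ be an almost contact metric manifold with a free smooth action of a compact Lie group $G$ preserving the structure, and let $\mu$ be a $G$-moment map. Then: 1. $M_0=\mu^{-1}(0)$ is an embedded submanifold $\iota\colon M_0\hookrightarrow M$ of dimension $\dim M-\dim G$, and $M_0/G$ with the quotient topology is a (Hausdorff, second countable) manifold of dimension $\dim M-2\dim G$ for which the projection $\pi\colon M_0\to M_0/G$ is a smooth submersion. The distribution $\mathcal H=\{X\in TM_0: d\mu(\varphi(X))=0\}$ is a connection on $M_0\to M_0/G$, i.e. $\mathcal H=\ker\theta$ for a smooth $\mathrm{Ad}$-equivariant $\theta\in\Omega^1(M_0,\mathfrak g)$ with $\theta(A^*)=A$. 2. $\xi$ is tangent to $M_0$ and lies in $\mathcal H$, $\mathcal H$ is $\varphi$-invariant, and $M_0/G$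 carries an almost contact metric structure $(\widetilde g,\widetilde\xi,\widetilde\eta,\widetilde\varphi)$ with $$\widetilde g(\pi_*X,\pi_*Y)=g(X,Y),\qquad \widetilde\xi=\pi_*\xi,\qquad \widetilde\varphi(\pi_*X)=\pi_*(\varphi X)\qquad (X,Y\in\mathcal H).$$ If $M$ is normal, so is $M_0/G$. 3. If $M$ is ST, so is $M_0/G$, and the torsion forms $c$ of $M$ and $\widetilde c$ of $M_0/G$ satisfy $$\pi^*\widetilde c=c^{\mathcal H}-\langle\alpha,R\rangle,\qquad \pi^*d\widetilde c=(dc-R\lrcorner c)^{\mathcal H}-\langle(d\alpha)^{\mathcal H},R\rangle.$$ Here $X^{\mathcal H}=X-\theta(X)^*$ is the horizontal projection, $\beta^{\mathcal H}$ is the form $\beta(\cdot^{\mathcal H},\dots,\cdot^{\mathcal H})$ on $M_0$ (forms on $M$ being first restricted to $M_0$), $\alpha\in\Omega^1(M_0,\mathfrak g^*)$ is given by $\langle\alpha(X),A\rangle=g(X^{\mathcal H},A^*)$, $R=(d\theta)^{\mathcal H}\in\Omega^2(M_0,\mathfrak g)$ is the curvature, $\langle\cdot,\cdot\rangle$ is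 the wedge product contracted by the pairing of $\mathfrak g^*$ and $\mathfrak g$, and $$(R\lrcorner c)(X_1,\dots,X_4)=\sum_{i<j}(-1)^{i+j+1}\,c\bigl(R(X_i,X_j)^*,X_1,\dots,\widehat{X_i},\dots,\widehat{X_j},\dots,X_4\bigr).$$ -/

import Mathlib

attribute [-instance] TopCat.of.chartedSpace

open scoped Manifold ContDiff Topology
open Bundle VectorField

noncomputable section

namespace STReduction

/-- The model space `ℝⁿ`. -/
abbrev Eu (n : ℕ) : Type := EuclideanSpace ℝ (Fin n)

/-- The tangent space `T_x M` of an `n`-manifold. -/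
abbrev Tan (n : ℕ) {M : Type*} [TopologicalSpace M] [ChartedSpace (Eu n) M] (x : M) : Type :=
  TangentSpace (𝓡 n) x

/-! ### Vector fields and differential forms -/

section Forms

variable {n k : ℕ} {M : Type*} [TopologicalSpace M] [ChartedSpace (Eu n) M]
variable {V : Type*} [NormedAddCommGroup V] [NormedSpace ℝ V]

/-- Smoothness of a vector field. -/
def IsSmoothVF [IsManifold (𝓡 n) ∞ M] (X : ∀ x : M, Tan n x) : Prop :=
  ContMDiff (𝓡 n) (𝓡 n).tangent ∞ (fun x => (⟨x, X x⟩ : TangentBundle (𝓡 n) M))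

/-- The exterior derivative of a `V`-valued `k`-form on `M`. At `x` the form is pulled back to the
model space by the inverse of the chart `extChartAt x`, differentiated there by Mathlib's `extDeriv`
and pulled back by the chart. There are no numerical factors:
`dη(X, Y) = X(η(Y)) - Y(η(X)) - η([X, Y])`. -/
def extD (β : ∀ x : M, Tan n x [⋀^Fin k]→L[ℝ] V) (x : M) : Tan n x [⋀^Fin (k + 1)]→L[ℝ] V :=
  (extDeriv (fun y : Eu n =>
      (β ((extChartAt (𝓡 n) x).symm y)).compContinuousLinearMap
        (mfderiv (𝓡 n) (𝓡 n) (extChartAt (𝓡 n) x).symm y : Eu n →L[ℝ] _))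
    (extChartAt (𝓡 n) x x)).compContinuousLinearMap
      (mfderiv (𝓡 n) (𝓡 n) (extChartAt (𝓡 n) x) x : Tan n x →L[ℝ] Eu n)

/-- A field of linear forms, as a differential `1`-form. -/
def toForm (α : ∀ x : M, Tan n x →L[ℝ] V) (x : M) : Tan n x [⋀^Fin 1]→L[ℝ] V :=
  ContinuousAlternatingMap.ofSubsingleton ℝ (Tan n x) V (0 : Fin 1) (α x)

/-- The wedge product of a `1`-form and a `2`-form at a point:
`(η ∧ β)(X₀, X₁, X₂) = η(X₀) β(X₁, X₂) - η(X₁) β(X₀, X₂) + η(X₂) β(X₀, X₁)`. -/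
def wedge {x : M} (η : Tan n x →L[ℝ] ℝ) (β : Tan n x [⋀^Fin 2]→L[ℝ] ℝ) :
    Tan n x [⋀^Fin 3]→L[ℝ] ℝ :=
  ContinuousAlternatingMap.alternatizeUncurryFin (𝕜 := ℝ) (E := Eu n) (F := ℝ)
    (ContinuousLinearMap.smulRight (η : Eu n →L[ℝ] ℝ) (β : Eu n [⋀^Fin 2]→L[ℝ] ℝ))

end Forms

/-! ### Almost contact metric structures -/

/-- An almost contact metric structure `(g, ξ, η, φ)` on an `n`-manifold, with `η = g(ξ, ·)`.
The equations force `n` to be odd as soon as the manifold is non-empty. -/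
structure AlmostContactMetric (n : ℕ) (M : Type*) [TopologicalSpace M] [ChartedSpace (Eu n) M]
    [IsManifold (𝓡 n) ∞ M] where
  /-- the Riemannian metric `g` -/
  metric : ContMDiffRiemannianMetric (𝓡 n) ∞ (Eu n) (fun x : M => Tan n x)
  /-- the Reeb vector field `ξ` -/
  reeb : ∀ x : M, Tan n x
  reeb_smooth : IsSmoothVF reeb
  /-- the bundle endomorphism `φ` -/
  phi : ∀ x : M, Tan n x →L[ℝ] Tan n x
  phi_smooth : ContMDiff (𝓡 n) ((𝓡 n).prod 𝓘(ℝ, Eu n →L[ℝ] Eu n)) ∞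
    (fun x => TotalSpace.mk' (Eu n →L[ℝ] Eu n) (E := fun x : M => Tan n x →L[ℝ] Tan n x) x (phi x))
  reeb_unit : ∀ x, metric.inner x (reeb x) (reeb x) = 1
  phi_reeb : ∀ x, phi x (reeb x) = 0
  phi_sq : ∀ x (v : Tan n x), phi x (phi x v) = -v + metric.inner x (reeb x) v • reeb x
  metric_phi : ∀ x (u v : Tan n x), metric.inner x (phi x u) (phi x v) =
    metric.inner x u v - metric.inner x (reeb x) u * metric.inner x (reeb x) v

namespace AlmostContactMetric

variable {n : ℕ} {M : Type*} [TopologicalSpace M] [ChartedSpace (Eu n) M]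
  [IsManifold (𝓡 n) ∞ M] (S : AlmostContactMetric n M)

/-- The dual `1`-form `η = g(ξ, ·)`. -/
def eta (x : M) : Tan n x →L[ℝ] ℝ := S.metric.inner x (S.reeb x)

/-- The exterior derivative `dη`. -/
def dEta (x : M) : Tan n x [⋀^Fin 2]→L[ℝ] ℝ := extD (toForm S.eta) x

theorem eta_phi (x : M) (v : Tan n x) : S.metric.inner x (S.reeb x) (S.phi x v) = 0 := by
  have h1 := S.phi_sq x (S.phi x v)
  rw [S.phi_sq x v, map_add, map_neg, map_smul, S.phi_reeb, smul_zero, add_zero] at h1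
  have h2 : S.metric.inner x (S.reeb x) (S.phi x v) • S.reeb x = 0 := by
    simpa using h1
  have h3 := congrArg (S.metric.inner x (S.reeb x)) h2
  rw [map_smul, S.reeb_unit, map_zero] at h3
  simpa using h3

theorem inner_phi_self (x : M) (v : Tan n x) : S.metric.inner x (S.phi x v) v = 0 := by
  have h := S.metric_phi x v (S.phi x v)
  rw [S.eta_phi, mul_zero, sub_zero, S.phi_sq, map_add, map_neg, map_smul,
    S.metric.symm x (S.phi x v) (S.reeb x), S.eta_phi, smul_zero, add_zero,
    S.metric.symm x v] at h
  linarith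

/-- The fundamental `2`-form `F(X, Y) = g(φ X, Y)`. -/
def fundForm (x : M) : Tan n x [⋀^Fin 2]→L[ℝ] ℝ where
  toFun v := S.metric.inner x (S.phi x (v 0)) (v 1)
  map_update_add' v i a b := by fin_cases i <;> simp
  map_update_smul' v i c a := by fin_cases i <;> simp
  cont := by
    have h : ∀ B : Eu n →L[ℝ] Eu n →L[ℝ] ℝ, Continuous fun p : Eu n × Eu n => B p.1 p.2 := by
      intro B; fun_prop
    exact (h (S.metric.inner x)).comp (((S.phi x).continuous.comp (continuous_apply 0)).prodMk (continuous_apply 1))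
  map_eq_zero_of_eq' v i j h hij := by
    fin_cases i <;> fin_cases j <;> simp_all [S.inner_phi_self]

/-- The torsion `3`-form `c = η ∧ dη + dF(φ·, φ·, φ·)`. -/
def torsion (x : M) : Tan n x [⋀^Fin 3]→L[ℝ] ℝ :=
  wedge (S.eta x) (S.dEta x) + (extD S.fundForm x).compContinuousLinearMap (S.phi x)

/-- Normality: the Sasaki--Hatakeyama tensor vanishes. -/
def IsNormal : Prop :=
  ∀ X Y : ∀ x : M, Tan n x, IsSmoothVF X → IsSmoothVF Y → ∀ x : M,
    mlieBracket (𝓡 n) (fun y => S.phi y (X y)) (fun y => S.phi y (Y y)) x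
      + S.phi x (S.phi x (mlieBracket (𝓡 n) X Y x))
      - S.phi x (mlieBracket (𝓡 n) (fun y => S.phi y (X y)) Y x)
      - S.phi x (mlieBracket (𝓡 n) X (fun y => S.phi y (Y y)) x)
      + S.dEta x ![X x, Y x] • S.reeb x = 0

/-- The Reeb field is Killing, `ℒ_ξ g = 0`:
`ξ(g(X, Y)) = g([ξ, X], Y) + g(X, [ξ, Y])` for all vector fields `X`, `Y`. -/
def ReebKilling : Prop :=
  ∀ X Y : ∀ x : M, Tan n x, IsSmoothVF X → IsSmoothVF Y → ∀ x : M,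
    (mfderiv (𝓡 n) 𝓘(ℝ, ℝ) (fun y => S.metric.inner y (X y) (Y y)) x (S.reeb x) : ℝ) =
      S.metric.inner x (mlieBracket (𝓡 n) S.reeb X x) (Y x)
        + S.metric.inner x (X x) (mlieBracket (𝓡 n) S.reeb Y x)

/-- Sasaki with torsion: normal with Killing Reeb field. -/
def IsST : Prop := S.IsNormal ∧ S.ReebKilling

end AlmostContactMetric

/-! ### Group actions and moment maps -/

/-- The Lie algebra `𝔤 = T₁G` of a `d`-dimensional Lie group. Mathlib's `GroupLieAlgebra (𝓡 d) G` is
by definition this space, which carries in addition a norm. -/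
abbrev LieAlg (d : ℕ) : Type := Eu d

/-- The dual `𝔤*`. -/
abbrev LieDual (d : ℕ) : Type := LieAlg d →L[ℝ] ℝ

section Action

variable (d n : ℕ) {G : Type*} [TopologicalSpace G] [ChartedSpace (Eu d) G] [Group G]
  {M : Type*} [TopologicalSpace M] [ChartedSpace (Eu n) M] [MulAction G M]

/-- The adjoint action `Ad g : 𝔤 → 𝔤`, the derivative at `1` of `h ↦ g h g⁻¹`. -/
def Ad (g : G) : LieAlg d →L[ℝ] LieAlg d :=
  mfderiv (𝓡 d) (𝓡 d) (fun h : G => g * h * g⁻¹) 1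

/-- The value at `p` of the fundamental vector field `A*`, linearly in `A ∈ 𝔤`: the derivative at
`1` of the orbit map `g ↦ g • p`. -/
def fund (G : Type*) [TopologicalSpace G] [ChartedSpace (Eu d) G] [Group G] [MulAction G M]
    (p : M) : LieAlg d →L[ℝ] Tan n p :=
  mfderiv (𝓡 d) (𝓡 n) (fun g : G => g • p) 1

/-- The derivative `T_p M → T_{g p} M` of the diffeomorphism `p ↦ g • p`. -/
def actD (g : G) (p : M) : Tan n p →L[ℝ] Tan n (g • p) :=
  mfderiv (𝓡 n) (𝓡 n) (fun x : M => g • x) p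

end Action

section Moment

variable {d n : ℕ} {G : Type*} [TopologicalSpace G] [ChartedSpace (Eu d) G] [Group G]
  {M : Type*} [TopologicalSpace M] [ChartedSpace (Eu n) M] [IsManifold (𝓡 n) ∞ M] [MulAction G M]

/-- The action of `G` preserves the metric, the Reeb field and `φ` (hence also `η`). -/
structure Preserves (G : Type*) [Group G] [MulAction G M] (S : AlmostContactMetric n M) :
    Prop where
  metric : ∀ (g : G) (p : M) (u v : Tan n p),
    S.metric.inner (g • p) (actD n g p u) (actD n g p v) = S.metric.inner p u v
  reeb : ∀ (g : G) (p : M), actD n g p (S.reeb p) = S.reeb (g • p)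
  phi : ∀ (g : G) (p : M) (u : Tan n p), actD n g p (S.phi p u) = S.phi (g • p) (actD n g p u)

/-- The derivative of a `𝔤*`-valued function. -/
def dMoment (μ : M → LieDual d) (p : M) : Tan n p →L[ℝ] LieDual d :=
  mfderiv (𝓡 n) 𝓘(ℝ, LieDual d) μ p

variable (d G) in
/-- A `G`-moment map: a smooth map `μ : M → 𝔤*`, equivariant for the coadjoint action, such that
`dμ_p(φ(A*)) ≠ 0` for every non-zero `A ∈ 𝔤` and `p ∈ μ⁻¹(0)`, and which is basic for the Reeb
foliation, i.e. `dμ(ξ) = 0`. -/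
structure MomentMap (S : AlmostContactMetric n M) where
  /-- the underlying map -/
  toFun : M → LieDual d
  smooth : ContMDiff (𝓡 n) 𝓘(ℝ, LieDual d) ∞ toFun
  equivariant : ∀ (g : G) (p : M) (A : LieAlg d), toFun (g • p) A = toFun p (Ad d g⁻¹ A)
  nondegenerate : ∀ A : LieAlg d, A ≠ 0 → ∀ p : M, toFun p = 0 →
    dMoment toFun p (S.phi p (fund d n G p A)) ≠ 0
  basic : ∀ p : M, dMoment toFun p (S.reeb p) = 0

namespace MomentMap

variable {S : AlmostContactMetric n M} (μ : MomentMap d G S)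

/-- The level set `M₀ = μ⁻¹(0)`. -/
def zeroLevel : Set M := {p | μ.toFun p = 0}

/-- The action of `G` restricts to `M₀`. -/
instance : MulAction G μ.zeroLevel where
  smul g q := ⟨g • (q : M), by
    have hq : μ.toFun q = 0 := q.2
    change μ.toFun (g • (q : M)) = 0
    ext A
    rw [μ.equivariant, hq]
    rfl⟩
  one_smul q := Subtype.ext (one_smul G (q : M))
  mul_smul g h q := Subtype.ext (mul_smul g h (q : M))

/-- The reduction `M // G = μ⁻¹(0) / G`, with the quotient topology. -/
abbrev Reduction : Type _ := MulAction.orbitRel.Quotient G μ.zeroLevel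

/-- The inclusion `ι : M₀ → M`. -/
def incl : μ.zeroLevel → M := Subtype.val

/-- The projection `π : M₀ → M // G`. -/
def proj : μ.zeroLevel → μ.Reduction := Quotient.mk _

section Level

variable {m : ℕ} [ChartedSpace (Eu m) μ.zeroLevel]

/-- The derivative `ι_*` of the inclusion. -/
def inclD (q : μ.zeroLevel) : Tan m q →L[ℝ] Tan n (q : M) :=
  mfderiv (𝓡 m) (𝓡 n) μ.incl q

/-- The derivative `π_*` of the projection. -/
def projD {k : ℕ} [ChartedSpace (Eu k) μ.Reduction] (q : μ.zeroLevel) :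
    Tan m q →L[ℝ] Tan k (μ.proj q) :=
  mfderiv (𝓡 m) (𝓡 k) μ.proj q

/-- The horizontal distribution `ℋ_q = {v ∈ T_q M₀ : dμ(φ(v)) = 0}`. -/
def horizontal (q : μ.zeroLevel) : Submodule ℝ (Tan m q) :=
  LinearMap.ker (((dMoment μ.toFun (q : M)).comp ((S.phi q).comp (μ.inclD q))).toLinearMap)

/-- `θ` is the connection form of `ℋ` on `M₀ → M // G`: a smooth `𝔤`-valued `1`-form on `M₀`,
`Ad`-equivariant, with `θ(A*) = A` for `A ∈ 𝔤` and `ker θ = ℋ`. -/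
structure IsConnectionForm [IsManifold (𝓡 m) ∞ μ.zeroLevel]
    (θ : ∀ q : μ.zeroLevel, Tan m q →L[ℝ] LieAlg d) : Prop where
  smooth : ∀ X : ∀ q : μ.zeroLevel, Tan m q, IsSmoothVF X →
    ContMDiff (𝓡 m) (𝓡 d) ∞ (fun q => θ q (X q))
  equivariant : ∀ (g : G) q (v : Tan m q), θ (g • q) (actD m g q v) = Ad d g (θ q v)
  fund_eq : ∀ q (A : LieAlg d), θ q (fund d m G q A) = A
  ker_eq : ∀ q (v : Tan m q), θ q v = 0 ↔ v ∈ μ.horizontal q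

variable (θ : ∀ q : μ.zeroLevel, Tan m q →L[ℝ] LieAlg d)

/-- The horizontal projection `v ↦ v^ℋ = v - θ(v)*`. -/
def hproj (q : μ.zeroLevel) : Tan m q →L[ℝ] Tan m q :=
  ContinuousLinearMap.id ℝ _ - (fund d m G q).comp (θ q)

/-- The curvature `R(u, v) = dθ(u^ℋ, v^ℋ) ∈ 𝔤`. -/
def curv (q : μ.zeroLevel) (u v : Tan m q) : LieAlg d :=
  extD (toForm θ) q ![μ.hproj θ q u, μ.hproj θ q v]

/-- The `𝔤*`-valued `1`-form `⟨α(v), A⟩ = g(v^ℋ, A*)` on `M₀`. -/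
def alpha (q : μ.zeroLevel) : Tan m q →L[ℝ] LieDual d :=
  (ContinuousLinearMap.precomp ℝ (fund d n G (q : M))).comp
    ((S.metric.inner (q : M)).comp ((μ.inclD q).comp (μ.hproj θ q)))

/-- The horizontal part `(dα)^ℋ`. -/
def dAlphaH (q : μ.zeroLevel) (u v : Tan m q) : LieDual d :=
  extD (toForm (μ.alpha θ)) q ![μ.hproj θ q u, μ.hproj θ q v]

/-- The `3`-form `⟨α, R⟩`, the wedge product of `α` and `R` contracted by `𝔤* × 𝔤 → ℝ`. -/
def alphaR (q : μ.zeroLevel) (X : Fin 3 → Tan m q) : ℝ :=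
  μ.alpha θ q (X 0) (μ.curv θ q (X 1) (X 2))
    + μ.alpha θ q (X 1) (μ.curv θ q (X 2) (X 0))
    + μ.alpha θ q (X 2) (μ.curv θ q (X 0) (X 1))

/-- The `4`-form `⟨(dα)^ℋ, R⟩`, the wedge product contracted by `𝔤* × 𝔤 → ℝ`. -/
def dAlphaR (q : μ.zeroLevel) (X : Fin 4 → Tan m q) : ℝ :=
  μ.dAlphaH θ q (X 0) (X 1) (μ.curv θ q (X 2) (X 3))
    - μ.dAlphaH θ q (X 0) (X 2) (μ.curv θ q (X 1) (X 3))
    + μ.dAlphaH θ q (X 0) (X 3) (μ.curv θ q (X 1) (X 2))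
    + μ.dAlphaH θ q (X 1) (X 2) (μ.curv θ q (X 0) (X 3))
    - μ.dAlphaH θ q (X 1) (X 3) (μ.curv θ q (X 0) (X 2))
    + μ.dAlphaH θ q (X 2) (X 3) (μ.curv θ q (X 0) (X 1))

/-- The `4`-form `R ⌟ c` on `M₀`: the wedge product of `R` and `c`, contracted through `A ↦ A*`,
`(R ⌟ c)(X₀, …, X₃) = ∑_{i < j} (-1)^{i+j+1} c(R(X_i, X_j)*, X_k, X_l)` with `k < l` the remaining
indices. -/
def curvTorsion (q : μ.zeroLevel) (X : Fin 4 → Tan m q) : ℝ :=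
  let c := fun i j k l : Fin 4 => S.torsion (q : M)
    ![fund d n G (q : M) (μ.curv θ q (X i) (X j)), μ.inclD q (X k), μ.inclD q (X l)]
  c 0 1 2 3 - c 0 2 1 3 + c 0 3 1 2 + c 1 2 0 3 - c 1 3 0 2 + c 2 3 0 1

/-- `T` is the structure on `M // G` induced by `S`: on `ℋ` one has
`g̃(π_* u, π_* v) = g(u, v)`, the field `ξ` is horizontal and `π`-related to `ξ̃`, and `φ`
preserves `ℋ` with `φ̃(π_* u) = π_*(φ u)`. -/
structure IsInduced {k : ℕ} [ChartedSpace (Eu k) μ.Reduction] [IsManifold (𝓡 k) ∞ μ.Reduction]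
    (T : AlmostContactMetric k μ.Reduction) : Prop where
  metric : ∀ (q : μ.zeroLevel) (u v : Tan m q), u ∈ μ.horizontal q → v ∈ μ.horizontal q →
    T.metric.inner (μ.proj q) (μ.projD q u) (μ.projD q v) =
      S.metric.inner (q : M) (μ.inclD q u) (μ.inclD q v)
  reeb : ∀ q : μ.zeroLevel, ∃ w ∈ μ.horizontal (m := m) q,
    μ.inclD q w = S.reeb (q : M) ∧ μ.projD q w = T.reeb (μ.proj q)
  phi : ∀ (q : μ.zeroLevel) (u : Tan m q), u ∈ μ.horizontal q → ∃ w ∈ μ.horizontal (m := m) q,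
    μ.inclD q w = S.phi (q : M) (μ.inclD q u) ∧
      μ.projD q w = T.phi (μ.proj q) (μ.projD q u)

end Level

end MomentMap

end Moment

end STReduction

end

/-!
# Reduction of almost contact metric structures

*Linear algebra on the zero level.* By condition (i), the map `A ↦ dμ(φ(A*))` is an isomorphism
`𝔤 ≃ 𝔤*` at the points of `M₀ = μ⁻¹(0)`. On `M₀` the form `dμ` vanishes on the vectors `A*`, by
equivariance, and `dμ ∘ φ ∘ φ = -dμ`, because `dμ(ξ) = 0`. So `(dμ ∘ φ, dμ)` maps onto
`𝔤* × 𝔤*`, and the tangent space of `M` splits into the fundamental vectors `A*`, the vectors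
`φ(A*)`, and the common kernel of `dμ` and `dμ ∘ φ`. This kernel is the horizontal space; it
contains `ξ` and is `φ`-invariant. The connection form is `θ = (dμ ∘ φ ∘ ·*)⁻¹ ∘ dμ ∘ φ`
(`MomentMap.conn`).

*Charts.* No slice theorem is available, but a slice is only needed at points of `M₀`, where the
action is free. By the inverse function theorem there is a transversal
`j : ℝᵏ × 𝔤* → M` through `q ∈ M₀`, tangent to `ker (dμ ∘ φ)`, with `μ(j(z, ν)) = ν`
(`exists_transversal`), and `(a, w) ↦ γ(a) • j(w)` is a chart of `M`, for a chart `γ` of `G` at `1`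
(`exists_slice_chart`). As `G` is compact and acts freely, distinct points `j(z, 0)` near `q` lie on
distinct orbits (`eventually_slice_inj`). In such a chart `M₀` is the subspace `ν = 0`, and `z` is a
coordinate on `M₀/G`; this gives both manifold structures, and the inclusion and the projection are
linear in these charts. The quotient is Hausdorff because an action of a compact group is proper.
The section `z ↦ j(z, 0)` is horizontal at `q`. What is used later of these charts is recorded in
`IsReductionAtlas`.

*The induced structure.* The tensors `g`, `ξ`, `φ` restrict to the horizontal spaces and are
`G`-invariant, so they descend to `M₀/G`. To compare derivatives at `π(q)`, all tensors of the
quotient are expressed along a section `s` with values in `M₀` which is horizontal at `q`: at a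
nearby point they are the tensors of `M` evaluated on the horizontal lift `L = ds - f ∘ s^*θ`, where
`f` is the infinitesimal action. As `s^*θ` vanishes at the point in question, the first derivative
of `L` is the second derivative of `s`, which is symmetric, minus `f` applied to the derivative of
`s^*θ` (`IsLiftAt`). Each expression which is antisymmetric in the derivative of `L` is thus the
corresponding expression on `M`, plus terms in the curvature `R`. For the normality tensor, these
terms are (`liftC_nij`)
`R(φX, φY)* - R(X, Y)* - φ((R(φX, Y) + R(X, φY))*)`.
If `M` is normal, they equal a horizontal vector; since fundamental vectors, their images under `φ`
and horizontal vectors are independent, all of them vanish. So `M₀/G` is normal and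
`R(φX, φY) = R(X, Y)`; in particular `R(ξ, ·) = 0`, whence `ξ̃` is Killing if `ξ` is.

*The torsion form.* The correction terms for `dη̃` and `dF̃`, combined with the `φ`-invariance of
`R`, give `π^*c̃ = c^ℋ - ⟨α, R⟩` (`torsionE_reduced`). This formula holds along all of `s`, and is
differentiated once more (`extDE_torsionE_reduced`): the derivative of the lift of `c` produces
`dc - R ⌟ c`, and that of `⟨α, R⟩` only `⟨dα, R⟩`, by the Bianchi identity. The latter comes from
`d(dθ) = 0`, since `R` and `s^*dθ` agree to first order at a point where `s` is horizontal
(`hasFDerivAt_curvPb`), `dθ` being zero on a fundamental and a horizontal vector (`dconn_fundE`).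
-/

set_option linter.unusedSectionVars false

noncomputable section

namespace STReduction

/-! ### Derivatives between manifolds modelled on normed spaces -/

section Derivative

variable {E F H : Type*} [NormedAddCommGroup E] [NormedSpace ℝ E]
  [NormedAddCommGroup F] [NormedSpace ℝ F] [NormedAddCommGroup H] [NormedSpace ℝ H]
  {X Y Z : Type*} [TopologicalSpace X] [ChartedSpace E X] [TopologicalSpace Y] [ChartedSpace F Y]
  [TopologicalSpace Z] [ChartedSpace H Z]

/-- The manifold derivative, with the tangent spaces identified with the model spaces. -/
def md (E F : Type*) [NormedAddCommGroup E] [NormedSpace ℝ E]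
    [NormedAddCommGroup F] [NormedSpace ℝ F] {X Y : Type*} [TopologicalSpace X] [ChartedSpace E X]
    [TopologicalSpace Y] [ChartedSpace F Y] (f : X → Y) (x : X) : E →L[ℝ] F :=
  mfderiv 𝓘(ℝ, E) 𝓘(ℝ, F) f x

/-- Smoothness at a point of a map between manifolds modelled on `E` and `F`. -/
abbrev SmoothAt (E F : Type*) [NormedAddCommGroup E] [NormedSpace ℝ E]
    [NormedAddCommGroup F] [NormedSpace ℝ F] {X Y : Type*} [TopologicalSpace X] [ChartedSpace E X]
    [TopologicalSpace Y] [ChartedSpace F Y] (f : X → Y) (x : X) : Prop :=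
  ContMDiffAt 𝓘(ℝ, E) 𝓘(ℝ, F) ∞ f x

/-- The preferred chart at `x`, as a map to the model space. -/
abbrev ch (E : Type*) [NormedAddCommGroup E] [NormedSpace ℝ E] {X : Type*} [TopologicalSpace X]
    [ChartedSpace E X] (x : X) : PartialEquiv X E := extChartAt 𝓘(ℝ, E) x

theorem SmoothAt.mdifferentiableAt {f : X → Y} {x : X} (h : SmoothAt E F f x) :
    MDifferentiableAt 𝓘(ℝ, E) 𝓘(ℝ, F) f x :=
  ContMDiffAt.mdifferentiableAt h (by simp)

theorem md_comp {f : X → Y} {g : Y → Z} {x : X} (hg : SmoothAt F H g (f x))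
    (hf : SmoothAt E F f x) :
    md E H (fun y => g (f y)) x = (md F H g (f x)).comp (md E F f x) :=
  mfderiv_comp x hg.mdifferentiableAt hf.mdifferentiableAt

theorem md_comp_of_mdifferentiableAt {f : X → Y} {g : Y → Z} {x : X}
    (hg : MDifferentiableAt 𝓘(ℝ, F) 𝓘(ℝ, H) g (f x))
    (hf : MDifferentiableAt 𝓘(ℝ, E) 𝓘(ℝ, F) f x) :
    md E H (fun y => g (f y)) x = (md F H g (f x)).comp (md E F f x) :=
  mfderiv_comp x hg hf

theorem md_comp_apply {f : X → Y} {g : Y → Z} {x : X} (hg : SmoothAt F H g (f x))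
    (hf : SmoothAt E F f x) (v : E) :
    md E H (fun y => g (f y)) x v = md F H g (f x) (md E F f x v) := by
  rw [md_comp hg hf]; rfl

theorem md_congr {f g : X → Y} {x : X} (h : f =ᶠ[𝓝 x] g) : md E F f x = md E F g x :=
  Filter.EventuallyEq.mfderiv_eq h

theorem md_id (x : X) : md E E (fun y : X => y) x = ContinuousLinearMap.id ℝ E := mfderiv_id

theorem md_const (x : X) (y : Y) : md E F (fun _ : X => y) x = 0 := mfderiv_const

theorem md_eq_fderiv (f : E → F) (x : E) : md E F f x = fderiv ℝ f x := mfderiv_eq_fderiv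

theorem smoothAt_iff_contDiffAt {f : E → F} {x : E} : SmoothAt E F f x ↔ ContDiffAt ℝ ∞ f x :=
  contMDiffAt_iff_contDiffAt

theorem SmoothAt.eventually_mdifferentiableAt [IsManifold 𝓘(ℝ, E) ∞ X]
    [IsManifold 𝓘(ℝ, F) ∞ Y] {f : X → Y} {x : X} (h : SmoothAt E F f x) :
    ∀ᶠ y in 𝓝 x, MDifferentiableAt 𝓘(ℝ, E) 𝓘(ℝ, F) f y := by
  have : IsManifold 𝓘(ℝ, E) 1 X := IsManifold.of_le (n := ∞) (by simp)
  have : IsManifold 𝓘(ℝ, F) 1 Y := IsManifold.of_le (n := ∞) (by simp)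
  have h1 : ContMDiffAt 𝓘(ℝ, E) 𝓘(ℝ, F) 1 f x := h.of_le (by simp)
  filter_upwards [(contMDiffAt_iff_contMDiffAt_nhds (by simp)).1 h1] with y hy
  exact hy.mdifferentiableAt (by simp)

theorem eventually_ch_target (x : X) : ∀ᶠ z in 𝓝 (ch E x x), z ∈ (ch E x).target :=
  extChartAt_target_mem_nhds x

theorem eventually_ch_source (x : X) : ∀ᶠ y in 𝓝 x, y ∈ (ch E x).source :=
  extChartAt_source_mem_nhds x

section Charts

variable [IsManifold 𝓘(ℝ, E) ∞ X]

theorem smoothAt_ch {x y : X} (h : y ∈ (ch E x).source) : SmoothAt E E (ch E x) y :=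
  contMDiffAt_extChartAt' (by simpa using h)

theorem smoothAt_ch_self (x : X) : SmoothAt E E (ch E x) x := smoothAt_ch (mem_extChartAt_source x)

theorem smoothAt_ch_symm {x : X} {z : E} (h : z ∈ (ch E x).target) :
    SmoothAt E E (ch E x).symm z :=
  (contMDiffOn_extChartAt_symm x).contMDiffAt ((isOpen_extChartAt_target x).mem_nhds h)

theorem smoothAt_ch_symm_self (x : X) : SmoothAt E E (ch E x).symm (ch E x x) :=
  smoothAt_ch_symm (mem_extChartAt_target x)

theorem md_ch_md_symm {x : X} {z : E} (h : z ∈ (ch E x).target) (v : E) :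
    md E E (ch E x) ((ch E x).symm z) (md E E (ch E x).symm z v) = v := by
  rw [← md_comp_apply (smoothAt_ch ((ch E x).map_target h)) (smoothAt_ch_symm h)]
  have : (fun y => ch E x ((ch E x).symm y)) =ᶠ[𝓝 z] fun y => y := by
    filter_upwards [(isOpen_extChartAt_target x).mem_nhds h] with y hy
    exact (ch E x).right_inv hy
  rw [md_congr this, md_id]; rfl

theorem md_symm_md_ch {x : X} {z : E} (h : z ∈ (ch E x).target) (v : E) :
    md E E (ch E x).symm z (md E E (ch E x) ((ch E x).symm z) v) = v := by
  have hz := (ch E x).map_target h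
  have h1 := md_comp_apply (f := ch E x) (g := (ch E x).symm) (x := (ch E x).symm z)
    (by rw [(ch E x).right_inv h]; exact smoothAt_ch_symm h) (smoothAt_ch hz) v
  rw [(ch E x).right_inv h] at h1
  rw [← h1]
  have : (fun y => (ch E x).symm (ch E x y)) =ᶠ[𝓝 ((ch E x).symm z)] fun y => y := by
    filter_upwards [(isOpen_extChartAt_source x).mem_nhds hz] with y hy
    exact (ch E x).left_inv hy
  rw [md_congr this, md_id]; rfl

/-- At the base point of a chart the derivative of the chart is the identity, since tangent spaces
are identified with the model space by the preferred charts. Hence coordinate expressions of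
tensors agree with the tensors at the base point. -/
theorem md_ch_self (x : X) : md E E (ch E x) x = ContinuousLinearMap.id ℝ E :=
  mfderiv_extChartAt_self

theorem md_ch_symm_self (x : X) : md E E (ch E x).symm (ch E x x) = ContinuousLinearMap.id ℝ E := by
  ext1 v
  have := md_symm_md_ch (mem_extChartAt_target (I := 𝓘(ℝ, E)) x) v
  rw [(ch E x).left_inv (mem_extChartAt_source x), md_ch_self] at this
  exact this

end Charts

end Derivative

/-! ### Pull-backs of forms and the exterior derivative -/

section FormsTools

variable {n k : ℕ} {M : Type*} [TopologicalSpace M] [ChartedSpace (Eu n) M]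
  [IsManifold (𝓡 n) ∞ M]
  {V : Type*} [NormedAddCommGroup V] [NormedSpace ℝ V]
  {E : Type*} [NormedAddCommGroup E] [NormedSpace ℝ E]

/-- The pull-back of a form on `M` by a map from a normed space. -/
def pb (β : M → Eu n [⋀^Fin k]→L[ℝ] V) (f : E → M) (z : E) : E [⋀^Fin k]→L[ℝ] V :=
  (β (f z)).compContinuousLinearMap (md E (Eu n) f z)

/-- A form is smooth if its expression in the preferred chart at each point is smooth there. -/
def SmoothForm (β : M → Eu n [⋀^Fin k]→L[ℝ] V) : Prop :=
  ∀ x, ContDiffAt ℝ ∞ (pb β (ch (Eu n) x).symm) (ch (Eu n) x x)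

/-- The exterior derivative of a form at `x` is that of its expression in the chart at `x`. -/
theorem extD_eq (β : M → Eu n [⋀^Fin k]→L[ℝ] V) (x : M) :
    (extD (n := n) (M := M) β x : Eu n [⋀^Fin (k + 1)]→L[ℝ] V) =
      extDeriv (pb β (ch (Eu n) x).symm) (ch (Eu n) x x) := by
  have : (extD (n := n) (M := M) β x : Eu n [⋀^Fin (k + 1)]→L[ℝ] V) =
    (extDeriv (pb β (ch (Eu n) x).symm) (ch (Eu n) x x)).compContinuousLinearMap
      (md (Eu n) (Eu n) (ch (Eu n) x) x) := rfl
  rw [this, md_ch_self]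
  ext v
  rfl

/-- Near `z₀` a pull-back can be computed through the chart at `f z₀`. -/
theorem pb_eventuallyEq (β : M → Eu n [⋀^Fin k]→L[ℝ] V) {f : E → M} {z₀ : E}
    (hf : SmoothAt E (Eu n) f z₀) :
    pb β f =ᶠ[𝓝 z₀] fun z =>
      (pb β (ch (Eu n) (f z₀)).symm (ch (Eu n) (f z₀) (f z))).compContinuousLinearMap
        (fderiv ℝ (fun y => ch (Eu n) (f z₀) (f y)) z) := by
  filter_upwards [hf.eventually_mdifferentiableAt,
    hf.continuousAt.eventually (eventually_ch_source (E := Eu n) (f z₀))] with z hz hs'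
  ext v
  simp only [pb, ContinuousAlternatingMap.compContinuousLinearMap_apply]
  rw [← md_eq_fderiv, md_comp_of_mdifferentiableAt (smoothAt_ch hs').mdifferentiableAt hz,
    (ch (Eu n) (f z₀)).left_inv hs']
  congr 1
  ext1 i
  have := md_symm_md_ch ((ch (Eu n) (f z₀)).map_source hs') (md E (Eu n) f z (v i))
  rw [(ch (Eu n) (f z₀)).left_inv hs'] at this
  exact this.symm

theorem contDiffAt_ch_comp {f : E → M} {z₀ : E} (hf : SmoothAt E (Eu n) f z₀) :
    ContDiffAt ℝ ∞ (fun y => ch (Eu n) (f z₀) (f y)) z₀ :=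
  smoothAt_iff_contDiffAt.1 (ContMDiffAt.comp z₀ (smoothAt_ch_self (f z₀)) hf)

/-- Smoothness of a family of alternating forms may be tested on constant vectors. -/
theorem contDiffAt_alternating_iff [FiniteDimensional ℝ E] [FiniteDimensional ℝ V]
    {Z : Type*} [NormedAddCommGroup Z] [NormedSpace ℝ Z] {β : Z → E [⋀^Fin k]→L[ℝ] V} {z : Z} :
    ContDiffAt ℝ ∞ β z ↔ ∀ v, ContDiffAt ℝ ∞ (fun y => β y v) z := by
  constructor
  · intro h v
    exact (ContinuousAlternatingMap.apply ℝ E V v).contDiff.contDiffAt.comp z h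
  · intro h
    let b := Module.finBasis ℝ E
    let Φ : E [⋀^Fin k]→L[ℝ] V →ₗ[ℝ] ((Fin k → Fin (Module.finrank ℝ E)) → V) :=
      { toFun := fun a r => a fun i => b (r i)
        map_add' := fun _ _ => rfl
        map_smul' := fun _ _ => rfl }
    have hΦ : Function.Injective Φ := by
      intro a a' haa
      have : a.toAlternatingMap = a'.toAlternatingMap :=
        Module.Basis.ext_alternating b fun r _ => congrFun haa r
      ext v
      exact DFunLike.congr_fun this v
    obtain ⟨Ψ, hΨ⟩ := LinearMap.exists_leftInverse_of_injective Φ (LinearMap.ker_eq_bot.2 hΦ)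
    have h1 : β = fun y => Ψ.toContinuousLinearMap (Φ (β y)) := by
      ext1 y
      exact (LinearMap.congr_fun hΨ (β y)).symm
    rw [h1]
    exact Ψ.toContinuousLinearMap.contDiff.contDiffAt.comp z (contDiffAt_pi.2 fun r => h _)

theorem contDiffAt_alternating_apply {W Z : Type*} [NormedAddCommGroup W] [NormedSpace ℝ W]
    [NormedAddCommGroup Z] [NormedSpace ℝ Z] [CompleteSpace V]
    {β : Z → W [⋀^Fin k]→L[ℝ] V} {v : Z → Fin k → W} {z : Z} (hβ : ContDiffAt ℝ ∞ β z)
    (hv : ContDiffAt ℝ ∞ v z) : ContDiffAt ℝ ∞ (fun y => β y (v y)) z := by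
  have h := (ContinuousAlternatingMap.toContinuousMultilinearMapCLM (E := W) (F := V) (ι := Fin k)
    (𝕜 := ℝ) ℝ).analyticAt_uncurry_of_multilinear (x := (β z, v z))
  exact (h.contDiffAt (n := ∞)).comp z (hβ.prodMk hv)

theorem contDiffAt_alternating_comp [FiniteDimensional ℝ E] [FiniteDimensional ℝ V]
    {W Z : Type*} [NormedAddCommGroup W] [NormedSpace ℝ W] [NormedAddCommGroup Z] [NormedSpace ℝ Z]
    {β : Z → W [⋀^Fin k]→L[ℝ] V} {L : Z → E →L[ℝ] W} {z : Z}
    (hβ : ContDiffAt ℝ ∞ β z) (hL : ContDiffAt ℝ ∞ L z) :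
    ContDiffAt ℝ ∞ (fun y => (β y).compContinuousLinearMap (L y)) z := by
  have : CompleteSpace V := FiniteDimensional.complete ℝ V
  refine contDiffAt_alternating_iff.2 fun v => ?_
  exact contDiffAt_alternating_apply (v := fun y i => L y (v i)) hβ
    (contDiffAt_pi.2 fun i => hL.clm_apply contDiffAt_const)

/-- Although smoothness is tested in preferred charts at their base points only, it passes to
pull-backs by smooth maps. -/
theorem SmoothForm.contDiffAt_pb [FiniteDimensional ℝ E] [FiniteDimensional ℝ V]
    {β : M → Eu n [⋀^Fin k]→L[ℝ] V} (hβ : SmoothForm β) {f : E → M}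
    {z₀ : E} (hf : SmoothAt E (Eu n) f z₀) : ContDiffAt ℝ ∞ (pb β f) z₀ := by
  refine ContDiffAt.congr_of_eventuallyEq ?_ (pb_eventuallyEq β hf)
  refine contDiffAt_alternating_comp ?_ ?_
  · exact ContDiffAt.comp z₀ (hβ (f z₀)) (contDiffAt_ch_comp hf)
  · exact (contDiffAt_ch_comp hf).fderiv_right (m := ∞) (by simp)

/-- The exterior derivative commutes with pull-backs. -/
theorem extDeriv_pb {β : M → Eu n [⋀^Fin k]→L[ℝ] V} (hβ : SmoothForm β) {f : E → M}
    {z₀ : E} (hf : SmoothAt E (Eu n) f z₀) :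
    extDeriv (pb β f) z₀ = pb (extD (n := n) (M := M) β) f z₀ := by
  rw [(pb_eventuallyEq β hf).extDeriv_eq,
    extDeriv_pullback (f := fun y => ch (Eu n) (f z₀) (f y))
      ((hβ (f z₀)).differentiableAt (by simp)) (contDiffAt_ch_comp hf) (r := ∞)
      (by rw [minSmoothness_of_isRCLikeNormedField]; exact ENat.LEInfty.out),
    ← md_eq_fderiv, md_comp (smoothAt_ch_self (f z₀)) hf, md_ch_self]
  ext v
  have := congrArg (fun a => a.compContinuousLinearMap (md E (Eu n) f z₀)) (extD_eq β (f z₀))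
  exact (DFunLike.congr_fun this v).symm

theorem contDiffAt_extDeriv [FiniteDimensional ℝ E] [FiniteDimensional ℝ V]
    {β : E → E [⋀^Fin k]→L[ℝ] V} {z : E} (h : ContDiffAt ℝ ∞ β z) :
    ContDiffAt ℝ ∞ (extDeriv β) z := by
  refine contDiffAt_alternating_iff.2 fun v => ?_
  simp only [extDeriv, ContinuousAlternatingMap.alternatizeUncurryFin_apply]
  refine ContDiffAt.sum fun i _ => ContDiffAt.const_smul _ ?_
  exact contDiffAt_alternating_iff.1
    ((h.fderiv_right (m := ∞) (by simp)).clm_apply contDiffAt_const) _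

theorem SmoothForm.extD [FiniteDimensional ℝ V] {β : M → Eu n [⋀^Fin k]→L[ℝ] V}
    (hβ : SmoothForm β) :
    SmoothForm (extD (n := n) (M := M) β : M → Eu n [⋀^Fin (k + 1)]→L[ℝ] V) := by
  intro x
  refine (contDiffAt_extDeriv (hβ x)).congr_of_eventuallyEq ?_
  filter_upwards [eventually_ch_target (E := Eu n) x] with z hz
  exact (extDeriv_pb hβ (smoothAt_ch_symm hz)).symm

end FormsTools

/-! ### Sections of tensor bundles in charts -/

section Sections

variable {n : ℕ} {M : Type*} [TopologicalSpace M] [ChartedSpace (Eu n) M] [IsManifold (𝓡 n) ∞ M]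
  {V : Type*} [NormedAddCommGroup V] [NormedSpace ℝ V]

/-- The derivative of the inverse of the chart at `x`. -/
abbrev dsym (x : M) (z : Eu n) : Eu n →L[ℝ] Eu n := md (Eu n) (Eu n) (ch (Eu n) x).symm z

/-- The derivative of the chart at `x`, at the point with coordinates `z`. -/
abbrev dch (x : M) (z : Eu n) : Eu n →L[ℝ] Eu n :=
  md (Eu n) (Eu n) (ch (Eu n) x) ((ch (Eu n) x).symm z)

theorem contDiffAt_congr_iff {E F : Type*} [NormedAddCommGroup E] [NormedSpace ℝ E]
    [NormedAddCommGroup F] [NormedSpace ℝ F] {f g : E → F} {z : E} (h : f =ᶠ[𝓝 z] g) :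
    ContDiffAt ℝ ∞ f z ↔ ContDiffAt ℝ ∞ g z :=
  ⟨fun hf => hf.congr_of_eventuallyEq h.symm, fun hg => hg.congr_of_eventuallyEq h⟩

theorem smoothAt_iff_comp_symm {f : M → V} {x : M} :
    SmoothAt (Eu n) V f x ↔
      ContDiffAt ℝ ∞ (fun z => f ((ch (Eu n) x).symm z)) (ch (Eu n) x x) := by
  constructor
  · intro h
    refine smoothAt_iff_contDiffAt.1 (ContMDiffAt.comp (ch (Eu n) x x) ?_ (smoothAt_ch_symm_self x))
    rw [extChartAt_to_inv]
    exact h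
  · intro h
    have h1 : SmoothAt (Eu n) V (fun y => f ((ch (Eu n) x).symm (ch (Eu n) x y))) x :=
      ContMDiffAt.comp x (g := fun z => f ((ch (Eu n) x).symm z)) (smoothAt_iff_contDiffAt.2 h)
        (smoothAt_ch_self x)
    refine h1.congr_of_eventuallyEq ?_
    filter_upwards [eventually_ch_source (E := Eu n) x] with y hy
    rw [(ch (Eu n) x).left_inv hy]

/-- The preferred trivialisation of the tangent bundle is the derivative of the preferred chart.
-/
theorem trivialization_apply_snd {x y : M} (hy : y ∈ (ch (Eu n) x).source) (v : Tan n y) :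
    (trivializationAt (Eu n) (TangentSpace (𝓡 n) : M → Type _) x
      (⟨y, v⟩ : TangentBundle (𝓡 n) M)).2 = md (Eu n) (Eu n) (ch (Eu n) x) y v := by
  have : IsManifold (𝓡 n) 1 M := IsManifold.of_le (n := ∞) (by simp)
  have hy' : y ∈ (chartAt (Eu n) x).source := by simpa using hy
  have h := TangentBundle.continuousLinearMapAt_trivializationAt (I := 𝓡 n) hy'
  have hb : y ∈ (trivializationAt (Eu n) (TangentSpace (𝓡 n) : M → Type _) x).baseSet := hy'
  have h2 := DFunLike.congr_fun h v
  rw [Trivialization.continuousLinearMapAt_apply, Trivialization.coe_linearMapAt_of_mem _ hb] at h2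
  exact h2

/-- A vector field is smooth at `x` if and only if its coordinate expression in the chart at `x`
is. -/
theorem contMDiffAt_vectorField_iff {X : ∀ y : M, Tan n y} {x : M} :
    ContMDiffAt (𝓡 n) (𝓡 n).tangent ∞ (fun y => (⟨y, X y⟩ : TangentBundle (𝓡 n) M)) x ↔
      ContDiffAt ℝ ∞ (fun z => dch x z (X ((ch (Eu n) x).symm z))) (ch (Eu n) x x) := by
  refine contMDiffAt_totalSpace.trans ((and_iff_right contMDiffAt_id).trans ?_)
  refine Iff.trans (Filter.EventuallyEq.contMDiffAt_iff ?_) (smoothAt_iff_comp_symm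
    (f := fun y => md (Eu n) (Eu n) (ch (Eu n) x) y (X y)))
  filter_upwards [eventually_ch_source (E := Eu n) x] with y hy
  exact trivialization_apply_snd hy (X y)

/-- A field of endomorphisms is smooth at `x` if and only if its coordinate expression in the
chart at `x` is. -/
theorem contMDiffAt_endomorphism_iff {φ : ∀ y : M, Tan n y →L[ℝ] Tan n y} {x : M} :
    ContMDiffAt (𝓡 n) ((𝓡 n).prod 𝓘(ℝ, Eu n →L[ℝ] Eu n)) ∞
      (fun x => TotalSpace.mk' (Eu n →L[ℝ] Eu n) (E := fun x : M => Tan n x →L[ℝ] Tan n x) x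
        (φ x)) x ↔
      ContDiffAt ℝ ∞ (fun z => (dch x z).comp
        ((φ ((ch (Eu n) x).symm z) : Eu n →L[ℝ] Eu n).comp (dsym x z))) (ch (Eu n) x x) := by
  have : IsManifold (𝓡 n) 1 M := IsManifold.of_le (n := ∞) (by simp)
  refine (contMDiffAt_hom_bundle _).trans ((and_iff_right contMDiffAt_id).trans ?_)
  refine (Iff.trans (Filter.EventuallyEq.contMDiffAt_iff ?_) (smoothAt_iff_comp_symm
    (f := fun y => (md (Eu n) (Eu n) (ch (Eu n) x) y).comp
      ((φ y : Eu n →L[ℝ] Eu n).comp (dsym x (ch (Eu n) x y)))))).trans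
    (contDiffAt_congr_iff ?_)
  · filter_upwards [eventually_ch_source (E := Eu n) x] with y hy
    have hy' : y ∈ (chartAt (Eu n) x).source := by simpa using hy
    have h1 := TangentBundle.continuousLinearMapAt_trivializationAt (I := 𝓡 n) hy'
    have h2 := TangentBundle.symmL_trivializationAt (I := 𝓡 n) hy'
    rw [show Set.range (𝓡 n) = Set.univ from (𝓡 n).range_eq_univ, mfderivWithin_univ] at h2
    change ContinuousLinearMap.comp _ (ContinuousLinearMap.comp _ _) = _
    erw [h1, h2]
    rfl
  · filter_upwards [eventually_ch_target (E := Eu n) x] with z hz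
    rw [(ch (Eu n) x).right_inv hz]

/-- A field of bilinear forms is smooth at `x` if and only if its coordinate expression in the
chart at `x` is. -/
theorem contMDiffAt_bilinear_iff {g : ∀ y : M, Tan n y →L[ℝ] Tan n y →L[ℝ] ℝ} {x : M} :
    ContMDiffAt (𝓡 n) ((𝓡 n).prod 𝓘(ℝ, Eu n →L[ℝ] Eu n →L[ℝ] ℝ)) ∞
      (fun x => TotalSpace.mk' (Eu n →L[ℝ] Eu n →L[ℝ] ℝ)
        (E := fun x : M => Tan n x →L[ℝ] Tan n x →L[ℝ] ℝ) x (g x)) x ↔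
      ContDiffAt ℝ ∞ (fun z => (g ((ch (Eu n) x).symm z) : Eu n →L[ℝ] Eu n →L[ℝ] ℝ).bilinearComp
        (dsym x z) (dsym x z)) (ch (Eu n) x x) := by
  have : IsManifold (𝓡 n) 1 M := IsManifold.of_le (n := ∞) (by simp)
  refine (contMDiffAt_hom_bundle _).trans ((and_iff_right contMDiffAt_id).trans ?_)
  refine (Iff.trans (Filter.EventuallyEq.contMDiffAt_iff ?_) (smoothAt_iff_comp_symm
    (f := fun y => (g y : Eu n →L[ℝ] Eu n →L[ℝ] ℝ).bilinearComp (dsym x (ch (Eu n) x y))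
      (dsym x (ch (Eu n) x y))))).trans (contDiffAt_congr_iff ?_)
  · filter_upwards [eventually_ch_source (E := Eu n) x] with y hy
    have hy' : y ∈ (chartAt (Eu n) x).source := by simpa using hy
    have h2 := TangentBundle.symmL_trivializationAt (I := 𝓡 n) hy'
    rw [show Set.range (𝓡 n) = Set.univ from (𝓡 n).range_eq_univ, mfderivWithin_univ] at h2
    ext u v
    have h3 := fun w => DFunLike.congr_fun h2 w
    refine (inCoordinates_apply_eq₂ (E₁ := fun x : M => Tan n x) (E₂ := fun x : M => Tan n x)
      (E₃ := Bundle.Trivial M ℝ) hy' hy' (Set.mem_univ _)).trans ?_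
    have h4 : ∀ w : Eu n, (trivializationAt (Eu n) (TangentSpace (𝓡 n) : M → Type _) x).symm y w =
      dsym x (ch (Eu n) x y) w :=
      fun w => (Trivialization.symmL_apply (R := ℝ) _ hy' w).symm.trans (h3 w)
    rw [Trivialization.coe_linearMapAt_of_mem _ (Set.mem_univ _), h4, h4]
    rfl
  · filter_upwards [eventually_ch_target (E := Eu n) x] with z hz
    rw [(ch (Eu n) x).right_inv hz]

end Sections

/-! ### Normality and the Killing equation in coordinates -/

section Euclid

variable {E V : Type*} [NormedAddCommGroup E] [NormedSpace ℝ E] [NormedAddCommGroup V]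
  [NormedSpace ℝ V]

/-- The Sasaki--Hatakeyama tensor of `(φ, ξ, η)` on an open set of a normed space, evaluated on
constant vector fields. -/
def nij (φ : E → E →L[ℝ] E) (ξ : E → E) (η : E → E →L[ℝ] ℝ) (z u v : E) : E :=
  fderiv ℝ φ z (φ z u) v - fderiv ℝ φ z (φ z v) u + φ z (fderiv ℝ φ z v u)
    - φ z (fderiv ℝ φ z u v) + (fderiv ℝ η z u v - fderiv ℝ η z v u) • ξ z

/-- The Lie derivative `ℒ_ξ g` on an open set of a normed space. -/
def lieMetric (g : E → E →L[ℝ] E →L[ℝ] ℝ) (ξ : E → E) (z u v : E) : ℝ :=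
  fderiv ℝ g z (ξ z) u v + g z (fderiv ℝ ξ z u) v + g z u (fderiv ℝ ξ z v)

theorem extDeriv_ofSubsingleton {α : E → E →L[ℝ] V} {z : E} (h : DifferentiableAt ℝ α z) (u v : E) :
    extDeriv (fun y => ContinuousAlternatingMap.ofSubsingleton ℝ E V (0 : Fin 1) (α y)) z ![u, v] =
      fderiv ℝ α z u v - fderiv ℝ α z v u := by
  have h1 : HasFDerivAt
      (fun y => ContinuousAlternatingMap.ofSubsingleton ℝ E V (0 : Fin 1) (α y))
      (((ContinuousAlternatingMap.ofSubsingletonLIE (𝕜 := ℝ) (E := E) (F := V) (0 : Fin 1)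
        ).toContinuousLinearEquiv.toContinuousLinearMap).comp (fderiv ℝ α z)) z :=
    ((ContinuousAlternatingMap.ofSubsingletonLIE (𝕜 := ℝ) (E := E) (F := V) (0 : Fin 1)
      ).toContinuousLinearEquiv.toContinuousLinearMap.hasFDerivAt).comp z h.hasFDerivAt
  rw [extDeriv, h1.fderiv, ContinuousAlternatingMap.alternatizeUncurryFin_apply]
  simp [Fin.sum_univ_two, sub_eq_add_neg]
  rfl

/-- The normality expression is tensorial: the derivatives of the vector fields cancel. -/
theorem nij_apply_vectorField {φ : E → E →L[ℝ] E} {ξ : E → E} {η : E → E →L[ℝ] ℝ} {z : E}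
    (hφ : DifferentiableAt ℝ φ z) {X Y : E → E} (hX : DifferentiableAt ℝ X z)
    (hY : DifferentiableAt ℝ Y z) :
    lieBracket ℝ (fun y => φ y (X y)) (fun y => φ y (Y y)) z
      + φ z (φ z (lieBracket ℝ X Y z)) - φ z (lieBracket ℝ (fun y => φ y (X y)) Y z)
      - φ z (lieBracket ℝ X (fun y => φ y (Y y)) z)
      + (fderiv ℝ η z (X z) (Y z) - fderiv ℝ η z (Y z) (X z)) • ξ z = nij φ ξ η z (X z) (Y z) := by
  have h : ∀ {X : E → E}, DifferentiableAt ℝ X z → ∀ w,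
      fderiv ℝ (fun y => φ y (X y)) z w = fderiv ℝ φ z w (X z) + φ z (fderiv ℝ X z w) := by
    intro X hX w
    rw [(hφ.hasFDerivAt.clm_apply hX.hasFDerivAt).fderiv]
    simp [add_comm]
  simp only [lieBracket, h hX, h hY, nij, map_sub, map_add]
  abel

/-- The Killing expression is tensorial: the derivatives of the vector fields cancel. -/
theorem lieMetric_apply_vectorField {g : E → E →L[ℝ] E →L[ℝ] ℝ} {ξ : E → E} {z : E}
    (hg : DifferentiableAt ℝ g z) {X Y : E → E} (hX : DifferentiableAt ℝ X z)
    (hY : DifferentiableAt ℝ Y z) :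
    fderiv ℝ (fun y => g y (X y) (Y y)) z (ξ z) - (g z (lieBracket ℝ ξ X z) (Y z)
      + g z (X z) (lieBracket ℝ ξ Y z)) = lieMetric g ξ z (X z) (Y z) := by
  rw [((hg.hasFDerivAt.clm_apply hX.hasFDerivAt).clm_apply hY.hasFDerivAt).fderiv]
  simp [lieBracket, lieMetric]
  abel

end Euclid

section Fields

variable {n : ℕ} {M : Type*} [TopologicalSpace M] [ChartedSpace (Eu n) M] [IsManifold (𝓡 n) ∞ M]

/-- The coordinate expression of a vector field in the chart at `x`. -/
def coordVF (X : M → Eu n) (x : M) (z : Eu n) : Eu n := dch x z (X ((ch (Eu n) x).symm z))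

theorem coordVF_self (X : M → Eu n) (x : M) : coordVF X x (ch (Eu n) x x) = X x := by
  rw [coordVF, dch, (ch (Eu n) x).left_inv (mem_extChartAt_source x), md_ch_self]
  rfl

/-- The Lie bracket of vector fields, as a field of vectors of the model space. -/
def bracketE (X Y : M → Eu n) (x : M) : Eu n := mlieBracket (𝓡 n) (M := M) X Y x

/-- The Lie bracket at the base point of a chart is that of the coordinate expressions. -/
theorem bracketE_eq (X Y : M → Eu n) (x : M) :
    bracketE X Y x =
      lieBracket ℝ (coordVF X x) (coordVF Y x) (ch (Eu n) x x) := by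
  have key : ∀ Z : ∀ y : M, Tan n y,
      mpullbackWithin 𝓘(ℝ, Eu n) (𝓡 n) (extChartAt (𝓡 n) x).symm Z (Set.range (𝓡 n))
        =ᶠ[𝓝 (ch (Eu n) x x)] coordVF Z x := by
    intro Z
    filter_upwards [eventually_ch_target (E := Eu n) x] with z hz
    rw [mpullbackWithin_apply, (𝓡 n).range_eq_univ, mfderivWithin_univ]
    have h1 : (dsym x z).inverse = dch x z := by
      refine ContinuousLinearMap.inverse_eq ?_ ?_
      · ext1 v; exact md_symm_md_ch hz v
      · ext1 v; exact md_ch_md_symm hz v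
    exact DFunLike.congr_fun h1 _
  have h2 : bracketE X Y x = (md (Eu n) (Eu n) (ch (Eu n) x) x).inverse
      (lieBracketWithin ℝ
        (mpullbackWithin 𝓘(ℝ, Eu n) (𝓡 n) (extChartAt (𝓡 n) x).symm X (Set.range (𝓡 n)))
        (mpullbackWithin 𝓘(ℝ, Eu n) (𝓡 n) (extChartAt (𝓡 n) x).symm Y (Set.range (𝓡 n)))
        ((extChartAt (𝓡 n) x).symm ⁻¹' Set.univ ∩ Set.range (𝓡 n)) (ch (Eu n) x x)) := by
    rfl
  have h3 : (extChartAt (𝓡 n) x).symm ⁻¹' Set.univ ∩ Set.range (𝓡 n) = Set.univ := by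
    rw [(𝓡 n).range_eq_univ]; simp
  rw [h2, md_ch_self, ContinuousLinearMap.inverse_id]
  erw [h3]
  exact (congrFun lieBracketWithin_univ _).trans ((key X).lieBracket_vectorField_eq (key Y))

/-- A tangent vector extends to a global smooth vector field. The bump function used to extend by
zero needs `M` to be Hausdorff. -/
theorem exists_smoothVF_eq [T2Space M] (x : M) (u : Tan n x) :
    ∃ X : ∀ y : M, Tan n y, IsSmoothVF X ∧ X x = u := by
  obtain ⟨s, hs, hsm⟩ := FiberBundle.exists_contMDiffOn_extend (𝓡 n) (Eu n) (k := ∞)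
    (V := (TangentSpace (𝓡 n) : M → Type _)) u
  obtain ⟨f, -, hf⟩ := (SmoothBumpFunction.nhds_basis_tsupport (I := 𝓡 n) x).mem_iff.1
    (interior_mem_nhds.2 hs)
  refine ⟨fun y => f y • FiberBundle.extend (Eu n) u y, ?_, ?_⟩
  · exact ContMDiffOn.smul_section_of_tsupport f.contMDiff.contMDiffOn isOpen_interior hf
      (hsm.mono interior_subset)
  · simp

end Fields

namespace AlmostContactMetric

variable {n : ℕ} {M : Type*} [TopologicalSpace M] [ChartedSpace (Eu n) M]
  [IsManifold (𝓡 n) ∞ M] (S : AlmostContactMetric n M)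

/-- The metric as a field of bilinear forms on the model space. -/
def gE (x : M) : Eu n →L[ℝ] Eu n →L[ℝ] ℝ := S.metric.inner x

/-- The endomorphism `φ` as a field of endomorphisms of the model space. -/
def phiE (x : M) : Eu n →L[ℝ] Eu n := S.phi x

/-- The Reeb field as a field of vectors of the model space. -/
def reebE (x : M) : Eu n := S.reeb x

/-- The form `dη` as a field of forms on the model space. -/
def dEtaE (x : M) : Eu n [⋀^Fin 2]→L[ℝ] ℝ := S.dEta x

/-- The coordinate expression of the metric in the chart at `x`. -/
def metricC (x : M) (z : Eu n) : Eu n →L[ℝ] Eu n →L[ℝ] ℝ :=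
  (S.gE ((ch (Eu n) x).symm z)).bilinearComp (dsym x z) (dsym x z)

/-- The coordinate expression of `φ` in the chart at `x`. -/
def phiC (x : M) (z : Eu n) : Eu n →L[ℝ] Eu n :=
  (dch x z).comp ((S.phiE ((ch (Eu n) x).symm z)).comp (dsym x z))

/-- The coordinate expression of the Reeb field in the chart at `x`. -/
def reebC (x : M) (z : Eu n) : Eu n := coordVF S.reebE x z

/-- The coordinate expression of `η` in the chart at `x`. -/
def etaC (x : M) (z : Eu n) : Eu n →L[ℝ] ℝ := S.metricC x z (S.reebC x z)

theorem contDiffAt_metricC (x : M) : ContDiffAt ℝ ∞ (S.metricC x) (ch (Eu n) x x) :=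
  contMDiffAt_bilinear_iff.1 (S.metric.contMDiff x)

theorem contDiffAt_phiC (x : M) : ContDiffAt ℝ ∞ (S.phiC x) (ch (Eu n) x x) :=
  contMDiffAt_endomorphism_iff.1 (S.phi_smooth x)

theorem contDiffAt_reebC (x : M) : ContDiffAt ℝ ∞ (S.reebC x) (ch (Eu n) x x) :=
  contMDiffAt_vectorField_iff.1 (S.reeb_smooth x)

theorem contDiffAt_etaC (x : M) : ContDiffAt ℝ ∞ (S.etaC x) (ch (Eu n) x x) :=
  (S.contDiffAt_metricC x).clm_apply (S.contDiffAt_reebC x)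

theorem phiC_self (x : M) : S.phiC x (ch (Eu n) x x) = S.phiE x := by
  rw [phiC, dch, dsym, (ch (Eu n) x).left_inv (mem_extChartAt_source x), md_ch_self,
    md_ch_symm_self]
  rfl

theorem metricC_self (x : M) : S.metricC x (ch (Eu n) x x) = S.gE x := by
  rw [metricC, dsym, (ch (Eu n) x).left_inv (mem_extChartAt_source x), md_ch_symm_self]
  rfl

theorem reebC_self (x : M) : S.reebC x (ch (Eu n) x x) = S.reebE x := coordVF_self _ x

theorem dsym_reebC (x : M) {z : Eu n} (hz : z ∈ (ch (Eu n) x).target) :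
    dsym x z (S.reebC x z) = S.reebE ((ch (Eu n) x).symm z) := md_symm_md_ch hz _

theorem etaC_apply (x : M) {z : Eu n} (hz : z ∈ (ch (Eu n) x).target) (v : Eu n) :
    S.etaC x z v = S.gE ((ch (Eu n) x).symm z) (S.reebE ((ch (Eu n) x).symm z)) (dsym x z v) := by
  rw [← S.dsym_reebC x hz]; rfl

theorem coordVF_phi (X : M → Eu n) (x : M) {z : Eu n} (hz : z ∈ (ch (Eu n) x).target) :
    coordVF (fun y => S.phiE y (X y)) x z = S.phiC x z (coordVF X x z) := by
  simp only [coordVF, phiC, ContinuousLinearMap.comp_apply]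
  rw [md_symm_md_ch hz]

/-- The form `η` in coordinates. -/
theorem pb_eta (x : M) : (pb (n := n) (M := M) (toForm S.eta) (ch (Eu n) x).symm)
    =ᶠ[𝓝 (ch (Eu n) x x)] fun z =>
      ContinuousAlternatingMap.ofSubsingleton ℝ (Eu n) ℝ (0 : Fin 1) (S.etaC x z) := by
  filter_upwards [eventually_ch_target (E := Eu n) x] with z hz
  ext v
  exact (S.etaC_apply x hz (v 0)).symm

theorem smoothForm_eta : SmoothForm (n := n) (M := M) (toForm S.eta) := by
  intro x
  refine ContDiffAt.congr_of_eventuallyEq ?_ (S.pb_eta x)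
  exact contDiffAt_alternating_iff.2 fun v => (S.contDiffAt_etaC x).clm_apply contDiffAt_const

theorem dEta_apply (x : M) (u v : Eu n) : S.dEtaE x ![u, v] =
    fderiv ℝ (S.etaC x) (ch (Eu n) x x) u v - fderiv ℝ (S.etaC x) (ch (Eu n) x x) v u := by
  have h := extD_eq (n := n) (M := M) (toForm S.eta) x
  rw [(S.pb_eta x).extDeriv_eq] at h
  rw [← extDeriv_ofSubsingleton ((S.contDiffAt_etaC x).differentiableAt (by simp)), ← h]
  rfl

/-- The normality tensor at the centre of a chart. -/
theorem sasakiHatakeyama_eq {X Y : M → Eu n} (hX : IsSmoothVF (n := n) (M := M) X)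
    (hY : IsSmoothVF (n := n) (M := M) Y) (x : M) :
    bracketE (fun y => S.phiE y (X y)) (fun y => S.phiE y (Y y)) x
      + S.phiE x (S.phiE x (bracketE X Y x)) - S.phiE x (bracketE (fun y => S.phiE y (X y)) Y x)
      - S.phiE x (bracketE X (fun y => S.phiE y (Y y)) x)
      + S.dEtaE x ![X x, Y x] • S.reebE x =
    nij (S.phiC x) (S.reebC x) (S.etaC x) (ch (Eu n) x x) (X x) (Y x) := by
  have hX' : DifferentiableAt ℝ (coordVF X x) (ch (Eu n) x x) :=
    (contMDiffAt_vectorField_iff.1 (hX x)).differentiableAt (by simp)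
  have hY' : DifferentiableAt ℝ (coordVF Y x) (ch (Eu n) x x) :=
    (contMDiffAt_vectorField_iff.1 (hY x)).differentiableAt (by simp)
  have hφ := (S.contDiffAt_phiC x).differentiableAt (by simp)
  have e : ∀ Z : M → Eu n, coordVF (fun y => S.phiE y (Z y)) x =ᶠ[𝓝 (ch (Eu n) x x)]
      fun z => S.phiC x z (coordVF Z x z) := by
    intro Z
    filter_upwards [eventually_ch_target (E := Eu n) x] with z hz
    exact S.coordVF_phi Z x hz
  have h := nij_apply_vectorField (ξ := S.reebC x) (η := S.etaC x) hφ hX' hY'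
  rw [bracketE_eq, bracketE_eq, bracketE_eq, bracketE_eq, (e X).lieBracket_vectorField_eq (e Y),
    (e X).lieBracket_vectorField_eq (Filter.EventuallyEq.refl _ _),
    Filter.EventuallyEq.lieBracket_vectorField_eq (Filter.EventuallyEq.refl _ _) (e Y),
    S.dEta_apply]
  rw [coordVF_self, coordVF_self, phiC_self] at h
  rw [← h, reebC_self]

/-- Normality may be checked pointwise, at the base point of each chart. -/
theorem isNormal_of_nij (h : ∀ x u v,
    nij (S.phiC x) (S.reebC x) (S.etaC x) (ch (Eu n) x x) u v = 0) : S.IsNormal :=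
  fun _ _ hX hY x => (S.sasakiHatakeyama_eq hX hY x).trans (h x _ _)

theorem nij_eq_zero [T2Space M] {S : AlmostContactMetric n M} (h : S.IsNormal) (x : M)
    (u v : Eu n) : nij (S.phiC x) (S.reebC x) (S.etaC x) (ch (Eu n) x x) u v = 0 := by
  obtain ⟨X, hX, rfl⟩ := exists_smoothVF_eq (n := n) x u
  obtain ⟨Y, hY, rfl⟩ := exists_smoothVF_eq (n := n) x v
  exact (S.sasakiHatakeyama_eq hX hY x).symm.trans (h X Y hX hY x)

/-- The Lie derivative of the metric along the Reeb field at the base point of a chart. -/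
theorem lieMetric_eq {X Y : M → Eu n} (hX : IsSmoothVF (n := n) (M := M) X)
    (hY : IsSmoothVF (n := n) (M := M) Y) (x : M) :
    md (Eu n) ℝ (fun y => S.gE y (X y) (Y y)) x (S.reebE x) -
      (S.gE x (bracketE S.reebE X x) (Y x) + S.gE x (X x) (bracketE S.reebE Y x)) =
      lieMetric (S.metricC x) (S.reebC x) (ch (Eu n) x x) (X x) (Y x) := by
  have hX' : DifferentiableAt ℝ (coordVF X x) (ch (Eu n) x x) :=
    (contMDiffAt_vectorField_iff.1 (hX x)).differentiableAt (by simp)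
  have hY' : DifferentiableAt ℝ (coordVF Y x) (ch (Eu n) x x) :=
    (contMDiffAt_vectorField_iff.1 (hY x)).differentiableAt (by simp)
  have hg := S.contDiffAt_metricC x
  have h := lieMetric_apply_vectorField (ξ := S.reebC x) (hg.differentiableAt (by simp)) hX' hY'
  rw [coordVF_self, coordVF_self, metricC_self] at h
  have e : (fun z => S.metricC x z (coordVF X x z) (coordVF Y x z)) =ᶠ[𝓝 (ch (Eu n) x x)]
      fun z => S.gE ((ch (Eu n) x).symm z) (X ((ch (Eu n) x).symm z))
        (Y ((ch (Eu n) x).symm z)) := by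
    filter_upwards [eventually_ch_target (E := Eu n) x] with z hz
    simp only [metricC, coordVF, ContinuousLinearMap.bilinearComp_apply]
    rw [md_symm_md_ch hz, md_symm_md_ch hz]
  have hs : SmoothAt (Eu n) ℝ (fun y => S.gE y (X y) (Y y)) x := by
    refine smoothAt_iff_comp_symm.2 (ContDiffAt.congr_of_eventuallyEq ?_ e.symm)
    exact (hg.clm_apply (contMDiffAt_vectorField_iff.1 (hX x))).clm_apply
      (contMDiffAt_vectorField_iff.1 (hY x))
  have hd : fderiv ℝ (fun z => S.metricC x z (coordVF X x z) (coordVF Y x z)) (ch (Eu n) x x) =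
      md (Eu n) ℝ (fun y => S.gE y (X y) (Y y)) x := by
    rw [e.fderiv_eq, ← md_eq_fderiv, md_comp (f := (ch (Eu n) x).symm)
      (g := fun y => S.gE y (X y) (Y y)) (by rwa [(ch (Eu n) x).left_inv
        (mem_extChartAt_source x)]) (smoothAt_ch_symm_self x), md_ch_symm_self,
      (ch (Eu n) x).left_inv (mem_extChartAt_source x)]
    rfl
  rw [bracketE_eq, bracketE_eq, ← h, hd, reebC_self]
  rfl

theorem reebKilling_of_lieMetric (h : ∀ x u v,
    lieMetric (S.metricC x) (S.reebC x) (ch (Eu n) x x) u v = 0) : S.ReebKilling :=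
  fun _ _ hX hY x => sub_eq_zero.1 ((S.lieMetric_eq hX hY x).trans (h x _ _))

theorem lieMetric_eq_zero [T2Space M] {S : AlmostContactMetric n M}
    (h : S.ReebKilling) (x : M) (u v : Eu n) :
    lieMetric (S.metricC x) (S.reebC x) (ch (Eu n) x x) u v = 0 := by
  obtain ⟨X, hX, rfl⟩ := exists_smoothVF_eq (n := n) x u
  obtain ⟨Y, hY, rfl⟩ := exists_smoothVF_eq (n := n) x v
  exact (S.lieMetric_eq hX hY x).symm.trans (sub_eq_zero.2 (h X Y hX hY x))

end AlmostContactMetric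

/-! ### Differential calculus of horizontal lifts -/

section Lift

variable {E W A F : Type*} [NormedAddCommGroup E] [NormedSpace ℝ E]
  [NormedAddCommGroup W] [NormedSpace ℝ W] [NormedAddCommGroup A] [NormedSpace ℝ A]
  [NormedAddCommGroup F] [NormedSpace ℝ F]

theorem minSmoothness_two_le : minSmoothness ℝ 2 ≤ ∞ := by
  rw [minSmoothness_of_isRCLikeNormedField]; exact ENat.LEInfty.out

theorem alternating_two_swap (β : W [⋀^Fin 2]→L[ℝ] F) (a b : W) : β ![a, b] = -β ![b, a] := by
  have h := β.toAlternatingMap.map_swap ![b, a] (i := 0) (j := 1) (by decide)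
  rw [show ![b, a] ∘ ⇑(Equiv.swap (0 : Fin 2) 1) = ![a, b] by
    ext1 i; fin_cases i <;> simp] at h
  exact h

theorem alternating_three_swap (β : W [⋀^Fin 3]→L[ℝ] F) (a b c : W) :
    β ![a, b, c] = -β ![b, a, c] := by
  have h := β.toAlternatingMap.map_swap ![b, a, c] (i := 0) (j := 1) (by decide)
  rw [show ![b, a, c] ∘ ⇑(Equiv.swap (0 : Fin 3) 1) = ![a, b, c] by
    ext1 i; fin_cases i <;> simp [Equiv.swap_apply_def]] at h
  exact h

theorem alternating_three_swap' (β : W [⋀^Fin 3]→L[ℝ] F) (a b c : W) :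
    β ![a, b, c] = -β ![a, c, b] := by
  have h := β.toAlternatingMap.map_swap ![a, c, b] (i := 1) (j := 2) (by decide)
  rw [show ![a, c, b] ∘ ⇑(Equiv.swap (1 : Fin 3) 2) = ![a, b, c] by
    ext1 i; fin_cases i <;> simp [Equiv.swap_apply_def]] at h
  exact h

theorem hasFDerivAt_apply_const {f : E → W →L[ℝ] F} {f' : E →L[ℝ] W →L[ℝ] F} {z : E}
    (h : HasFDerivAt f f' z) (u : W) : HasFDerivAt (fun y => f y u) (f'.flip u) z :=
  (ContinuousLinearMap.apply ℝ F u).hasFDerivAt.comp z h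

/-- A lift `L` of the tangent vectors of `E` along `σ : E → W`, which at `z` coincides with the
derivative of `σ` and whose derivative at `z` differs from the second derivative of `σ` by
`f ∘ K`, where `f : A → W` is the infinitesimal action and `K` is the derivative at `z` of the
local connection form. -/
structure IsLiftAt (σ : E → W) (L : E → E →L[ℝ] W) (f : A →L[ℝ] W) (K : E →L[ℝ] E →L[ℝ] A)
    (z : E) : Prop where
  smooth : ContDiffAt ℝ ∞ σ z
  diff : DifferentiableAt ℝ L z
  eq : L z = fderiv ℝ σ z
  fderiv_eq : ∀ w u, fderiv ℝ L z w u = fderiv ℝ (fderiv ℝ σ) z w u - f (K w u)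

variable {σ : E → W} {L : E → E →L[ℝ] W} {f : A →L[ℝ] W} {K : E →L[ℝ] E →L[ℝ] A} {z : E}

namespace IsLiftAt

theorem differentiableAt (h : IsLiftAt σ L f K z) : DifferentiableAt ℝ σ z :=
  h.smooth.differentiableAt (by simp)

/-- The second derivative of `σ` being symmetric, only the curvature `R = K - Kᵗ` enters the
antisymmetrisation of the derivative of `L`. -/
theorem fderiv_swap (h : IsLiftAt σ L f K z) (w u : E) :
    fderiv ℝ L z w u - fderiv ℝ L z u w = -f (K w u - K u w) := by
  have hs := (h.smooth.isSymmSndFDerivAt minSmoothness_two_le) w u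
  rw [h.fderiv_eq, h.fderiv_eq, hs, map_sub]
  abel

/-- The exterior derivative of a form evaluated on lifted vectors: the pull-back formula for `σ`,
corrected by the difference between the derivatives of `L` and of `dσ`. -/
theorem extDeriv_comp (h : IsLiftAt σ L f K z) {k : ℕ} {β : W → W [⋀^Fin k]→L[ℝ] F}
    (hβ : DifferentiableAt ℝ β (σ z)) (v : Fin (k + 1) → E) :
    extDeriv (fun y => (β (σ y)).compContinuousLinearMap (L y)) z v =
      extDeriv β (σ z) (fun i => L z (v i)) -
      ∑ i : Fin (k + 1), (-1) ^ (i : ℕ) • ∑ j, β (σ z)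
        (Function.update (fun l => L z (i.removeNth v l)) j
          (f (K (v i) (i.removeNth v j)))) := by
  have hσ2 : DifferentiableAt ℝ (fderiv ℝ σ) z :=
    (h.smooth.fderiv_right (m := ∞) (by simp)).differentiableAt (by simp)
  have hβσ : DifferentiableAt ℝ (fun y => β (σ y)) z := hβ.comp z h.differentiableAt
  have h1 := extDeriv_pullback hβ h.smooth (r := ∞) minSmoothness_two_le
  have h2 := fderiv_continuousAlternatingMapCompContinuousLinearMap hβσ hσ2
  have h3 := fderiv_continuousAlternatingMapCompContinuousLinearMap hβσ h.diff
  have h4 := DFunLike.congr_fun h1 v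
  have h5 : ∀ w, fderiv ℝ L z w = fderiv ℝ (fderiv ℝ σ) z w - f.comp (K w) := fun w => by
    ext1 u; exact h.fderiv_eq w u
  rw [extDeriv, h2, ContinuousAlternatingMap.alternatizeUncurryFin_apply] at h4
  rw [extDeriv, h3, ContinuousAlternatingMap.alternatizeUncurryFin_apply, h.eq]
  simp only [add_apply, ContinuousLinearMap.comp_apply, h5, map_sub,
    ContinuousAlternatingMap.add_apply, ContinuousAlternatingMap.sub_apply] at h4 ⊢
  rw [ContinuousAlternatingMap.compContinuousLinearMap_apply] at h4
  rw [show (fun i => fderiv ℝ σ z (v i)) = ⇑(fderiv ℝ σ z) ∘ v from rfl, ← h4,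
    ← Finset.sum_sub_distrib]
  refine Finset.sum_congr rfl fun i _ => ?_
  rw [← smul_sub, add_sub_assoc']
  congr 2
  rw [ContinuousAlternatingMap.fderivCompContinuousLinearMap_apply]
  refine Finset.sum_congr rfl fun j _ => ?_
  congr 1
  ext1 l
  by_cases hl : l = j
  · subst hl; simp
  · simp [hl]

theorem extDeriv_comp_two (h : IsLiftAt σ L f K z) {β : W → W [⋀^Fin 2]→L[ℝ] F}
    (hβ : DifferentiableAt ℝ β (σ z)) (v : Fin 3 → E) {R : E → E → A}
    (hR : ∀ u v, R u v = K u v - K v u) :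
    extDeriv (fun y => (β (σ y)).compContinuousLinearMap (L y)) z v =
      extDeriv β (σ z) (fun i => L z (v i)) -
      (β (σ z) ![f (R (v 0) (v 1)), L z (v 2)] + β (σ z) ![f (R (v 1) (v 2)), L z (v 0)]
        + β (σ z) ![f (R (v 2) (v 0)), L z (v 1)]) := by
  rw [h.extDeriv_comp hβ]
  congr 1
  have e0 : ∀ (w : Fin 2 → W) a, Function.update w 0 a = ![a, w 1] := by
    intro w a; ext1 i; fin_cases i <;> simp
  have e1 : ∀ (w : Fin 2 → W) a, Function.update w 1 a = ![w 0, a] := by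
    intro w a; ext1 i; fin_cases i <;> simp
  refine (Fin.sum_univ_three _).trans ?_
  simp only [Fin.sum_univ_two, e0, e1, Fin.removeNth_apply]
  simp [Fin.succAbove, hR, map_sub]
  simp only [alternating_two_swap (β (σ z)) (L z _) (f _)]
  abel

theorem extDeriv_comp_three (h : IsLiftAt σ L f K z) {β : W → W [⋀^Fin 3]→L[ℝ] F}
    (hβ : DifferentiableAt ℝ β (σ z)) (v : Fin 4 → E) {R : E → E → A}
    (hR : ∀ u v, R u v = K u v - K v u) :
    extDeriv (fun y => (β (σ y)).compContinuousLinearMap (L y)) z v =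
      extDeriv β (σ z) (fun i => L z (v i)) -
      (β (σ z) ![f (R (v 0) (v 1)), L z (v 2), L z (v 3)]
        - β (σ z) ![f (R (v 0) (v 2)), L z (v 1), L z (v 3)]
        + β (σ z) ![f (R (v 0) (v 3)), L z (v 1), L z (v 2)]
        + β (σ z) ![f (R (v 1) (v 2)), L z (v 0), L z (v 3)]
        - β (σ z) ![f (R (v 1) (v 3)), L z (v 0), L z (v 2)]
        + β (σ z) ![f (R (v 2) (v 3)), L z (v 0), L z (v 1)]) := by
  rw [h.extDeriv_comp hβ]
  congr 1
  have e0 : ∀ (w : Fin 3 → W) a, Function.update w 0 a = ![a, w 1, w 2] := by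
    intro w a; ext1 i; fin_cases i <;> simp
  have e1 : ∀ (w : Fin 3 → W) a, Function.update w 1 a = ![w 0, a, w 2] := by
    intro w a; ext1 i; fin_cases i <;> simp
  have e2 : ∀ (w : Fin 3 → W) a, Function.update w 2 a = ![w 0, w 1, a] := by
    intro w a; ext1 i; fin_cases i <;> simp
  refine (Fin.sum_univ_four _).trans ?_
  simp only [Fin.sum_univ_three, e0, e1, e2, Fin.removeNth_apply]
  simp [Fin.succAbove, hR, map_sub]
  simp only [alternating_three_swap' (β (σ z)) (L z _) (L z _) (f _),
    alternating_three_swap (β (σ z)) (L z _) (f _)]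
  abel

theorem extDeriv_comp_one (h : IsLiftAt σ L f K z) {β : W → W [⋀^Fin 1]→L[ℝ] F}
    (hβ : DifferentiableAt ℝ β (σ z)) (v : Fin 2 → E) {R : E → E → A}
    (hR : ∀ u v, R u v = K u v - K v u) :
    extDeriv (fun y => (β (σ y)).compContinuousLinearMap (L y)) z v =
      extDeriv β (σ z) (fun i => L z (v i)) - β (σ z) ![f (R (v 0) (v 1))] := by
  rw [h.extDeriv_comp hβ]
  congr 1
  have e0 : ∀ (w : Fin 1 → W) a, Function.update w 0 a = ![a] := by
    intro w a; ext1 i; fin_cases i; simp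
  have hs : ∀ a b, β (σ z) ![a - b] = β (σ z) ![a] - β (σ z) ![b] := by
    intro a b
    have := (β (σ z)).toAlternatingMap.map_update_sub ![a] 0 a b
    rwa [e0, e0, e0] at this
  refine (Fin.sum_univ_two _).trans ?_
  simp only [Fin.sum_univ_one, e0, Fin.removeNth_apply]
  simp [Fin.succAbove, hR, map_sub, hs]
  abel

/-- The normality tensors of two `φ`-related structures differ by curvature terms. -/
theorem nij_eq (h : IsLiftAt σ L f K z) {R : E → E → A} (hR : ∀ u v, R u v = K u v - K v u)
    {φ : W → W →L[ℝ] W} {ξ : W → W} {η : W → W →L[ℝ] ℝ}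
    {φ' : E → E →L[ℝ] E} {ξ' : E → E} {η' : E → E →L[ℝ] ℝ}
    (hφ : DifferentiableAt ℝ φ (σ z)) (hη : DifferentiableAt ℝ η (σ z))
    (hφ' : DifferentiableAt ℝ φ' z)
    (hLφ : (fun y => (L y).comp (φ' y)) =ᶠ[𝓝 z] fun y => (φ (σ y)).comp (L y))
    (hLξ : L z (ξ' z) = ξ (σ z))
    (hLη : η' =ᶠ[𝓝 z] fun y => (η (σ y)).comp (L y))
    (hφ2 : ∀ w, φ (σ z) (φ (σ z) w) = -w + η (σ z) w • ξ (σ z)) (u v : E) :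
    L z (nij φ' ξ' η' z u v) = nij φ ξ η (σ z) (L z u) (L z v)
      + (f (R (φ' z u) (φ' z v)) - f (R u v))
      - φ (σ z) (f (R (φ' z u) v) + f (R u (φ' z v))) := by
  have hσ := h.differentiableAt.hasFDerivAt
  rw [← h.eq] at hσ
  have hL := h.diff.hasFDerivAt
  have hφσ : HasFDerivAt (fun y => φ (σ y)) _ z := hφ.hasFDerivAt.comp z hσ
  have hησ : HasFDerivAt (fun y => η (σ y)) _ z := hη.hasFDerivAt.comp z hσ
  have e1 : ∀ w u, L z (fderiv ℝ φ' z w u) = fderiv ℝ φ (σ z) (L z w) (L z u)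
      + φ (σ z) (fderiv ℝ L z w u) - fderiv ℝ L z w (φ' z u) := by
    intro w u
    have h1 := (hL.clm_comp hφ'.hasFDerivAt).fderiv
    have h2 := (hφσ.clm_comp hL).fderiv
    rw [hLφ.fderiv_eq, h2] at h1
    have h3 := DFunLike.congr_fun (DFunLike.congr_fun h1 w) u
    simp at h3
    rw [eq_sub_iff_add_eq, ← h3]
    abel
  have e2 : ∀ w u, fderiv ℝ η' z w u = fderiv ℝ η (σ z) (L z w) (L z u)
      + η (σ z) (fderiv ℝ L z w u) := by
    intro w u
    rw [hLη.fderiv_eq, (hησ.clm_comp hL).fderiv]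
    simp [add_comm]
  have e3 : ∀ u, L z (φ' z u) = φ (σ z) (L z u) := fun u => DFunLike.congr_fun hLφ.self_of_nhds u
  have e4 : ∀ w u, f (R w u) = fderiv ℝ L z u w - fderiv ℝ L z w u := by
    intro w u
    rw [hR, ← neg_inj, ← h.fderiv_swap]
    abel
  simp only [nij, map_add, map_sub, map_smul, e1, e2, e3, e4, hLξ]
  have e5 : ∀ w u, φ (σ z) (φ (σ z) (fderiv ℝ L z w u)) =
    -fderiv ℝ L z w u + η (σ z) (fderiv ℝ L z w u) • ξ (σ z) := fun w u => hφ2 _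
  simp only [e5, add_smul, sub_smul]
  abel

set_option synthInstance.maxHeartbeats 100000 in
/-- The Lie derivatives of two related metrics along related fields differ by curvature terms. -/
theorem lieMetric_eq (h : IsLiftAt σ L f K z) {R : E → E → A} (hR : ∀ u v, R u v = K u v - K v u)
    {g : W → W →L[ℝ] W →L[ℝ] ℝ} {ξ : W → W} {g' : E → E →L[ℝ] E →L[ℝ] ℝ} {ξ' : E → E}
    (hg : DifferentiableAt ℝ g (σ z)) (hξ : DifferentiableAt ℝ ξ (σ z))
    (hg' : DifferentiableAt ℝ g' z) (hξ' : DifferentiableAt ℝ ξ' z)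
    (hLg : ∀ u v, (fun y => g' y u v) =ᶠ[𝓝 z] fun y => g (σ y) (L y u) (L y v))
    (hLξ : (fun y => L y (ξ' y)) =ᶠ[𝓝 z] fun y => ξ (σ y)) (u v : E) :
    lieMetric g' ξ' z u v = lieMetric g ξ (σ z) (L z u) (L z v)
      - g (σ z) (f (R (ξ' z) u)) (L z v) - g (σ z) (L z u) (f (R (ξ' z) v)) := by
  have hσ := h.differentiableAt.hasFDerivAt
  rw [← h.eq] at hσ
  have hL := h.diff.hasFDerivAt
  have hgσ : HasFDerivAt (fun y => g (σ y)) ((fderiv ℝ g (σ z)).comp (L z)) z :=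
    HasFDerivAt.comp z (g := g) hg.hasFDerivAt hσ
  have hξσ : HasFDerivAt (fun y => ξ (σ y)) _ z := hξ.hasFDerivAt.comp z hσ
  have e1 : ∀ w, fderiv ℝ g' z w u v = fderiv ℝ g (σ z) (L z w) (L z u) (L z v)
      + g (σ z) (fderiv ℝ L z w u) (L z v) + g (σ z) (L z u) (fderiv ℝ L z w v) := by
    intro w
    have h1 := hasFDerivAt_apply_const (hasFDerivAt_apply_const hg'.hasFDerivAt u) v
    have h2 := (hgσ.clm_apply (hasFDerivAt_apply_const hL u)).clm_apply
      (hasFDerivAt_apply_const hL v)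
    have h3 := h1.fderiv
    rw [(hLg u v).fderiv_eq, h2.fderiv] at h3
    have h4 := DFunLike.congr_fun h3 w
    simp at h4
    rw [← h4]
    abel
  have e2 : ∀ w, L z (fderiv ℝ ξ' z w) = fderiv ℝ ξ (σ z) (L z w) - fderiv ℝ L z w (ξ' z) := by
    intro w
    have h1 := (hL.clm_apply hξ'.hasFDerivAt).fderiv
    rw [hLξ.fderiv_eq, hξσ.fderiv] at h1
    have h2 := DFunLike.congr_fun h1 w
    simp at h2
    rw [h2]
    abel
  have e3 : ∀ u v, g' z u v = g (σ z) (L z u) (L z v) := fun u v => (hLg u v).self_of_nhds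
  have e4 : ∀ w u, f (R w u) = fderiv ℝ L z u w - fderiv ℝ L z w u := by
    intro w u
    rw [hR, ← neg_inj, ← h.fderiv_swap]
    abel
  have e5 : L z (ξ' z) = ξ (σ z) := hLξ.self_of_nhds
  simp only [lieMetric, e1, e2, e3, e4, e5, map_sub, sub_apply]
  abel

end IsLiftAt

/-- The exterior derivative of `a ∧ ρ`, for a `1`-form `a` and a `2`-form `ρ` which is closed to
first order at the given point. -/
theorem extDeriv_pairing {a : E → E →L[ℝ] A →L[ℝ] ℝ} {ρ : E → E → E → A}
    {ρ' : E → E → E →L[ℝ] A} {β : E → E [⋀^Fin 3]→L[ℝ] ℝ} {z : E} (hβ : DifferentiableAt ℝ β z)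
    (ha : DifferentiableAt ℝ a z) (hρ : ∀ u v, HasFDerivAt (fun y => ρ y u v) (ρ' u v) z)
    (hρ' : ∀ u v w, ρ' u v w + ρ' v w u + ρ' w u v = 0) (hsymm : ∀ y u v, ρ y u v = -ρ y v u)
    (hβa : ∀ u : Fin 3 → E, (fun y => β y u) =ᶠ[𝓝 z] fun y => a y (u 0) (ρ y (u 1) (u 2))
      + a y (u 1) (ρ y (u 2) (u 0)) + a y (u 2) (ρ y (u 0) (u 1))) (v : Fin 4 → E)
    {da : E → E → A →L[ℝ] ℝ} (hda : ∀ u v, da u v = fderiv ℝ a z u v - fderiv ℝ a z v u) :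
    extDeriv β z v = da (v 0) (v 1) (ρ z (v 2) (v 3)) - da (v 0) (v 2) (ρ z (v 1) (v 3))
      + da (v 0) (v 3) (ρ z (v 1) (v 2)) + da (v 1) (v 2) (ρ z (v 0) (v 3))
      - da (v 1) (v 3) (ρ z (v 0) (v 2)) + da (v 2) (v 3) (ρ z (v 0) (v 1)) := by
  have hau := fun u => hasFDerivAt_apply_const ha.hasFDerivAt u
  have e1 : ∀ w (u : Fin 3 → E), fderiv ℝ β z w u =
      fderiv ℝ a z w (u 0) (ρ z (u 1) (u 2)) + a z (u 0) (ρ' (u 1) (u 2) w)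
      + (fderiv ℝ a z w (u 1) (ρ z (u 2) (u 0)) + a z (u 1) (ρ' (u 2) (u 0) w))
      + (fderiv ℝ a z w (u 2) (ρ z (u 0) (u 1)) + a z (u 2) (ρ' (u 0) (u 1) w)) := by
    intro w u
    have h1 : HasFDerivAt (fun y => β y u) ((ContinuousAlternatingMap.apply ℝ E ℝ u).comp
      (fderiv ℝ β z)) z :=
      (ContinuousAlternatingMap.apply ℝ E ℝ u).hasFDerivAt.comp z hβ.hasFDerivAt
    have h2 := (((hau (u 0)).clm_apply (hρ (u 1) (u 2))).add
      ((hau (u 1)).clm_apply (hρ (u 2) (u 0)))).add ((hau (u 2)).clm_apply (hρ (u 0) (u 1)))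
    have h3 := h1.fderiv
    rw [(hβa u).fderiv_eq] at h3
    have h4 := DFunLike.congr_fun (h3.symm.trans h2.fderiv) w
    simp at h4
    rw [h4]
    abel
  have e2 : ∀ u v w, ρ' u v w = -ρ' v u w := by
    intro u v w
    have h1 := (hρ u v).fderiv
    rw [show (fun y => ρ y u v) = fun y => -ρ y v u from funext fun y => hsymm y u v] at h1
    have h2 : HasFDerivAt (fun y => -ρ y v u) _ z := (hρ v u).neg
    rw [← h1, h2.fderiv]; rfl
  rw [extDeriv, ContinuousAlternatingMap.alternatizeUncurryFin_apply]
  refine (Fin.sum_univ_four _).trans ?_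
  simp only [e1, Fin.removeNth_apply, hda]
  simp [Fin.succAbove]
  simp only [hsymm z (v 2) (v 0), hsymm z (v 3) (v 0), hsymm z (v 3) (v 1), e2 (v 2) (v 0),
    e2 (v 3) (v 0), e2 (v 3) (v 1)]
  have h012 := hρ' (v 0) (v 1) (v 2)
  have h013 := hρ' (v 0) (v 1) (v 3)
  have h023 := hρ' (v 0) (v 2) (v 3)
  have h123 := hρ' (v 1) (v 2) (v 3)
  rw [e2 (v 2) (v 0)] at h012
  rw [e2 (v 3) (v 0)] at h013 h023
  rw [e2 (v 3) (v 1)] at h123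
  have k3 := congrArg (a z (v 3)) h012
  have k2 := congrArg (a z (v 2)) h013
  have k1 := congrArg (a z (v 1)) h023
  have k0 := congrArg (a z (v 0)) h123
  simp only [map_add, map_neg, map_zero] at k0 k1 k2 k3 ⊢
  linarith

end Lift

/-! ### Fundamental vector fields and the moment map -/

theorem contDiffAt_fderiv {E F : Type*} [NormedAddCommGroup E] [NormedSpace ℝ E]
    [NormedAddCommGroup F] [NormedSpace ℝ F] {f : E → F} {z : E} (h : ContDiffAt ℝ ∞ f z) :
    ContDiffAt ℝ ∞ (fderiv ℝ f) z :=
  h.fderiv_right (m := ∞) (by simp)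

section Action

variable {d n : ℕ} {G : Type*} [TopologicalSpace G] [ChartedSpace (Eu d) G] [Group G]
  [LieGroup (𝓡 d) ∞ G] {M : Type*} [TopologicalSpace M] [ChartedSpace (Eu n) M]
  [IsManifold (𝓡 n) ∞ M] [MulAction G M]

section Smul

variable [ContMDiffSMul (𝓡 d) (𝓡 n) ∞ G M]
  {E : Type*} [NormedAddCommGroup E] [NormedSpace ℝ E] {X : Type*} [TopologicalSpace X]
  [ChartedSpace E X]

theorem SmoothAt.smul {d n : ℕ} {G : Type*} [TopologicalSpace G] [ChartedSpace (Eu d) G]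
    [Group G] {M : Type*} [TopologicalSpace M] [ChartedSpace (Eu n) M] [MulAction G M]
    [ContMDiffSMul (𝓡 d) (𝓡 n) ∞ G M] {a : X → G} {b : X → M} {x : X} (ha : SmoothAt E (Eu d) a x)
    (hb : SmoothAt E (Eu n) b x) : SmoothAt E (Eu n) (fun y => a y • b y) x :=
  ContMDiffAt.smul (I := 𝓡 d) (I' := 𝓡 n) ha hb

theorem smoothAt_const_smul (d : ℕ) {n : ℕ} {G : Type*} [TopologicalSpace G]
    [ChartedSpace (Eu d) G] [Group G] {M : Type*} [TopologicalSpace M] [ChartedSpace (Eu n) M]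
    [MulAction G M] [ContMDiffSMul (𝓡 d) (𝓡 n) ∞ G M] (g : G) (p : M) :
    SmoothAt (Eu n) (Eu n) (fun x : M => g • x) p :=
  SmoothAt.smul (d := d) contMDiffAt_const contMDiffAt_id

theorem smoothAt_orbit (g : G) (p : M) : SmoothAt (Eu d) (Eu n) (fun h : G => h • p) g :=
  SmoothAt.smul contMDiffAt_id contMDiffAt_const

end Smul

variable (d n G) in
/-- The fundamental vector fields, as a map to the model space. -/
def fundE (p : M) : Eu d →L[ℝ] Eu n := md (Eu d) (Eu n) (fun g : G => g • p) 1

variable (n) in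
/-- The derivative of the action of `g`, as an endomorphism of the model space. -/
def actE (g : G) (p : M) : Eu n →L[ℝ] Eu n := md (Eu n) (Eu n) (fun x : M => g • x) p

/-- The coordinate expression of the fundamental vector fields in the chart at `x`. -/
def fundC (d n : ℕ) (G : Type*) [TopologicalSpace G] [ChartedSpace (Eu d) G] [Group G]
    {M : Type*} [TopologicalSpace M] [ChartedSpace (Eu n) M] [MulAction G M]
    (x : M) (z : Eu n) : Eu d →L[ℝ] Eu n :=
  fderiv ℝ (fun a => ch (Eu n) x ((ch (Eu d) (1 : G)).symm a • (ch (Eu n) x).symm z))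
    (ch (Eu d) (1 : G) 1)

variable [ContMDiffSMul (𝓡 d) (𝓡 n) ∞ G M]

theorem smoothAt_smul_symm (x : M) {z : Eu n} (hz : z ∈ (ch (Eu n) x).target) :
    SmoothAt (Eu d × Eu n) (Eu n)
      (fun p : Eu d × Eu n => (ch (Eu d) (1 : G)).symm p.1 • (ch (Eu n) x).symm p.2)
      (ch (Eu d) (1 : G) 1, z) := by
  refine SmoothAt.smul (d := d) ?_ ?_
  · exact ContMDiffAt.comp (g := (ch (Eu d) (1 : G)).symm) (ch (Eu d) (1 : G) 1, z)
      (smoothAt_ch_symm_self (1 : G)) (smoothAt_iff_contDiffAt.2 contDiffAt_fst)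
  · exact ContMDiffAt.comp (g := (ch (Eu n) x).symm) (ch (Eu d) (1 : G) 1, z)
      (smoothAt_ch_symm hz) (smoothAt_iff_contDiffAt.2 contDiffAt_snd)

theorem contDiffAt_fundC (x : M) {z : Eu n} (hz : z ∈ (ch (Eu n) x).target) :
    ContDiffAt ℝ ∞ (fundC d n G x) z := by
  refine ContDiffAt.fderiv (n := ∞) (f := fun z a => ch (Eu n) x
    ((ch (Eu d) (1 : G)).symm a • (ch (Eu n) x).symm z)) ?_ contDiffAt_const (by simp)
  have h1 : (ch (Eu d) (1 : G)).symm (ch (Eu d) (1 : G) 1) = 1 := extChartAt_to_inv (1 : G)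
  have h2 : ContDiffAt ℝ ∞ (fun p : Eu d × Eu n => ch (Eu n) x
      ((ch (Eu d) (1 : G)).symm p.1 • (ch (Eu n) x).symm p.2)) (ch (Eu d) (1 : G) 1, z) := by
    refine smoothAt_iff_contDiffAt.1 (ContMDiffAt.comp _ (smoothAt_ch ?_)
      (smoothAt_smul_symm (G := G) (d := d) x hz))
    simp only [h1, one_smul]
    exact (ch (Eu n) x).map_target hz
  exact ContDiffAt.comp (z, ch (Eu d) (1 : G) 1) (f := fun q : Eu n × Eu d => (q.2, q.1)) h2
    (contDiffAt_snd.prodMk contDiffAt_fst)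

theorem fundC_eq (x : M) {z : Eu n} (hz : z ∈ (ch (Eu n) x).target) :
    fundC d n G x z = (dch x z).comp (fundE d n G ((ch (Eu n) x).symm z)) := by
  have h1 : (ch (Eu d) (1 : G)).symm (ch (Eu d) (1 : G) 1) = 1 := extChartAt_to_inv (1 : G)
  have h2 : SmoothAt (Eu d) (Eu n) (fun g : G => g • (ch (Eu n) x).symm z)
      ((ch (Eu d) (1 : G)).symm (ch (Eu d) (1 : G) 1)) := smoothAt_orbit _ _
  rw [fundC, ← md_eq_fderiv]
  refine (md_comp (E := Eu d) (F := Eu n) (H := Eu n)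
    (f := fun a => (ch (Eu d) (1 : G)).symm a • (ch (Eu n) x).symm z)
    (g := ch (Eu n) x) ?_ ?_).trans ?_
  · simp only [h1, one_smul]
    exact smoothAt_ch ((ch (Eu n) x).map_target hz)
  · exact ContMDiffAt.comp _ h2 (smoothAt_ch_symm_self (1 : G))
  · rw [md_comp (E := Eu d) (F := Eu d) (H := Eu n) (f := (ch (Eu d) (1 : G)).symm)
      (g := fun g : G => g • (ch (Eu n) x).symm z)
      h2 (smoothAt_ch_symm_self (1 : G)), md_ch_symm_self, h1, one_smul]
    rfl

/-- The fundamental vector fields are equivariant: `(Ad g A)* = g_* A*`. -/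
theorem actE_comp_fundE (g : G) (p : M) (A : Eu d) :
    fundE d n G (g • p) (Ad d g A) = actE n g p (fundE d n G p A) := by
  have e : (fun h : G => (g * h * g⁻¹) • g • p) = fun h : G => g • h • p := by
    funext h; simp [mul_smul]
  have h1 : SmoothAt (Eu d) (Eu d) (fun h : G => g * h * g⁻¹) 1 :=
    (contMDiffAt_const (c := g).mul contMDiffAt_id).mul contMDiffAt_const
  have h3 : SmoothAt (Eu d) (Eu n) (fun h : G => h • g • p) (g * 1 * g⁻¹) := smoothAt_orbit _ _
  have h2 := md_comp_apply (f := fun h : G => g * h * g⁻¹) (g := fun h : G => h • g • p) h3 h1 A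
  rw [e, md_comp_apply (f := fun h : G => h • p) (g := fun x : M => g • x)
    (smoothAt_const_smul d _ _) (smoothAt_orbit _ _)] at h2
  rw [show g * 1 * g⁻¹ = 1 by group] at h2
  rw [one_smul] at h2
  exact h2.symm

end Action

namespace MomentMap

variable {d n : ℕ} {G : Type*} [TopologicalSpace G] [ChartedSpace (Eu d) G] [Group G]
  [LieGroup (𝓡 d) ∞ G] {M : Type*} [TopologicalSpace M] [ChartedSpace (Eu n) M]
  [IsManifold (𝓡 n) ∞ M] [MulAction G M] [ContMDiffSMul (𝓡 d) (𝓡 n) ∞ G M]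
  {S : AlmostContactMetric n M} (μ : MomentMap d G S)

/-- The derivative `dμ`, as a map from the model space. -/
def dE (p : M) : Eu n →L[ℝ] LieDual d := dMoment μ.toFun p

/-- The linear map `dμ ∘ φ`. -/
def phiDual (p : M) : Eu n →L[ℝ] LieDual d := (μ.dE p).comp (S.phiE p)

/-- The linear map `A ↦ dμ(φ(A*))`. -/
def pairing (p : M) : Eu d →L[ℝ] LieDual d := (μ.phiDual p).comp (fundE d n G p)

theorem smoothAt_toFun (p : M) : SmoothAt (Eu n) (LieDual d) μ.toFun p := μ.smooth p

/-- The derivative of the equivariance of the moment map. -/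
theorem dE_smul (g : G) (p : M) (w : Eu n) (A : Eu d) :
    μ.dE (g • p) (actE n g p w) A = μ.dE p w (Ad d g⁻¹ A) := by
  have e : (fun x : M => μ.toFun (g • x)) =
      fun x : M => (ContinuousLinearMap.precomp ℝ (Ad d g⁻¹)) (μ.toFun x) := by
    funext x; ext A; exact μ.equivariant g x A
  have h1 := md_comp_apply (f := fun x : M => g • x) (g := μ.toFun) (μ.smoothAt_toFun (g • p))
    (smoothAt_const_smul d g p) w
  have h2 := md_comp_apply (f := μ.toFun)
    (g := fun a => (ContinuousLinearMap.precomp ℝ (Ad d g⁻¹) : LieDual d →L[ℝ] LieDual d) a)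
    (x := p) (smoothAt_iff_contDiffAt.2 (ContinuousLinearMap.contDiff _).contDiffAt)
    (μ.smoothAt_toFun p) w
  rw [e, h2, md_eq_fderiv, ContinuousLinearMap.fderiv] at h1
  exact (DFunLike.congr_fun h1 A).symm

/-- The zero level is invariant, so `dμ` vanishes on the fundamental vectors there. -/
theorem dE_fundE {p : M} (hp : μ.toFun p = 0) (A : Eu d) : μ.dE p (fundE d n G p A) = 0 := by
  have e : (fun g : G => μ.toFun (g • p)) = fun _ => 0 := by
    funext g; ext A; rw [μ.equivariant, hp]; rfl
  have h : SmoothAt (Eu n) (LieDual d) μ.toFun ((1 : G) • p) := μ.smoothAt_toFun _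
  have h1 := md_comp_apply (f := fun g : G => g • p) (g := μ.toFun) (x := (1 : G)) h
    (smoothAt_orbit 1 p) A
  rw [e, md_const, one_smul] at h1
  exact h1.symm

theorem dE_reeb (p : M) : μ.dE p (S.reebE p) = 0 := μ.basic p

theorem phiDual_reeb (p : M) : μ.phiDual p (S.reebE p) = 0 := by
  have h : S.phiE p (S.reebE p) = 0 := S.phi_reeb p
  rw [phiDual, ContinuousLinearMap.comp_apply, h, map_zero]

/-- As `dμ(ξ) = 0`, the identity `φ² = -1 + η ⊗ ξ` gives `dμ ∘ φ ∘ φ = -dμ`. -/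
theorem phiDual_phi (p : M) (w : Eu n) : μ.phiDual p (S.phiE p w) = -μ.dE p w := by
  have h : S.phiE p (S.phiE p w) = -w + S.gE p (S.reebE p) w • S.reebE p := S.phi_sq p w
  rw [phiDual, ContinuousLinearMap.comp_apply, h, map_add, map_smul, μ.dE_reeb, smul_zero,
    add_zero, map_neg]

theorem phiDual_smul (hS : Preserves G S) (g : G) (p : M) (w : Eu n) (A : Eu d) :
    μ.phiDual (g • p) (actE n g p w) A = μ.phiDual p w (Ad d g⁻¹ A) := by
  have h : S.phiE (g • p) (actE n g p w) = actE n g p (S.phiE p w) := (hS.phi g p w).symm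
  rw [phiDual, ContinuousLinearMap.comp_apply, h, μ.dE_smul]; rfl

theorem pairing_injective {p : M} (hp : μ.toFun p = 0) : Function.Injective (μ.pairing p) := by
  refine (injective_iff_map_eq_zero _).2 fun A hA => ?_
  by_contra hA'
  exact μ.nondegenerate A hA' p hp hA

theorem finrank_lieDual (d : ℕ) : Module.finrank ℝ (LieDual d) = d := by
  rw [← LinearMap.toContinuousLinearMap.finrank_eq]
  exact Subspace.dual_finrank_eq.trans (by simp)

/-- On the zero level, `A ↦ dμ(φ(A*))` is an isomorphism `𝔤 ≃ 𝔤*`. -/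
def pairingEquiv {p : M} (hp : μ.toFun p = 0) : Eu d ≃L[ℝ] LieDual d :=
  (LinearEquiv.ofInjectiveOfFinrankEq (μ.pairing p).toLinearMap (μ.pairing_injective hp)
    (by rw [finrank_lieDual]; simp)).toContinuousLinearEquiv

theorem coe_pairingEquiv {p : M} (hp : μ.toFun p = 0) :
    (μ.pairingEquiv hp : Eu d →L[ℝ] LieDual d) = μ.pairing p := rfl

/-- The coordinate expression of `dμ`. -/
def momentC (x : M) (z : Eu n) : Eu n →L[ℝ] LieDual d :=
  fderiv ℝ (fun y => μ.toFun ((ch (Eu n) x).symm y)) z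

theorem momentC_eq (x : M) {z : Eu n} (hz : z ∈ (ch (Eu n) x).target) :
    μ.momentC x z = (μ.dE ((ch (Eu n) x).symm z)).comp (dsym x z) := by
  rw [momentC, ← md_eq_fderiv, md_comp (f := (ch (Eu n) x).symm) (μ.smoothAt_toFun _)
    (smoothAt_ch_symm hz)]
  rfl

theorem contDiffAt_momentC (x : M) : ContDiffAt ℝ ∞ (μ.momentC x) (ch (Eu n) x x) := by
  refine contDiffAt_fderiv (smoothAt_iff_contDiffAt.1 ?_)
  exact ContMDiffAt.comp _ (μ.smoothAt_toFun _) (smoothAt_ch_symm_self x)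

/-- The coordinate expression of `dμ ∘ φ`. -/
def phiDualC (x : M) (z : Eu n) : Eu n →L[ℝ] LieDual d := (μ.momentC x z).comp (S.phiC x z)

theorem phiDualC_eq (x : M) {z : Eu n} (hz : z ∈ (ch (Eu n) x).target) :
    μ.phiDualC x z = (μ.phiDual ((ch (Eu n) x).symm z)).comp (dsym x z) := by
  ext1 v
  rw [phiDualC, μ.momentC_eq x hz]
  simp only [ContinuousLinearMap.comp_apply, AlmostContactMetric.phiC, phiDual]
  rw [md_symm_md_ch hz]

theorem contDiffAt_phiDualC (x : M) : ContDiffAt ℝ ∞ (μ.phiDualC x) (ch (Eu n) x x) :=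
  (μ.contDiffAt_momentC x).clm_comp (S.contDiffAt_phiC x)

theorem pairing_eq (x : M) {z : Eu n} (hz : z ∈ (ch (Eu n) x).target) :
    μ.pairing ((ch (Eu n) x).symm z) = (μ.phiDualC x z).comp (fundC d n G x z) := by
  ext1 v
  rw [μ.phiDualC_eq x hz, fundC_eq x hz]
  simp only [ContinuousLinearMap.comp_apply, pairing]
  rw [md_symm_md_ch hz]

end MomentMap

/-! ### The connection form on the zero level -/

namespace MomentMap

variable {d n m k : ℕ} {G : Type*} [TopologicalSpace G] [ChartedSpace (Eu d) G] [Group G]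
  {M : Type*} [TopologicalSpace M] [ChartedSpace (Eu n) M]
  [IsManifold (𝓡 n) ∞ M] [MulAction G M]
  {S : AlmostContactMetric n M} (μ : MomentMap d G S)
  [ChartedSpace (Eu m) μ.zeroLevel]
  [ChartedSpace (Eu k) μ.Reduction]

variable (m) in
/-- The derivative of the inclusion, as a map of model spaces. -/
def inclE (q : μ.zeroLevel) : Eu m →L[ℝ] Eu n := md (Eu m) (Eu n) μ.incl q

variable (m k) in
/-- The derivative of the projection, as a map of model spaces. -/
def projE (q : μ.zeroLevel) : Eu m →L[ℝ] Eu k := md (Eu m) (Eu k) μ.proj q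

/-- A local section `s` of `M₀ → M // G` through `q`, parametrised by the preferred chart of the
quotient at the class of `q`, and horizontal at `q`. -/
structure IsHorSection (q : μ.zeroLevel) (s : Eu k → μ.zeroLevel) : Prop where
  smooth : ∀ᶠ z in 𝓝 (ch (Eu k) (μ.proj q) (μ.proj q)), SmoothAt (Eu k) (Eu m) s z
  base : s (ch (Eu k) (μ.proj q) (μ.proj q)) = q
  proj : ∀ᶠ z in 𝓝 (ch (Eu k) (μ.proj q) (μ.proj q)),
    μ.proj (s z) = (ch (Eu k) (μ.proj q)).symm z
  horizontal : ∀ u, μ.phiDual q (μ.inclE m q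
    (md (Eu k) (Eu m) s (ch (Eu k) (μ.proj q) (μ.proj q)) u)) = 0

variable (m k) in
/-- What the geometry of the reduction uses of the manifold structures on the zero level and on
the quotient: everything about the induced structure follows from these properties, however the
charts are constructed. The dimension formulas are only required when the zero level is not
empty. -/
structure IsReductionAtlas [IsManifold (𝓡 m) ∞ μ.zeroLevel] [IsManifold (𝓡 k) ∞ μ.Reduction] :
    Prop where
  embedding : Manifold.IsSmoothEmbedding (𝓡 m) (𝓡 n) ∞ μ.incl
  proj_smooth : ∀ q, SmoothAt (Eu m) (Eu k) μ.proj q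
  inclE_injective : ∀ q, Function.Injective (μ.inclE m q)
  dim_level : ∀ _ : μ.zeroLevel, m + d = n
  dim_quotient : ∀ _ : μ.zeroLevel, k + d = m
  exists_section : ∀ q, ∃ s : Eu k → μ.zeroLevel, μ.IsHorSection (m := m) q s

variable [LieGroup (𝓡 d) ∞ G] [ContMDiffSMul (𝓡 d) (𝓡 n) ∞ G M]

variable (m) in
/-- The connection form of the horizontal distribution `ker (dμ ∘ φ)`: the composite of
`v ↦ dμ(φ(v))` with the inverse of the isomorphism `A ↦ dμ(φ(A*))`. -/
def conn (q : μ.zeroLevel) : Eu m →L[ℝ] Eu d :=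
  ((μ.pairingEquiv q.2).symm : LieDual d →L[ℝ] Eu d).comp ((μ.phiDual q).comp (μ.inclE m q))

variable (m) in
/-- The horizontal projection. -/
def horE (q : μ.zeroLevel) : Eu m →L[ℝ] Eu m :=
  ContinuousLinearMap.id ℝ _ - (fundE d m G q).comp (μ.conn m q)

theorem conn_eq_zero_iff (q : μ.zeroLevel) (v : Eu m) :
    μ.conn m q v = 0 ↔ μ.phiDual q (μ.inclE m q v) = 0 := by
  simp [conn]

namespace IsReductionAtlas

variable {μ} [IsManifold (𝓡 m) ∞ μ.zeroLevel] [IsManifold (𝓡 k) ∞ μ.Reduction]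
  (h : μ.IsReductionAtlas m k)
  {E : Type*} [NormedAddCommGroup E] [NormedSpace ℝ E]
  {X : Type*} [TopologicalSpace X] [ChartedSpace E X]

include h

theorem smoothAt_incl (q : μ.zeroLevel) : SmoothAt (Eu m) (Eu n) μ.incl q :=
  h.embedding.isImmersion.contMDiff q

/-- A map to the zero level is smooth if and only if it is smooth as a map to `M`. -/
theorem smoothAt_iff {c : X → μ.zeroLevel} {x : X} :
    SmoothAt E (Eu m) c x ↔ SmoothAt E (Eu n) (fun y => μ.incl (c y)) x := by
  refine (ContMDiffAt.iff_comp_isImmersionAt (h.embedding.isImmersion.isImmersionAt (c x))).trans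
    ⟨fun H => H.2, fun H => ⟨?_, H⟩⟩
  exact h.embedding.isEmbedding.isInducing.continuousAt_iff.2 H.continuousAt

theorem contMDiffSMul : ContMDiffSMul (𝓡 d) (𝓡 m) ∞ G μ.zeroLevel := by
  refine ⟨(ContMDiff.iff_comp_isImmersion h.embedding.isImmersion).2 ⟨?_, ?_⟩⟩
  · refine h.embedding.isEmbedding.isInducing.continuous_iff.2 ?_
    have : ContinuousSMul G M := ContMDiffSMul.continuousSMul (I := 𝓡 d) (I' := 𝓡 n) ∞
    exact continuous_fst.smul (continuous_subtype_val.comp continuous_snd)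
  · exact contMDiff_fst.smul (h.embedding.isImmersion.contMDiff.comp contMDiff_snd)

theorem inclE_fundE (q : μ.zeroLevel) (A : Eu d) :
    μ.inclE m q (fundE d m G q A) = fundE d n G (q : M) A := by
  have := h.contMDiffSMul
  have h1 := md_comp_apply (f := fun g : G => g • q) (g := μ.incl) (x := (1 : G))
    (h.smoothAt_incl _) (smoothAt_orbit 1 q) A
  rw [one_smul] at h1
  exact h1.symm

theorem inclE_actE (g : G) (q : μ.zeroLevel) (v : Eu m) :
    μ.inclE m (g • q) (actE m g q v) = actE n g (q : M) (μ.inclE m q v) := by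
  have := h.contMDiffSMul
  have h1 := md_comp_apply (f := fun q : μ.zeroLevel => g • q) (g := μ.incl) (x := q)
    (h.smoothAt_incl _) (smoothAt_const_smul d g q) v
  have h2 := md_comp_apply (f := μ.incl) (g := fun p : M => g • p) (x := q)
    (smoothAt_const_smul d g _) (h.smoothAt_incl q) v
  exact h1.symm.trans h2

theorem projE_actE (g : G) (q : μ.zeroLevel) (v : Eu m) :
    μ.projE m k (g • q) (actE m g q v) = μ.projE m k q v := by
  have := h.contMDiffSMul
  have h1 := md_comp_apply (f := fun q : μ.zeroLevel => g • q) (g := μ.proj) (x := q)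
    (h.proj_smooth _) (smoothAt_const_smul d g q) v
  rw [show (fun q : μ.zeroLevel => μ.proj (g • q)) = μ.proj from
    funext fun q => Quotient.sound ⟨g, rfl⟩] at h1
  exact h1.symm

theorem projE_fundE (q : μ.zeroLevel) (A : Eu d) : μ.projE m k q (fundE d m G q A) = 0 := by
  have := h.contMDiffSMul
  have h1 := md_comp_apply (f := fun g : G => g • q) (g := μ.proj) (x := (1 : G))
    (h.proj_smooth _) (smoothAt_orbit 1 q) A
  rw [show (fun g : G => μ.proj (g • q)) = fun _ => μ.proj q from
    funext fun g => Quotient.sound ⟨g, rfl⟩, md_const, one_smul] at h1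
  exact h1.symm

theorem dE_inclE (q : μ.zeroLevel) (v : Eu m) : μ.dE q (μ.inclE m q v) = 0 := by
  have h1 := md_comp_apply (f := μ.incl) (g := μ.toFun) (x := q)
    (μ.smoothAt_toFun _) (h.smoothAt_incl q) v
  rw [show (fun q : μ.zeroLevel => μ.toFun (μ.incl q)) = fun _ => 0 from
    funext fun q => q.2, md_const] at h1
  exact h1.symm

/-- The tangent space of the zero level is the kernel of `dμ`, by a dimension count. -/
theorem exists_inclE (q : μ.zeroLevel) {v : Eu n} (hv : μ.dE q v = 0) :
    ∃ u, μ.inclE m q u = v := by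
  have h1 : LinearMap.range (μ.inclE m q).toLinearMap ≤
      LinearMap.ker (μ.dE (q : M)).toLinearMap := by
    rintro _ ⟨u, rfl⟩
    exact h.dE_inclE q u
  have h2 : Function.Surjective (μ.dE (q : M)) := by
    intro a
    obtain ⟨A, hA⟩ := (μ.pairingEquiv q.2).surjective a
    exact ⟨S.phiE q (fundE d n G (q : M) A), hA⟩
  have h3 := LinearMap.finrank_range_of_inj (f := (μ.inclE m q).toLinearMap) (h.inclE_injective q)
  have h4 := LinearMap.finrank_range_add_finrank_ker (μ.dE (q : M)).toLinearMap
  rw [LinearMap.range_eq_top.2 h2, finrank_top, finrank_lieDual] at h4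
  rw [finrank_euclideanSpace_fin] at h3 h4
  have h5 := Submodule.eq_of_le_of_finrank_eq h1 (by have := h.dim_level q; omega)
  have : v ∈ LinearMap.ker (μ.dE (q : M)).toLinearMap := hv
  rw [← h5] at this
  exact this

theorem conn_fundE (q : μ.zeroLevel) (A : Eu d) : μ.conn m q (fundE d m G q A) = A := by
  rw [conn, ContinuousLinearMap.comp_apply, ContinuousLinearMap.comp_apply, h.inclE_fundE]
  exact (μ.pairingEquiv q.2).symm_apply_apply A

theorem conn_horE (q : μ.zeroLevel) (v : Eu m) : μ.conn m q (μ.horE m q v) = 0 := by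
  simp [horE, h.conn_fundE]

theorem horE_of_conn {q : μ.zeroLevel} {v : Eu m} (hv : μ.conn m q v = 0) : μ.horE m q v = v := by
  simp [horE, hv]

theorem projE_horE (q : μ.zeroLevel) (v : Eu m) :
    μ.projE m k q (μ.horE m q v) = μ.projE m k q v := by
  simp [horE, h.projE_fundE]

theorem inclE_horE (q : μ.zeroLevel) (v : Eu m) :
    μ.inclE m q (μ.horE m q v) = μ.inclE m q v - fundE d n G (q : M) (μ.conn m q v) := by
  simp [horE, h.inclE_fundE]

theorem conn_actE_of_conn (hS : Preserves G S) (g : G) {q : μ.zeroLevel} {v : Eu m}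
    (hv : μ.conn m q v = 0) : μ.conn m (g • q) (actE m g q v) = 0 := by
  rw [conn_eq_zero_iff] at hv ⊢
  rw [h.inclE_actE]
  ext A
  exact (μ.phiDual_smul hS g q _ A).trans (by rw [hv]; rfl)

/-- The connection form is equivariant; it suffices to split a vector into its horizontal part and
a fundamental vector. -/
theorem conn_actE (hS : Preserves G S) (g : G) (q : μ.zeroLevel) (v : Eu m) :
    μ.conn m (g • q) (actE m g q v) = Ad d g (μ.conn m q v) := by
  have := h.contMDiffSMul
  have h1 : v = μ.horE m q v + fundE d m G q (μ.conn m q v) := by simp [horE]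
  conv_lhs => rw [h1]
  rw [map_add, map_add, h.conn_actE_of_conn hS g (h.conn_horE q v), ← actE_comp_fundE,
    h.conn_fundE, zero_add]

end IsReductionAtlas

end MomentMap

/-! ### Smoothness of the connection form and the lift of tangent vectors -/

set_option synthInstance.maxHeartbeats 200000 in
theorem fderiv_sub_comp_apply {E W A : Type*} [NormedAddCommGroup E] [NormedSpace ℝ E]
    [NormedAddCommGroup W] [NormedSpace ℝ W] [NormedAddCommGroup A] [NormedSpace ℝ A]
    {D : E → E →L[ℝ] W} {f : E → A →L[ℝ] W} {a : E → E →L[ℝ] A} {z : E}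
    (hD : DifferentiableAt ℝ D z) (hf : DifferentiableAt ℝ f z) (ha : DifferentiableAt ℝ a z)
    (h0 : a z = 0) (w u : E) :
    fderiv ℝ (fun y => D y - (f y).comp (a y)) z w u =
      fderiv ℝ D z w u - f z (fderiv ℝ a z w u) := by
  have h1 : HasFDerivAt (fun y => D y - (f y).comp (a y)) _ z :=
    hD.hasFDerivAt.sub (hf.hasFDerivAt.clm_comp ha.hasFDerivAt)
  rw [h1.fderiv, h0]
  simp

namespace MomentMap

variable {d n m k : ℕ} {G : Type*} [TopologicalSpace G] [ChartedSpace (Eu d) G] [Group G]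
  {M : Type*} [TopologicalSpace M] [ChartedSpace (Eu n) M]
  [IsManifold (𝓡 n) ∞ M] [MulAction G M]
  {S : AlmostContactMetric n M} (μ : MomentMap d G S)
  [ChartedSpace (Eu m) μ.zeroLevel] [ChartedSpace (Eu k) μ.Reduction]
  [LieGroup (𝓡 d) ∞ G] [ContMDiffSMul (𝓡 d) (𝓡 n) ∞ G M]
  [IsManifold (𝓡 m) ∞ μ.zeroLevel] [IsManifold (𝓡 k) ∞ μ.Reduction]
  {E : Type*} [NormedAddCommGroup E] [NormedSpace ℝ E]

/-- The coordinate expression of a map to the zero level, in the chart of `M` at the image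
of `z₀`. -/
def coordMap (c : E → μ.zeroLevel) (z₀ z : E) : Eu n := ch (Eu n) (c z₀ : M) (c z : M)

variable (m) in
/-- The pull-back of the connection form by a map to the zero level. -/
def connPb (c : E → μ.zeroLevel) (z : E) : E →L[ℝ] Eu d :=
  (μ.conn m (c z)).comp (md E (Eu m) c z)

variable (m) in
/-- The horizontal part of the derivative of a map `c` to the zero level, expressed in the chart of
`M` at the image of `z₀`. -/
def liftC (c : E → μ.zeroLevel) (z₀ z : E) : E →L[ℝ] Eu n :=
  fderiv ℝ (μ.coordMap c z₀) z
    - (fundC d n G (c z₀ : M) (μ.coordMap c z₀ z)).comp (μ.connPb m c z)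

namespace IsReductionAtlas

variable {μ} (h : μ.IsReductionAtlas m k) {c : E → μ.zeroLevel} {z₀ : E}

include h

theorem smoothAt_comp_incl (hc : SmoothAt E (Eu m) c z₀) :
    SmoothAt E (Eu n) (fun z => (c z : M)) z₀ :=
  h.smoothAt_iff.1 hc

theorem contDiffAt_coordMap (hc : SmoothAt E (Eu m) c z₀) :
    ContDiffAt ℝ ∞ (μ.coordMap c z₀) z₀ :=
  contDiffAt_ch_comp (h.smoothAt_comp_incl hc)

/-- The coordinate expression of a map to the zero level, and its derivative. -/
theorem eventually_coordMap (hc : SmoothAt E (Eu m) c z₀) : ∀ᶠ z in 𝓝 z₀,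
    μ.coordMap c z₀ z ∈ (ch (Eu n) (c z₀ : M)).target ∧
    (ch (Eu n) (c z₀ : M)).symm (μ.coordMap c z₀ z) = c z ∧
    ∀ v, fderiv ℝ (μ.coordMap c z₀) z v =
      dch (c z₀ : M) (μ.coordMap c z₀ z) (μ.inclE m (c z) (md E (Eu m) c z v)) := by
  have hs := h.smoothAt_comp_incl hc
  filter_upwards [hc.eventually_mdifferentiableAt,
    hs.continuousAt.eventually (eventually_ch_source (E := Eu n) (c z₀ : M))] with z hz hz'
  refine ⟨(ch (Eu n) (c z₀ : M)).map_source hz', (ch (Eu n) (c z₀ : M)).left_inv hz', fun v => ?_⟩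
  have h1 : md E (Eu n) (fun y => ch (Eu n) (c z₀ : M) (μ.incl (c y))) z =
      (md (Eu m) (Eu n) (fun q => ch (Eu n) (c z₀ : M) (μ.incl q)) (c z)).comp (md E (Eu m) c z) :=
    md_comp_of_mdifferentiableAt (SmoothAt.mdifferentiableAt
      (ContMDiffAt.comp _ (smoothAt_ch hz') (h.smoothAt_incl _))) hz
  rw [md_comp (f := μ.incl) (smoothAt_ch hz') (h.smoothAt_incl _)] at h1
  rw [← md_eq_fderiv]
  rw [dch, show (ch (Eu n) (c z₀ : M)).symm (μ.coordMap c z₀ z) = c z from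
    (ch (Eu n) (c z₀ : M)).left_inv hz']
  exact DFunLike.congr_fun h1 v

/-- In coordinates the pulled back connection form is `(dμ ∘ φ ∘ f)⁻¹ ∘ dμ ∘ φ ∘ dc`, where `f` is
the infinitesimal action; it is therefore smooth, inversion being smooth. -/
theorem connPb_eventuallyEq (hc : SmoothAt E (Eu m) c z₀) : μ.connPb m c =ᶠ[𝓝 z₀] fun z =>
    ((μ.phiDualC (c z₀) (μ.coordMap c z₀ z)).comp
      (fundC d n G (c z₀ : M) (μ.coordMap c z₀ z))).inverse.comp
      ((μ.phiDualC (c z₀) (μ.coordMap c z₀ z)).comp (fderiv ℝ (μ.coordMap c z₀) z)) := by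
  filter_upwards [h.eventually_coordMap hc] with z ⟨hz, hz1, hz2⟩
  ext1 v
  rw [← μ.pairing_eq _ hz, hz1, ← μ.coe_pairingEquiv (c z).2, ContinuousLinearMap.inverse_equiv,
    μ.phiDualC_eq _ hz, hz1]
  simp only [ContinuousLinearMap.comp_apply, hz2, connPb, conn]
  have := md_symm_md_ch (E := Eu n) hz (μ.inclE m (c z) (md E (Eu m) c z v))
  rw [hz1] at this
  rw [dch, hz1, this]

theorem contDiffAt_fundC_coordMap (hc : SmoothAt E (Eu m) c z₀) :
    ContDiffAt ℝ ∞ (fun z => fundC d n G (c z₀ : M) (μ.coordMap c z₀ z)) z₀ :=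
  ContDiffAt.comp z₀ (contDiffAt_fundC (c z₀ : M) (mem_extChartAt_target (c z₀ : M)))
    (h.contDiffAt_coordMap hc)

set_option synthInstance.maxHeartbeats 200000 in
theorem contDiffAt_connPb (hc : SmoothAt E (Eu m) c z₀) : ContDiffAt ℝ ∞ (μ.connPb m c) z₀ := by
  refine ContDiffAt.congr_of_eventuallyEq ?_ (h.connPb_eventuallyEq hc)
  have h1 : ContDiffAt ℝ ∞ (fun z => μ.phiDualC (c z₀) (μ.coordMap c z₀ z)) z₀ :=
    ContDiffAt.comp z₀ (g := μ.phiDualC (c z₀ : M)) (μ.contDiffAt_phiDualC (c z₀ : M))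
      (h.contDiffAt_coordMap hc)
  have h2 := h1.clm_comp (h.contDiffAt_fundC_coordMap hc)
  have h3 : (μ.phiDualC (c z₀) (μ.coordMap c z₀ z₀)).comp
      (fundC d n G (c z₀ : M) (μ.coordMap c z₀ z₀)) = μ.pairingEquiv (c z₀).2 := by
    obtain ⟨hz, hz1, -⟩ := (h.eventually_coordMap hc).self_of_nhds
    rw [← μ.pairing_eq _ hz, hz1, ← μ.coe_pairingEquiv (c z₀).2]
  refine ContDiffAt.clm_comp ?_ (h1.clm_comp (contDiffAt_fderiv (h.contDiffAt_coordMap hc)))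
  refine ContDiffAt.comp z₀ (g := ContinuousLinearMap.inverse) ?_ h2
  rw [h3]
  exact contDiffAt_map_inverse _

theorem contDiffAt_liftC (hc : SmoothAt E (Eu m) c z₀) : ContDiffAt ℝ ∞ (μ.liftC m c z₀) z₀ :=
  (contDiffAt_fderiv (h.contDiffAt_coordMap hc)).sub
    ((h.contDiffAt_fundC_coordMap hc).clm_comp (h.contDiffAt_connPb hc))

/-- The map `liftC` is the coordinate expression of the horizontal part of the derivative. -/
theorem eventually_liftC (hc : SmoothAt E (Eu m) c z₀) : ∀ᶠ z in 𝓝 z₀, ∀ v,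
    dsym (c z₀ : M) (μ.coordMap c z₀ z) (μ.liftC m c z₀ z v) =
      μ.inclE m (c z) (μ.horE m (c z) (md E (Eu m) c z v)) := by
  filter_upwards [h.eventually_coordMap hc] with z ⟨hz, hz1, hz2⟩ v
  have h1 := md_symm_md_ch (E := Eu n) hz (μ.inclE m (c z) (md E (Eu m) c z v))
  have h2 := md_symm_md_ch (E := Eu n) hz (fundE d n G (c z : M) (μ.connPb m c z v))
  rw [h.inclE_horE, liftC]
  simp only [sub_apply, ContinuousLinearMap.comp_apply, map_sub, hz2]
  rw [fundC_eq _ hz, ContinuousLinearMap.comp_apply, dch, hz1] at *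
  rw [h1, h2]
  rfl

/-- At a point where `c` is horizontal, the horizontal part of its derivative is a lift along `c`.
-/
theorem isLiftAt (hc : SmoothAt E (Eu m) c z₀) (h0 : μ.connPb m c z₀ = 0) :
    IsLiftAt (μ.coordMap c z₀) (μ.liftC m c z₀) (fundE d n G (c z₀ : M))
      (fderiv ℝ (μ.connPb m c) z₀) z₀ where
  smooth := h.contDiffAt_coordMap hc
  diff := (h.contDiffAt_liftC hc).differentiableAt (by simp)
  eq := by rw [liftC, h0, ContinuousLinearMap.comp_zero, sub_zero]
  fderiv_eq w u := by
    obtain ⟨hz, hz1, -⟩ := (h.eventually_coordMap hc).self_of_nhds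
    have h5 : fundC d n G (c z₀ : M) (μ.coordMap c z₀ z₀) = fundE d n G (c z₀ : M) := by
      rw [fundC_eq _ hz, hz1, dch, hz1, md_ch_self]
      rfl
    rw [← h5]
    exact fderiv_sub_comp_apply
      ((contDiffAt_fderiv (h.contDiffAt_coordMap hc)).differentiableAt (by simp))
      ((h.contDiffAt_fundC_coordMap hc).differentiableAt (by simp))
      ((h.contDiffAt_connPb hc).differentiableAt (by simp)) h0 w u

/-- The connection form is smooth. -/
theorem smoothForm_conn :
    SmoothForm (n := m) (M := μ.zeroLevel) (toForm (n := m) (M := μ.zeroLevel) (μ.conn m)) := by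
  intro x
  refine contDiffAt_alternating_iff.2 fun v => ?_
  exact (h.contDiffAt_connPb (smoothAt_ch_symm_self x)).clm_apply contDiffAt_const

theorem isConnectionForm (hS : Preserves G S) : μ.IsConnectionForm (m := m) (μ.conn m) where
  smooth Y hY q := by
    refine (smoothAt_iff_comp_symm (f := fun q => μ.conn m q (Y q))).2 ?_
    have h1 := (h.contDiffAt_connPb (smoothAt_ch_symm_self q)).clm_apply
      (contMDiffAt_vectorField_iff.1 (hY q))
    refine h1.congr_of_eventuallyEq ?_
    filter_upwards [eventually_ch_target (E := Eu m) q] with z hz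
    rw [connPb, ContinuousLinearMap.comp_apply]
    erw [md_symm_md_ch hz]
  equivariant g q v := h.conn_actE hS g q v
  fund_eq q A := h.conn_fundE q A
  ker_eq q v := μ.conn_eq_zero_iff q v

end IsReductionAtlas

end MomentMap

/-! ### Horizontal lifts and the reduced tensors -/

/-- A smooth family of linear maps which is injective at a point has a smooth family of left
inverses near that point. -/
theorem exists_contDiffAt_leftInverse {E V W : Type*} [NormedAddCommGroup E] [NormedSpace ℝ E]
    [NormedAddCommGroup V] [NormedSpace ℝ V] [FiniteDimensional ℝ V] [NormedAddCommGroup W]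
    [NormedSpace ℝ W] [FiniteDimensional ℝ W] {L : E → V →L[ℝ] W} {z : E}
    (hL : ContDiffAt ℝ ∞ L z) (hi : Function.Injective (L z)) :
    ∃ B : E → W →L[ℝ] V, ContDiffAt ℝ ∞ B z ∧ ∀ᶠ y in 𝓝 z, ∀ v, B y (L y v) = v := by
  obtain ⟨P, hP⟩ := LinearMap.exists_leftInverse_of_injective (L z).toLinearMap
    (LinearMap.ker_eq_bot.2 hi)
  have : CompleteSpace V := FiniteDimensional.complete ℝ V
  have hP' : P.toContinuousLinearMap.comp (L z) = ContinuousLinearEquiv.refl ℝ V := by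
    ext v; exact LinearMap.congr_fun hP v
  have h1 : ContDiffAt ℝ ∞ (fun y => P.toContinuousLinearMap.comp (L y)) z :=
    contDiffAt_const.clm_comp hL
  refine ⟨fun y => (P.toContinuousLinearMap.comp (L y)).inverse.comp P.toContinuousLinearMap,
    ContDiffAt.clm_comp ?_ contDiffAt_const, ?_⟩
  · refine ContDiffAt.comp z (g := ContinuousLinearMap.inverse) ?_ h1
    rw [hP']
    exact contDiffAt_map_inverse _
  · have h2 : ∀ᶠ y in 𝓝 z, P.toContinuousLinearMap.comp (L y) ∈
        Set.range ((↑) : (V ≃L[ℝ] V) → V →L[ℝ] V) := by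
      refine h1.continuousAt.eventually ?_
      simp only [hP']
      exact ContinuousLinearEquiv.nhds _
    filter_upwards [h2] with y ⟨e, he⟩ v
    rw [← he, ContinuousLinearMap.inverse_equiv]
    have h3 : e v = P.toContinuousLinearMap (L y v) := DFunLike.congr_fun he v
    change e.symm (P.toContinuousLinearMap (L y v)) = v
    rw [← h3, e.symm_apply_apply]

/-- If `D` has left inverse `P` and its image lies in the kernel of a surjective `C`, the
dimensions being complementary, then `P` is a right inverse of `D` on that kernel. -/
theorem apply_leftInverse_of_finrank {V W A : Type*} [AddCommGroup V] [Module ℝ V]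
    [AddCommGroup W] [Module ℝ W] [AddCommGroup A] [Module ℝ A] [FiniteDimensional ℝ V]
    [FiniteDimensional ℝ W] {D : V →ₗ[ℝ] W} {P : W →ₗ[ℝ] V} {C : W →ₗ[ℝ] A}
    (hPD : ∀ v, P (D v) = v) (hCD : ∀ v, C (D v) = 0) (hC : Function.Surjective C)
    (hdim : Module.finrank ℝ V + Module.finrank ℝ A = Module.finrank ℝ W) {w : W} (hw : C w = 0) :
    D (P w) = w := by
  have h1 : LinearMap.range D ≤ LinearMap.ker C := by
    rintro _ ⟨u, rfl⟩
    exact hCD u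
  have h3 := LinearMap.finrank_range_of_inj (f := D) (Function.LeftInverse.injective hPD)
  have h4 := LinearMap.finrank_range_add_finrank_ker C
  rw [LinearMap.range_eq_top.2 hC, finrank_top] at h4
  have h5 := Submodule.eq_of_le_of_finrank_eq h1 (by omega)
  have h6 : w ∈ LinearMap.ker C := hw
  rw [← h5] at h6
  obtain ⟨u, rfl⟩ := h6
  rw [hPD]

namespace MomentMap

variable {d n m k : ℕ} {G : Type*} [TopologicalSpace G] [ChartedSpace (Eu d) G] [Group G]
  {M : Type*} [TopologicalSpace M] [ChartedSpace (Eu n) M]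
  [IsManifold (𝓡 n) ∞ M] [MulAction G M]
  {S : AlmostContactMetric n M} {μ : MomentMap d G S}
  [ChartedSpace (Eu m) μ.zeroLevel] [ChartedSpace (Eu k) μ.Reduction]
  [LieGroup (𝓡 d) ∞ G] [ContMDiffSMul (𝓡 d) (𝓡 n) ∞ G M]
  [IsManifold (𝓡 m) ∞ μ.zeroLevel] [IsManifold (𝓡 k) ∞ μ.Reduction]

namespace IsReductionAtlas

variable (h : μ.IsReductionAtlas m k) {q : μ.zeroLevel} {s : Eu k → μ.zeroLevel}

include h

theorem smoothAt_section (hs : μ.IsHorSection (m := m) q s) :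
    SmoothAt (Eu k) (Eu m) s (ch (Eu k) (μ.proj q) (μ.proj q)) :=
  hs.smooth.self_of_nhds

theorem eventually_projE_section (hs : μ.IsHorSection (m := m) q s) :
    ∀ᶠ z in 𝓝 (ch (Eu k) (μ.proj q) (μ.proj q)), ∀ u,
      μ.projE m k (s z) (md (Eu k) (Eu m) s z u) = dsym (μ.proj q) z u := by
  filter_upwards [hs.proj.eventually_nhds, hs.smooth] with z hz hz' u
  rw [dsym, ← md_congr hz]
  exact (md_comp_apply (f := s) (g := μ.proj) (h.proj_smooth _) hz' u).symm

theorem projE_section (hs : μ.IsHorSection (m := m) q s) (u : Eu k) :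
    μ.projE m k q (md (Eu k) (Eu m) s (ch (Eu k) (μ.proj q) (μ.proj q)) u) = u := by
  have h1 := (h.eventually_projE_section hs).self_of_nhds u
  rw [hs.base, dsym, md_ch_symm_self] at h1
  exact h1

theorem connPb_section (hs : μ.IsHorSection (m := m) q s) :
    μ.connPb m s (ch (Eu k) (μ.proj q) (μ.proj q)) = 0 := by
  ext1 u
  rw [connPb, hs.base, ContinuousLinearMap.comp_apply, zero_apply]
  exact (μ.conn_eq_zero_iff q _).2 (hs.horizontal u)

theorem section_projE (hs : μ.IsHorSection (m := m) q s) {v : Eu m} (hv : μ.conn m q v = 0) :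
    md (Eu k) (Eu m) s (ch (Eu k) (μ.proj q) (μ.proj q)) (μ.projE m k q v) = v := by
  refine apply_leftInverse_of_finrank
    (D := (md (Eu k) (Eu m) s (ch (Eu k) (μ.proj q) (μ.proj q))).toLinearMap)
    (P := (μ.projE m k q).toLinearMap) (C := (μ.conn m q).toLinearMap) (h.projE_section hs)
    (fun u => (μ.conn_eq_zero_iff q _).2 (hs.horizontal u)) (fun A => ⟨_, h.conn_fundE q A⟩) ?_ hv
  have := h.dim_quotient q
  simpa using this

/-- The derivative of the section inverts the projection on horizontal vectors. -/
theorem section_projE' (hs : μ.IsHorSection (m := m) q s) (v : Eu m) :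
    md (Eu k) (Eu m) s (ch (Eu k) (μ.proj q) (μ.proj q)) (μ.projE m k q v) = μ.horE m q v := by
  rw [← h.projE_horE, h.section_projE hs (h.conn_horE q v)]

/-- The horizontal lift of the tangent space of the quotient to the tangent space of the zero
level at `q`, as the derivative of a section which is horizontal at `q`. It does not depend on
the section, being inverse to the projection on horizontal vectors. -/
def hLift (q : μ.zeroLevel) : Eu k →L[ℝ] Eu m :=
  md (Eu k) (Eu m) (h.exists_section q).choose (ch (Eu k) (μ.proj q) (μ.proj q))

theorem conn_hLift (q : μ.zeroLevel) (u : Eu k) : μ.conn m q (h.hLift q u) = 0 :=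
  (μ.conn_eq_zero_iff q _).2 ((h.exists_section q).choose_spec.horizontal u)

theorem projE_hLift (q : μ.zeroLevel) (u : Eu k) : μ.projE m k q (h.hLift q u) = u :=
  h.projE_section (h.exists_section q).choose_spec u

theorem hLift_projE (q : μ.zeroLevel) (v : Eu m) : h.hLift q (μ.projE m k q v) = μ.horE m q v :=
  h.section_projE' (h.exists_section q).choose_spec v

/-- The horizontal lift, as a map to the tangent space of `M`. -/
def liftM (q : μ.zeroLevel) : Eu k →L[ℝ] Eu n := (μ.inclE m q).comp (h.hLift q)

theorem liftM_projE (q : μ.zeroLevel) (v : Eu m) :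
    h.liftM q (μ.projE m k q v) = μ.inclE m q (μ.horE m q v) := by
  rw [liftM, ContinuousLinearMap.comp_apply, h.hLift_projE]

theorem liftM_injective (q : μ.zeroLevel) : Function.Injective (h.liftM q) :=
  (h.inclE_injective q).comp (Function.LeftInverse.injective (h.projE_hLift q))

theorem dE_liftM (q : μ.zeroLevel) (u : Eu k) : μ.dE q (h.liftM q u) = 0 := h.dE_inclE q _

theorem phiDual_liftM (q : μ.zeroLevel) (u : Eu k) : μ.phiDual q (h.liftM q u) = 0 :=
  (μ.conn_eq_zero_iff q _).1 (h.conn_hLift q u)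

/-- The horizontal lifts are the vectors annihilated by `dμ` and by `dμ ∘ φ`; this space contains
`ξ` and is invariant under `φ`. -/
theorem exists_liftM {q : μ.zeroLevel} {w : Eu n} (hw : μ.dE q w = 0) (hw' : μ.phiDual q w = 0) :
    ∃ u, h.liftM q u = w := by
  obtain ⟨v, rfl⟩ := h.exists_inclE q hw
  refine ⟨μ.projE m k q v, ?_⟩
  rw [h.liftM_projE, h.horE_of_conn ((μ.conn_eq_zero_iff q v).2 hw')]

theorem liftM_smul (hS : Preserves G S) (g : G) (q : μ.zeroLevel) (u : Eu k) :
    h.liftM (g • q) u = actE n g (q : M) (h.liftM q u) := by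
  have h1 := h.hLift_projE (g • q) (actE m g q (h.hLift q u))
  rw [h.horE_of_conn (h.conn_actE_of_conn hS g (h.conn_hLift q u)), h.projE_actE,
    h.projE_hLift] at h1
  rw [liftM, ContinuousLinearMap.comp_apply, h1, h.inclE_actE]
  rfl

/-- A left inverse of the horizontal lift. Only its values on horizontal vectors matter. -/
def dropM (q : μ.zeroLevel) : Eu n →L[ℝ] Eu k :=
  (LinearMap.exists_leftInverse_of_injective (h.liftM q).toLinearMap
    (LinearMap.ker_eq_bot.2 (h.liftM_injective q))).choose.toContinuousLinearMap

theorem dropM_liftM (q : μ.zeroLevel) (u : Eu k) : h.dropM q (h.liftM q u) = u :=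
  LinearMap.congr_fun (LinearMap.exists_leftInverse_of_injective (h.liftM q).toLinearMap
    (LinearMap.ker_eq_bot.2 (h.liftM_injective q))).choose_spec u

theorem liftM_dropM {q : μ.zeroLevel} {w : Eu n} (hw : μ.dE q w = 0) (hw' : μ.phiDual q w = 0) :
    h.liftM q (h.dropM q w) = w := by
  obtain ⟨u, rfl⟩ := h.exists_liftM hw hw'
  rw [h.dropM_liftM]

/-- The reduced metric, evaluated on horizontal lifts to a representative of the class. -/
def redMetric (y : μ.Reduction) : Eu k →L[ℝ] Eu k →L[ℝ] ℝ :=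
  (S.gE (y.out : M)).bilinearComp (h.liftM y.out) (h.liftM y.out)

/-- The reduced Reeb field, the projection of the Reeb field at a representative. -/
def redReeb (y : μ.Reduction) : Eu k := h.dropM y.out (S.reebE (y.out : M))

/-- The reduced endomorphism, the projection of `φ` on horizontal lifts to a representative. -/
def redPhi (y : μ.Reduction) : Eu k →L[ℝ] Eu k :=
  (h.dropM y.out).comp ((S.phiE (y.out : M)).comp (h.liftM y.out))

omit h in
theorem exists_smul_out (q : μ.zeroLevel) : ∃ g : G, g • (μ.proj q).out = q := by
  have h1 : (⟦q⟧ : μ.Reduction) = ⟦(μ.proj q).out⟧ := (Quotient.out_eq (μ.proj q)).symm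
  exact Quotient.exact h1

/-- By invariance, the reduced metric may be evaluated at any representative. -/
theorem redMetric_proj (hS : Preserves G S) (q : μ.zeroLevel) (u v : Eu k) :
    h.redMetric (μ.proj q) u v = S.gE (q : M) (h.liftM q u) (h.liftM q v) := by
  obtain ⟨g, hg⟩ := exists_smul_out q
  have h1 : ∀ u, h.liftM q u = actE n g ((μ.proj q).out : M) (h.liftM (μ.proj q).out u) := by
    intro u
    rw [← h.liftM_smul hS, hg]
  have h2 : S.gE (q : M) = S.gE (g • ((μ.proj q).out : M)) := by
    rw [show g • ((μ.proj q).out : M) = q from congrArg Subtype.val hg]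
  rw [h1, h1, h2]
  exact (hS.metric g _ _ _).symm

theorem liftM_redReeb (hS : Preserves G S) (q : μ.zeroLevel) :
    h.liftM q (h.redReeb (μ.proj q)) = S.reebE (q : M) := by
  obtain ⟨g, hg⟩ := exists_smul_out q
  have h2 : S.reebE (q : M) = S.reebE (g • ((μ.proj q).out : M)) := by
    rw [show g • ((μ.proj q).out : M) = q from congrArg Subtype.val hg]
  have h1 : ∀ u, h.liftM q u = actE n g ((μ.proj q).out : M) (h.liftM (μ.proj q).out u) := by
    intro u
    rw [← h.liftM_smul hS, hg]
  rw [h1, redReeb, h.liftM_dropM (μ.dE_reeb _) (μ.phiDual_reeb _), h2]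
  exact hS.reeb g _

theorem liftM_redPhi (hS : Preserves G S) (q : μ.zeroLevel) (u : Eu k) :
    h.liftM q (h.redPhi (μ.proj q) u) = S.phiE (q : M) (h.liftM q u) := by
  obtain ⟨g, hg⟩ := exists_smul_out q
  have h1 : ∀ u, h.liftM q u = actE n g ((μ.proj q).out : M) (h.liftM (μ.proj q).out u) := by
    intro u
    rw [← h.liftM_smul hS, hg]
  have h2 : S.phiE (q : M) = S.phiE (g • ((μ.proj q).out : M)) := by
    rw [show g • ((μ.proj q).out : M) = q from congrArg Subtype.val hg]
  rw [h1, h1, h2, redPhi]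
  simp only [ContinuousLinearMap.comp_apply]
  rw [h.liftM_dropM (q := (μ.proj q).out)
    (w := S.phiE ((μ.proj q).out : M) (h.liftM (μ.proj q).out u)) (h.phiDual_liftM _ u)
    (by rw [μ.phiDual_phi, h.dE_liftM, neg_zero])]
  exact hS.phi g _ _

end IsReductionAtlas

end MomentMap

/-! ### The reduced almost contact metric structure -/

set_option synthInstance.maxHeartbeats 200000 in
theorem contDiffAt_bilinearComp {E V W : Type*} [NormedAddCommGroup E] [NormedSpace ℝ E]
    [NormedAddCommGroup V] [NormedSpace ℝ V] [NormedAddCommGroup W] [NormedSpace ℝ W]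
    {B : E → W →L[ℝ] W →L[ℝ] ℝ} {L : E → V →L[ℝ] W} {z : E} (hB : ContDiffAt ℝ ∞ B z)
    (hL : ContDiffAt ℝ ∞ L z) : ContDiffAt ℝ ∞ (fun y => (B y).bilinearComp (L y) (L y)) z := by
  have h1 : ContDiffAt ℝ ∞ (fun y => (ContinuousLinearMap.compL ℝ V W ℝ).flip (L y)) z :=
    contDiffAt_const.clm_apply hL
  exact h1.clm_comp (hB.clm_comp hL)

/-- The unit ball of a positive definite form is bounded: the form has a positive minimum on the
unit sphere. -/
theorem isVonNBounded_of_pos {V : Type*} [NormedAddCommGroup V] [NormedSpace ℝ V]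
    [FiniteDimensional ℝ V] (B : V →L[ℝ] V →L[ℝ] ℝ) (hB : ∀ v, v ≠ 0 → 0 < B v v) :
    Bornology.IsVonNBounded ℝ {v : V | B v v < 1} := by
  rw [NormedSpace.isVonNBounded_iff]
  rcases subsingleton_or_nontrivial V with hV | hV
  · exact (Set.subsingleton_of_subsingleton).finite.isBounded
  obtain ⟨w, hw, hmin⟩ := (isCompact_sphere (0 : V) 1).exists_isMinOn
    (NormedSpace.sphere_nonempty.2 zero_le_one) (f := fun v => B v v)
    (Continuous.continuousOn (by fun_prop))
  have hw1 : ‖w‖ = 1 := by simpa using hw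
  have hc : 0 < B w w := hB w (by rintro rfl; simp at hw1)
  refine (Metric.isBounded_iff_subset_closedBall 0).2 ⟨1 + 1 / B w w, fun v hv => ?_⟩
  rw [mem_closedBall_zero_iff]
  by_contra! hlt
  have hv0 : 0 < ‖v‖ := lt_trans (by positivity) hlt
  have h1 : B w w ≤ B (‖v‖⁻¹ • v) (‖v‖⁻¹ • v) :=
    hmin (by simp [norm_smul, hv0.ne'])
  have h2 : B w w * ‖v‖ ^ 2 ≤ B v v := by
    simp only [map_smul, smul_apply, smul_eq_mul] at h1
    have h3 : ‖v‖⁻¹ * (‖v‖⁻¹ * B v v) * ‖v‖ ^ 2 = B v v := by field_simp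
    rw [← h3]
    gcongr
  have h4 : B v v < 1 := hv
  have h5 : (1 : ℝ) ≤ ‖v‖ := by
    have : 0 ≤ 1 / B w w := by positivity
    linarith
  have h6 : 1 < B w w * ‖v‖ := by
    have : B w w * (1 / B w w) = 1 := by field_simp
    nlinarith
  nlinarith

namespace MomentMap

variable {d n m k : ℕ} {G : Type*} [TopologicalSpace G] [ChartedSpace (Eu d) G] [Group G]
  {M : Type*} [TopologicalSpace M] [ChartedSpace (Eu n) M]
  [IsManifold (𝓡 n) ∞ M] [MulAction G M]
  {S : AlmostContactMetric n M} {μ : MomentMap d G S}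
  [ChartedSpace (Eu m) μ.zeroLevel] [ChartedSpace (Eu k) μ.Reduction]
  [LieGroup (𝓡 d) ∞ G] [ContMDiffSMul (𝓡 d) (𝓡 n) ∞ G M]
  [IsManifold (𝓡 m) ∞ μ.zeroLevel] [IsManifold (𝓡 k) ∞ μ.Reduction]

namespace IsReductionAtlas

variable (h : μ.IsReductionAtlas m k) (hS : Preserves G S) {q : μ.zeroLevel}
  {s : Eu k → μ.zeroLevel} (hs : μ.IsHorSection (m := m) q s)

include h

/-- Along a section, `liftC` expresses the horizontal lift in coordinates, also away from the
point where the section is horizontal. -/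
theorem eventually_liftM (hs : μ.IsHorSection (m := m) q s) :
    ∀ᶠ z in 𝓝 (ch (Eu k) (μ.proj q) (μ.proj q)), ∀ u,
      dsym (s (ch (Eu k) (μ.proj q) (μ.proj q)) : M)
        (μ.coordMap s (ch (Eu k) (μ.proj q) (μ.proj q)) z)
        (μ.liftC m s (ch (Eu k) (μ.proj q) (μ.proj q)) z u) =
      h.liftM (s z) (dsym (μ.proj q) z u) := by
  filter_upwards [h.eventually_liftC (h.smoothAt_section hs), h.eventually_projE_section hs]
    with z hz hz' u
  rw [hz, ← hz', h.liftM_projE]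

theorem liftC_self (hs : μ.IsHorSection (m := m) q s) (u : Eu k) :
    μ.liftC m s (ch (Eu k) (μ.proj q) (μ.proj q)) (ch (Eu k) (μ.proj q) (μ.proj q)) u =
      h.liftM q u := by
  have h1 := (h.eventually_liftM hs).self_of_nhds u
  rw [coordMap, dsym, md_ch_symm_self, dsym, md_ch_symm_self] at h1
  conv_rhs at h1 => rw [hs.base]
  exact h1

/-- The coordinate expression of the reduced metric. -/
def redMetricC (y : μ.Reduction) (z : Eu k) : Eu k →L[ℝ] Eu k →L[ℝ] ℝ :=
  (h.redMetric ((ch (Eu k) y).symm z)).bilinearComp (dsym y z) (dsym y z)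

/-- The coordinate expression of the reduced endomorphism. -/
def redPhiC (y : μ.Reduction) (z : Eu k) : Eu k →L[ℝ] Eu k :=
  (dch y z).comp ((h.redPhi ((ch (Eu k) y).symm z)).comp (dsym y z))

/-- The coordinate expression of the reduced Reeb field. -/
def redReebC (y : μ.Reduction) (z : Eu k) : Eu k := coordVF h.redReeb y z

include hS hs

theorem eventually_redMetricC : h.redMetricC (μ.proj q) =ᶠ[𝓝 (ch (Eu k) (μ.proj q) (μ.proj q))]
    fun z => (S.metricC (s (ch (Eu k) (μ.proj q) (μ.proj q)) : M)
      (μ.coordMap s (ch (Eu k) (μ.proj q) (μ.proj q)) z)).bilinearComp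
        (μ.liftC m s (ch (Eu k) (μ.proj q) (μ.proj q)) z)
        (μ.liftC m s (ch (Eu k) (μ.proj q) (μ.proj q)) z) := by
  filter_upwards [h.eventually_liftM hs, hs.proj,
    h.eventually_coordMap (h.smoothAt_section hs)] with z hz hz' ⟨_, hz'', _⟩
  ext u v
  simp only [redMetricC, AlmostContactMetric.metricC, ContinuousLinearMap.bilinearComp_apply]
  rw [hz, hz, hz'', ← hz', h.redMetric_proj hS]

theorem eventually_redPhiC : ∀ᶠ z in 𝓝 (ch (Eu k) (μ.proj q) (μ.proj q)),
    (μ.liftC m s (ch (Eu k) (μ.proj q) (μ.proj q)) z).comp (h.redPhiC (μ.proj q) z) =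
      (S.phiC (s (ch (Eu k) (μ.proj q) (μ.proj q)) : M)
        (μ.coordMap s (ch (Eu k) (μ.proj q) (μ.proj q)) z)).comp
        (μ.liftC m s (ch (Eu k) (μ.proj q) (μ.proj q)) z) := by
  filter_upwards [h.eventually_liftM hs, hs.proj, eventually_ch_target (E := Eu k) (μ.proj q),
    h.eventually_coordMap (h.smoothAt_section hs)] with z hz hz' hzt ⟨hzt', hz'', _⟩
  ext1 u
  rw [ContinuousLinearMap.comp_apply, ContinuousLinearMap.comp_apply]
  refine (Function.LeftInverse.injective (md_ch_md_symm (E := Eu n) hzt')) ?_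
  change dsym _ _ _ = dsym _ _ _
  rw [hz, redPhiC, ContinuousLinearMap.comp_apply, ContinuousLinearMap.comp_apply]
  rw [show dsym (μ.proj q) z (dch (μ.proj q) z (h.redPhi ((ch (Eu k) (μ.proj q)).symm z)
    (dsym (μ.proj q) z u))) = _ from md_symm_md_ch hzt _, ← hz', h.liftM_redPhi hS,
    AlmostContactMetric.phiC, ContinuousLinearMap.comp_apply, ContinuousLinearMap.comp_apply, hz,
    hz'']
  have h1 := md_symm_md_ch (E := Eu n) hzt' (S.phiE (s z : M) (h.liftM (s z) (dsym (μ.proj q) z u)))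
  rw [hz''] at h1
  rw [dch, hz'']
  exact h1.symm

theorem eventually_redReebC : ∀ᶠ z in 𝓝 (ch (Eu k) (μ.proj q) (μ.proj q)),
    μ.liftC m s (ch (Eu k) (μ.proj q) (μ.proj q)) z (h.redReebC (μ.proj q) z) =
      S.reebC (s (ch (Eu k) (μ.proj q) (μ.proj q)) : M)
        (μ.coordMap s (ch (Eu k) (μ.proj q) (μ.proj q)) z) := by
  filter_upwards [h.eventually_liftM hs, hs.proj, eventually_ch_target (E := Eu k) (μ.proj q),
    h.eventually_coordMap (h.smoothAt_section hs)] with z hz hz' hzt ⟨hzt', hz'', _⟩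
  refine (Function.LeftInverse.injective (md_ch_md_symm (E := Eu n) hzt')) ?_
  change dsym _ _ _ = dsym _ _ _
  rw [hz, S.dsym_reebC _ hzt', hz'', redReebC, coordVF]
  rw [show dsym (μ.proj q) z (dch (μ.proj q) z (h.redReeb ((ch (Eu k) (μ.proj q)).symm z))) = _
    from md_symm_md_ch hzt _, ← hz', h.liftM_redReeb hS]

theorem contDiffAt_redMetricC :
    ContDiffAt ℝ ∞ (h.redMetricC (μ.proj q)) (ch (Eu k) (μ.proj q) (μ.proj q)) := by
  refine ContDiffAt.congr_of_eventuallyEq ?_ (h.eventually_redMetricC hS hs)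
  refine contDiffAt_bilinearComp ?_ (h.contDiffAt_liftC (h.smoothAt_section hs))
  exact ContDiffAt.comp _ (g := S.metricC (s (ch (Eu k) (μ.proj q) (μ.proj q)) : M))
    (S.contDiffAt_metricC _) (h.contDiffAt_coordMap (h.smoothAt_section hs))

/-- The lift of the reduced endomorphism is smooth by `eventually_redPhiC`; composing with a
smooth family of left inverses of the lift gives the endomorphism itself. -/
theorem contDiffAt_redPhiC :
    ContDiffAt ℝ ∞ (h.redPhiC (μ.proj q)) (ch (Eu k) (μ.proj q) (μ.proj q)) := by
  have hL := h.contDiffAt_liftC (h.smoothAt_section hs)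
  obtain ⟨B, hB, hBL⟩ := exists_contDiffAt_leftInverse hL
    (by rw [show ⇑(μ.liftC m s (ch (Eu k) (μ.proj q) (μ.proj q)) _) = h.liftM q from
      funext (h.liftC_self hs)]; exact h.liftM_injective q)
  have hφ : ContDiffAt ℝ ∞ (fun z => S.phiC (s (ch (Eu k) (μ.proj q) (μ.proj q)) : M)
      (μ.coordMap s (ch (Eu k) (μ.proj q) (μ.proj q)) z)) (ch (Eu k) (μ.proj q) (μ.proj q)) :=
    ContDiffAt.comp _ (g := S.phiC (s (ch (Eu k) (μ.proj q) (μ.proj q)) : M))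
      (S.contDiffAt_phiC _) (h.contDiffAt_coordMap (h.smoothAt_section hs))
  refine ContDiffAt.congr_of_eventuallyEq (hB.clm_comp (hφ.clm_comp hL)) ?_
  filter_upwards [hBL, h.eventually_redPhiC hS hs] with z hz hz'
  rw [← hz']
  ext1 u
  exact (hz _).symm

theorem contDiffAt_redReebC :
    ContDiffAt ℝ ∞ (h.redReebC (μ.proj q)) (ch (Eu k) (μ.proj q) (μ.proj q)) := by
  have hL := h.contDiffAt_liftC (h.smoothAt_section hs)
  obtain ⟨B, hB, hBL⟩ := exists_contDiffAt_leftInverse hL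
    (by rw [show ⇑(μ.liftC m s (ch (Eu k) (μ.proj q) (μ.proj q)) _) = h.liftM q from
      funext (h.liftC_self hs)]; exact h.liftM_injective q)
  have hξ : ContDiffAt ℝ ∞ (fun z => S.reebC (s (ch (Eu k) (μ.proj q) (μ.proj q)) : M)
      (μ.coordMap s (ch (Eu k) (μ.proj q) (μ.proj q)) z)) (ch (Eu k) (μ.proj q) (μ.proj q)) :=
    ContDiffAt.comp _ (g := S.reebC (s (ch (Eu k) (μ.proj q) (μ.proj q)) : M))
      (S.contDiffAt_reebC _) (h.contDiffAt_coordMap (h.smoothAt_section hs))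
  refine ContDiffAt.congr_of_eventuallyEq (hB.clm_apply hξ) ?_
  filter_upwards [hBL, h.eventually_redReebC hS hs] with z hz hz'
  rw [← hz', hz]

omit hs

omit h hS in
theorem proj_surjective (y : μ.Reduction) : ∃ q, μ.proj q = y := ⟨y.out, Quotient.out_eq y⟩

theorem redPhi_redPhi (y : μ.Reduction) (v : Eu k) : h.redPhi y (h.redPhi y v) =
    -v + h.redMetric y (h.redReeb y) v • h.redReeb y := by
  obtain ⟨q, rfl⟩ := proj_surjective y
  apply h.liftM_injective q
  rw [h.liftM_redPhi hS, h.liftM_redPhi hS, map_add, map_neg, map_smul, h.liftM_redReeb hS,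
    h.redMetric_proj hS, h.liftM_redReeb hS]
  exact S.phi_sq _ _

theorem redMetric_redPhi (y : μ.Reduction) (u v : Eu k) :
    h.redMetric y (h.redPhi y u) (h.redPhi y v) =
      h.redMetric y u v - h.redMetric y (h.redReeb y) u * h.redMetric y (h.redReeb y) v := by
  obtain ⟨q, rfl⟩ := proj_surjective y
  simp only [h.redMetric_proj hS, h.liftM_redPhi hS, h.liftM_redReeb hS]
  exact S.metric_phi _ _ _

theorem redMetric_redReeb (y : μ.Reduction) :
    h.redMetric y (h.redReeb y) (h.redReeb y) = 1 := by
  obtain ⟨q, rfl⟩ := proj_surjective y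
  rw [h.redMetric_proj hS, h.liftM_redReeb hS]
  exact S.reeb_unit _

theorem redPhi_redReeb (y : μ.Reduction) : h.redPhi y (h.redReeb y) = 0 := by
  obtain ⟨q, rfl⟩ := proj_surjective y
  apply h.liftM_injective q
  rw [h.liftM_redPhi hS, h.liftM_redReeb hS, map_zero]
  exact S.phi_reeb _

/-- The almost contact metric structure induced on the quotient. -/
def reduced : AlmostContactMetric k μ.Reduction where
  metric :=
    { inner := fun y => h.redMetric y
      symm := fun _ _ _ => S.metric.symm _ _ _
      pos := fun y v hv => S.metric.pos _ _
        fun h0 => hv (h.liftM_injective y.out (h0.trans (map_zero _).symm))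
      isVonNBounded := fun y => isVonNBounded_of_pos (h.redMetric y) fun v hv =>
        S.metric.pos _ _ fun h0 => hv (h.liftM_injective y.out (h0.trans (map_zero _).symm))
      contMDiff := fun y => by
        obtain ⟨q, rfl⟩ := proj_surjective y
        obtain ⟨s, hs⟩ := h.exists_section q
        exact contMDiffAt_bilinear_iff.2 (h.contDiffAt_redMetricC hS hs) }
  reeb y := h.redReeb y
  reeb_smooth y := by
    obtain ⟨q, rfl⟩ := proj_surjective y
    obtain ⟨s, hs⟩ := h.exists_section q
    exact contMDiffAt_vectorField_iff.2 (h.contDiffAt_redReebC hS hs)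
  phi y := h.redPhi y
  phi_smooth y := by
    obtain ⟨q, rfl⟩ := proj_surjective y
    obtain ⟨s, hs⟩ := h.exists_section q
    exact contMDiffAt_endomorphism_iff.2 (h.contDiffAt_redPhiC hS hs)
  reeb_unit y := h.redMetric_redReeb hS y
  phi_reeb y := h.redPhi_redReeb hS y
  phi_sq y v := h.redPhi_redPhi hS y v
  metric_phi y u v := h.redMetric_redPhi hS y u v

theorem redMetric_projE (q : μ.zeroLevel) {u v : Eu m} (hu : μ.conn m q u = 0)
    (hv : μ.conn m q v = 0) : h.redMetric (μ.proj q) (μ.projE m k q u) (μ.projE m k q v) =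
      S.gE (q : M) (μ.inclE m q u) (μ.inclE m q v) := by
  rw [h.redMetric_proj hS, h.liftM_projE, h.liftM_projE, h.horE_of_conn hu, h.horE_of_conn hv]

theorem liftM_redPhi_projE (q : μ.zeroLevel) {u : Eu m} (hu : μ.conn m q u = 0) :
    h.liftM q (h.redPhi (μ.proj q) (μ.projE m k q u)) = S.phiE (q : M) (μ.inclE m q u) := by
  rw [h.liftM_redPhi hS, h.liftM_projE, h.horE_of_conn hu]

theorem isInduced : μ.IsInduced (m := m) (h.reduced hS) where
  metric q u v hu hv := h.redMetric_projE hS q ((μ.conn_eq_zero_iff q u).2 hu)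
    ((μ.conn_eq_zero_iff q v).2 hv)
  reeb q := ⟨h.hLift q (h.redReeb (μ.proj q)), (μ.conn_eq_zero_iff q _).1 (h.conn_hLift q _),
    h.liftM_redReeb hS q, h.projE_hLift q _⟩
  phi q u hu := ⟨h.hLift q (h.redPhi (μ.proj q) (μ.projE m k q u)),
    (μ.conn_eq_zero_iff q _).1 (h.conn_hLift q _),
    h.liftM_redPhi_projE hS q ((μ.conn_eq_zero_iff q u).2 hu), h.projE_hLift q _⟩

end IsReductionAtlas

end MomentMap

/-! ### Normality and the Killing equation for the reduced structure -/

namespace MomentMap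

variable {d n m k : ℕ} {G : Type*} [TopologicalSpace G] [ChartedSpace (Eu d) G] [Group G]
  {M : Type*} [TopologicalSpace M] [ChartedSpace (Eu n) M]
  [IsManifold (𝓡 n) ∞ M] [MulAction G M]
  {S : AlmostContactMetric n M} {μ : MomentMap d G S}
  [ChartedSpace (Eu m) μ.zeroLevel] [ChartedSpace (Eu k) μ.Reduction]
  [LieGroup (𝓡 d) ∞ G] [ContMDiffSMul (𝓡 d) (𝓡 n) ∞ G M]
  [IsManifold (𝓡 m) ∞ μ.zeroLevel] [IsManifold (𝓡 k) ∞ μ.Reduction]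

variable (m) in
/-- The exterior derivative of the pull-back of the connection form by a map `s`; at a point where
`s` is horizontal this is the curvature. -/
def secCurv (s : Eu k → μ.zeroLevel) (z u v : Eu k) : Eu d :=
  fderiv ℝ (μ.connPb m s) z u v - fderiv ℝ (μ.connPb m s) z v u

namespace IsReductionAtlas

variable (h : μ.IsReductionAtlas m k) (hS : Preserves G S) {q : μ.zeroLevel}
  {s : Eu k → μ.zeroLevel} (hs : μ.IsHorSection (m := m) q s)

include h

theorem isLiftAt_section (hs : μ.IsHorSection (m := m) q s) :
    IsLiftAt (μ.coordMap s (ch (Eu k) (μ.proj q) (μ.proj q)))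
      (μ.liftC m s (ch (Eu k) (μ.proj q) (μ.proj q)))
      (fundE d n G (s (ch (Eu k) (μ.proj q) (μ.proj q)) : M))
      (fderiv ℝ (μ.connPb m s) (ch (Eu k) (μ.proj q) (μ.proj q)))
      (ch (Eu k) (μ.proj q) (μ.proj q)) :=
  h.isLiftAt (h.smoothAt_section hs) (h.connPb_section hs)

theorem liftC_injective (hs : μ.IsHorSection (m := m) q s) : Function.Injective
    (μ.liftC m s (ch (Eu k) (μ.proj q) (μ.proj q)) (ch (Eu k) (μ.proj q) (μ.proj q))) := by
  rw [show ⇑(μ.liftC m s (ch (Eu k) (μ.proj q) (μ.proj q)) _) = h.liftM q from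
    funext (h.liftC_self hs)]
  exact h.liftM_injective q

theorem phiDual_liftC (hs : μ.IsHorSection (m := m) q s) (u : Eu k) :
    μ.phiDual q
      (μ.liftC m s (ch (Eu k) (μ.proj q) (μ.proj q)) (ch (Eu k) (μ.proj q) (μ.proj q)) u) = 0 := by
  rw [h.liftC_self hs, h.phiDual_liftM]

theorem dE_liftC (hs : μ.IsHorSection (m := m) q s) (u : Eu k) :
    μ.dE q
      (μ.liftC m s (ch (Eu k) (μ.proj q) (μ.proj q)) (ch (Eu k) (μ.proj q) (μ.proj q)) u) = 0 := by
  rw [h.liftC_self hs, h.dE_liftM]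

include hS hs

/-- The horizontal lift of the normality tensor of the quotient is the normality tensor of `M` on
the lifts, up to fundamental vectors of curvatures and their images under `φ`. -/
theorem liftC_nij (u v : Eu k) :
    μ.liftC m s (ch (Eu k) (μ.proj q) (μ.proj q)) (ch (Eu k) (μ.proj q) (μ.proj q))
      (nij ((h.reduced hS).phiC (μ.proj q)) ((h.reduced hS).reebC (μ.proj q))
        ((h.reduced hS).etaC (μ.proj q)) (ch (Eu k) (μ.proj q) (μ.proj q)) u v) =
      nij (S.phiC q) (S.reebC q) (S.etaC q) (ch (Eu n) (q : M) q) (h.liftM q u) (h.liftM q v)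
      + (fundE d n G (q : M) (secCurv m s (ch (Eu k) (μ.proj q) (μ.proj q))
            (h.redPhi (μ.proj q) u) (h.redPhi (μ.proj q) v))
        - fundE d n G (q : M) (secCurv m s (ch (Eu k) (μ.proj q) (μ.proj q)) u v))
      - S.phiE q (fundE d n G (q : M) (secCurv m s (ch (Eu k) (μ.proj q) (μ.proj q))
            (h.redPhi (μ.proj q) u) v)
        + fundE d n G (q : M) (secCurv m s (ch (Eu k) (μ.proj q) (μ.proj q))
            u (h.redPhi (μ.proj q) v))) := by
  have hL := h.isLiftAt_section hs
  have e0 : μ.coordMap s (ch (Eu k) (μ.proj q) (μ.proj q)) (ch (Eu k) (μ.proj q) (μ.proj q)) =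
    ch (Eu n) (q : M) q := by rw [coordMap, hs.base]
  have e1 : (s (ch (Eu k) (μ.proj q) (μ.proj q)) : M) = q := by rw [hs.base]
  have h1 := hL.nij_eq (R := secCurv m s (ch (Eu k) (μ.proj q) (μ.proj q))) (fun _ _ => rfl)
    (φ := S.phiC q) (ξ := S.reebC q) (η := S.etaC q)
    (φ' := (h.reduced hS).phiC (μ.proj q)) (ξ' := (h.reduced hS).reebC (μ.proj q))
    (η' := (h.reduced hS).etaC (μ.proj q))
    (by rw [e0]; exact (S.contDiffAt_phiC _).differentiableAt (by simp))
    (by rw [e0]; exact (S.contDiffAt_etaC _).differentiableAt (by simp))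
    (((h.reduced hS).contDiffAt_phiC _).differentiableAt (by simp))
    (by rw [← e1]; exact h.eventually_redPhiC hS hs)
    (by rw [← e1]; exact (h.eventually_redReebC hS hs).self_of_nhds)
    (by
      rw [← e1]
      filter_upwards [h.eventually_redMetricC hS hs, h.eventually_redReebC hS hs] with z hz hz'
      ext1 w
      change h.redMetricC (μ.proj q) z (h.redReebC (μ.proj q) z) w = _
      rw [hz, ContinuousLinearMap.bilinearComp_apply, hz']
      rfl)
    (by
      intro w
      rw [e0, S.phiC_self, S.reebC_self, AlmostContactMetric.etaC, S.metricC_self, S.reebC_self]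
      exact S.phi_sq _ w) u v
  rw [h1, (h.reduced hS).phiC_self, e0, S.phiC_self, e1, h.liftC_self hs, h.liftC_self hs]
  rfl

/-- For normal `M`, the curvature is `φ`-invariant. The two identities are the components of
`liftC_nij` transversal to the horizontal space: the left-hand side there is annihilated by `dμ`
and by `dμ ∘ φ`, which are injective on the vectors `φ(A*)` and `A*`, respectively. -/
theorem secCurv_of_normal [T2Space M] (hN : S.IsNormal) (u v : Eu k) :
    secCurv m s (ch (Eu k) (μ.proj q) (μ.proj q)) (h.redPhi (μ.proj q) u) (h.redPhi (μ.proj q) v)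
      = secCurv m s (ch (Eu k) (μ.proj q) (μ.proj q)) u v ∧
    secCurv m s (ch (Eu k) (μ.proj q) (μ.proj q)) (h.redPhi (μ.proj q) u) v
      + secCurv m s (ch (Eu k) (μ.proj q) (μ.proj q)) u (h.redPhi (μ.proj q) v) = 0 := by
  have h1 := h.liftC_nij hS hs u v
  rw [AlmostContactMetric.nij_eq_zero hN, zero_add, ← map_sub, ← map_add] at h1
  constructor
  · have h2 := congrArg (μ.phiDual q) h1
    rw [h.phiDual_liftC hs, map_sub, μ.phiDual_phi, μ.dE_fundE q.2, neg_zero, sub_zero] at h2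
    exact sub_eq_zero.1 (μ.pairing_injective q.2 (h2.symm.trans (map_zero _).symm))
  · have h2 := congrArg (μ.dE q) h1
    rw [h.dE_liftC hs, map_sub, μ.dE_fundE q.2, zero_sub] at h2
    exact μ.pairing_injective q.2 ((neg_eq_zero.1 h2.symm).trans (map_zero _).symm)

/-- As `φ(ξ) = 0`, the invariance of the curvature under `φ` makes it vanish on `ξ`. -/
theorem secCurv_redReeb [T2Space M] (hN : S.IsNormal) (v : Eu k) :
    secCurv m s (ch (Eu k) (μ.proj q) (μ.proj q)) (h.redReeb (μ.proj q)) v = 0 := by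
  rw [← (h.secCurv_of_normal hS hs hN _ v).1, h.redPhi_redReeb hS]
  simp [secCurv]

omit hs

theorem isNormal_reduced [T2Space M] (hN : S.IsNormal) : (h.reduced hS).IsNormal := by
  refine (h.reduced hS).isNormal_of_nij fun y u v => ?_
  obtain ⟨q, rfl⟩ := proj_surjective y
  obtain ⟨s, hs⟩ := h.exists_section q
  apply h.liftC_injective hs
  have h2 := h.secCurv_of_normal hS hs hN u v
  rw [h.liftC_nij hS hs, AlmostContactMetric.nij_eq_zero hN, ← map_add, h2.1, h2.2]
  simp

theorem reebKilling_reduced [T2Space M] (hST : S.IsST) : (h.reduced hS).ReebKilling := by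
  refine (h.reduced hS).reebKilling_of_lieMetric fun y u v => ?_
  obtain ⟨q, rfl⟩ := proj_surjective y
  obtain ⟨s, hs⟩ := h.exists_section q
  have hL := h.isLiftAt_section hs
  have e0 : μ.coordMap s (ch (Eu k) (μ.proj q) (μ.proj q)) (ch (Eu k) (μ.proj q) (μ.proj q)) =
    ch (Eu n) (q : M) q := by rw [coordMap, hs.base]
  have e1 : (s (ch (Eu k) (μ.proj q) (μ.proj q)) : M) = q := by rw [hs.base]
  have h1 := hL.lieMetric_eq (R := secCurv m s (ch (Eu k) (μ.proj q) (μ.proj q))) (fun _ _ => rfl)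
    (g := S.metricC q) (ξ := S.reebC q)
    (g' := (h.reduced hS).metricC (μ.proj q)) (ξ' := (h.reduced hS).reebC (μ.proj q))
    (by rw [e0]; exact (S.contDiffAt_metricC _).differentiableAt (by simp))
    (by rw [e0]; exact (S.contDiffAt_reebC _).differentiableAt (by simp))
    (((h.reduced hS).contDiffAt_metricC _).differentiableAt (by simp))
    (((h.reduced hS).contDiffAt_reebC _).differentiableAt (by simp))
    (by
      intro u v
      rw [← e1]
      filter_upwards [h.eventually_redMetricC hS hs] with z hz
      exact DFunLike.congr_fun (DFunLike.congr_fun hz u) v)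
    (by rw [← e1]; exact h.eventually_redReebC hS hs) u v
  have e2 : ∀ v, secCurv m s (ch (Eu k) (μ.proj q) (μ.proj q))
      ((h.reduced hS).reebC (μ.proj q) (ch (Eu k) (μ.proj q) (μ.proj q))) v = 0 := by
    rw [(h.reduced hS).reebC_self]
    exact h.secCurv_redReeb hS hs hST.1
  rw [h1, e2, e2, e0, AlmostContactMetric.lieMetric_eq_zero hST.2]
  simp

theorem isST_reduced [T2Space M] (hST : S.IsST) : (h.reduced hS).IsST :=
  ⟨h.isNormal_reduced hS hST.1, h.reebKilling_reduced hS hST⟩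

end IsReductionAtlas

end MomentMap

/-! ### The torsion form of the reduced structure -/

/-- The exterior derivative of a form, as a field of forms on the model space. -/
def extDE {n l : ℕ} {M : Type*} [TopologicalSpace M] [ChartedSpace (Eu n) M] {V : Type*}
    [NormedAddCommGroup V] [NormedSpace ℝ V] (β : M → Eu n [⋀^Fin l]→L[ℝ] V) (x : M) :
    Eu n [⋀^Fin (l + 1)]→L[ℝ] V :=
  extD (n := n) (M := M) β x

theorem extDE_eq {n l : ℕ} {M : Type*} [TopologicalSpace M] [ChartedSpace (Eu n) M]
    [IsManifold (𝓡 n) ∞ M] {V : Type*} [NormedAddCommGroup V] [NormedSpace ℝ V]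
    (β : M → Eu n [⋀^Fin l]→L[ℝ] V) (x : M) :
    extDE β x = extDeriv (pb β (ch (Eu n) x).symm) (ch (Eu n) x x) :=
  extD_eq β x

namespace AlmostContactMetric

variable {n : ℕ} {M : Type*} [TopologicalSpace M] [ChartedSpace (Eu n) M]
  [IsManifold (𝓡 n) ∞ M] (S : AlmostContactMetric n M)

/-- The form `η`, as a field of `1`-forms on the model space. -/
def etaForm (x : M) : Eu n [⋀^Fin 1]→L[ℝ] ℝ := toForm S.eta x

/-- The fundamental `2`-form, as a field of forms on the model space. -/
def fundFormE (x : M) : Eu n [⋀^Fin 2]→L[ℝ] ℝ := S.fundForm x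

/-- The derivative of the fundamental `2`-form, as a field of forms on the model space. -/
def dFundFormE (x : M) : Eu n [⋀^Fin 3]→L[ℝ] ℝ := extD S.fundForm x

/-- The torsion form, as a field of forms on the model space. -/
def torsionE (x : M) : Eu n [⋀^Fin 3]→L[ℝ] ℝ := S.torsion x

theorem fundFormE_apply (x : M) (v : Fin 2 → Eu n) :
    S.fundFormE x v = S.gE x (S.phiE x (v 0)) (v 1) := rfl

theorem etaForm_apply (x : M) (v : Fin 1 → Eu n) :
    S.etaForm x v = S.gE x (S.reebE x) (v 0) := rfl

theorem smoothForm_fundFormE : SmoothForm S.fundFormE := by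
  intro x
  refine contDiffAt_alternating_iff.2 fun v => ?_
  have h1 : ContDiffAt ℝ ∞ (fun z => S.metricC x z (S.phiC x z (v 0)) (v 1)) (ch (Eu n) x x) :=
    ((S.contDiffAt_metricC x).clm_apply
      ((S.contDiffAt_phiC x).clm_apply contDiffAt_const)).clm_apply contDiffAt_const
  refine h1.congr_of_eventuallyEq ?_
  filter_upwards [eventually_ch_target (E := Eu n) x] with z hz
  simp only [metricC, phiC, ContinuousLinearMap.bilinearComp_apply, ContinuousLinearMap.comp_apply]
  rw [md_symm_md_ch hz]
  rfl

theorem wedge_apply {x : M} (η : Eu n →L[ℝ] ℝ) (β : Eu n [⋀^Fin 2]→L[ℝ] ℝ) (v : Fin 3 → Eu n) :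
    wedge (n := n) (x := x) η β v =
      η (v 0) * β ![v 1, v 2] - η (v 1) * β ![v 0, v 2] + η (v 2) * β ![v 0, v 1] := by
  change ContinuousAlternatingMap.alternatizeUncurryFin (ContinuousLinearMap.smulRight η β) v = _
  rw [ContinuousAlternatingMap.alternatizeUncurryFin_apply]
  refine (Fin.sum_univ_three _).trans ?_
  have e0 : Fin.removeNth 0 v = ![v 1, v 2] := by ext1 i; fin_cases i <;> rfl
  have e1 : Fin.removeNth 1 v = ![v 0, v 2] := by ext1 i; fin_cases i <;> rfl
  have e2 : Fin.removeNth 2 v = ![v 0, v 1] := by ext1 i; fin_cases i <;> rfl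
  rw [e0, e1, e2]
  simp [sub_eq_add_neg]

theorem torsionE_apply (x : M) (v : Fin 3 → Eu n) :
    S.torsionE x v = S.gE x (S.reebE x) (v 0) * S.dEtaE x ![v 1, v 2]
      - S.gE x (S.reebE x) (v 1) * S.dEtaE x ![v 0, v 2]
      + S.gE x (S.reebE x) (v 2) * S.dEtaE x ![v 0, v 1]
      + S.dFundFormE x (fun i => S.phiE x (v i)) := by
  rw [← wedge_apply (x := x) (S.gE x (S.reebE x))]
  rfl

theorem smoothForm_dEtaE : SmoothForm S.dEtaE := S.smoothForm_eta.extD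

theorem smoothForm_dFundFormE : SmoothForm S.dFundFormE := S.smoothForm_fundFormE.extD

theorem smoothForm_torsionE : SmoothForm S.torsionE := by
  intro x
  refine contDiffAt_alternating_iff.2 fun v => ?_
  have hη : ∀ w, ContDiffAt ℝ ∞ (fun z => S.etaC x z w) (ch (Eu n) x x) :=
    fun w => (S.contDiffAt_etaC x).clm_apply contDiffAt_const
  have hd : ∀ w, ContDiffAt ℝ ∞ (fun z => pb S.dEtaE (ch (Eu n) x).symm z w) (ch (Eu n) x x) :=
    contDiffAt_alternating_iff.1 (S.smoothForm_dEtaE x)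
  have hF : ContDiffAt ℝ ∞ (fun z => pb S.dFundFormE (ch (Eu n) x).symm z
      (fun i => S.phiC x z (v i))) (ch (Eu n) x x) :=
    contDiffAt_alternating_apply (v := fun z i => S.phiC x z (v i)) (S.smoothForm_dFundFormE x)
      (contDiffAt_pi.2 fun i => (S.contDiffAt_phiC x).clm_apply contDiffAt_const)
  refine ContDiffAt.congr_of_eventuallyEq (((((hη (v 0)).mul (hd ![v 1, v 2])).sub
    ((hη (v 1)).mul (hd ![v 0, v 2]))).add ((hη (v 2)).mul (hd ![v 0, v 1]))).add hF) ?_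
  filter_upwards [eventually_ch_target (E := Eu n) x] with z hz
  have e : ∀ a b, (fun i => dsym x z (![a, b] i)) = ![dsym x z a, dsym x z b] := by
    intro a b; ext1 i; fin_cases i <;> rfl
  have e1 : ∀ a b, pb S.dEtaE (ch (Eu n) x).symm z ![a, b] =
      S.dEtaE ((ch (Eu n) x).symm z) ![dsym x z a, dsym x z b] := by
    intro a b
    rw [← e]; rfl
  have e2 : pb S.dFundFormE (ch (Eu n) x).symm z (fun i => S.phiC x z (v i)) =
      S.dFundFormE ((ch (Eu n) x).symm z)
        (fun i => S.phiE ((ch (Eu n) x).symm z) (dsym x z (v i))) := by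
    refine congrArg (S.dFundFormE ((ch (Eu n) x).symm z)) (funext fun i => ?_)
    exact md_symm_md_ch hz _
  simp only [S.etaC_apply x hz, e1, e2]
  exact S.torsionE_apply _ _

end AlmostContactMetric

namespace MomentMap

variable {d n m k : ℕ} {G : Type*} [TopologicalSpace G] [ChartedSpace (Eu d) G] [Group G]
  {M : Type*} [TopologicalSpace M] [ChartedSpace (Eu n) M]
  [IsManifold (𝓡 n) ∞ M] [MulAction G M]
  {S : AlmostContactMetric n M} {μ : MomentMap d G S}
  [ChartedSpace (Eu m) μ.zeroLevel] [ChartedSpace (Eu k) μ.Reduction]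
  [LieGroup (𝓡 d) ∞ G] [ContMDiffSMul (𝓡 d) (𝓡 n) ∞ G M]
  [IsManifold (𝓡 m) ∞ μ.zeroLevel] [IsManifold (𝓡 k) ∞ μ.Reduction]

namespace IsReductionAtlas

variable (h : μ.IsReductionAtlas m k) (hS : Preserves G S) {q : μ.zeroLevel}
  {s : Eu k → μ.zeroLevel} (hs : μ.IsHorSection (m := m) q s)

include h hs

/-- The pull-back of a form on `M` by the horizontal lift along a local section. -/
theorem eventually_pb_lift {l : ℕ} (β : M → Eu n [⋀^Fin l]→L[ℝ] ℝ) :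
    ∀ᶠ z in 𝓝 (ch (Eu k) (μ.proj q) (μ.proj q)), ∀ v : Fin l → Eu k,
      (pb β (ch (Eu n) (s (ch (Eu k) (μ.proj q) (μ.proj q)) : M)).symm
        (μ.coordMap s (ch (Eu k) (μ.proj q) (μ.proj q)) z)).compContinuousLinearMap
          (μ.liftC m s (ch (Eu k) (μ.proj q) (μ.proj q)) z) v =
      β (s z : M) (fun i => h.liftM (s z) (dsym (μ.proj q) z (v i))) := by
  filter_upwards [h.eventually_liftM hs, h.eventually_coordMap (h.smoothAt_section hs)]
    with z hz ⟨_, hz', _⟩ v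
  have h1 : ∀ w : Fin l → Eu n, pb β (ch (Eu n) (s (ch (Eu k) (μ.proj q) (μ.proj q)) : M)).symm
      (μ.coordMap s (ch (Eu k) (μ.proj q) (μ.proj q)) z) w = β (s z : M) (fun i =>
        dsym (s (ch (Eu k) (μ.proj q) (μ.proj q)) : M)
          (μ.coordMap s (ch (Eu k) (μ.proj q) (μ.proj q)) z) (w i)) := by
    intro w
    rw [← hz']
    rfl
  refine (h1 _).trans (congrArg (β (s z : M)) (funext fun i => hz (v i)))

theorem extDeriv_pb_symm {l : ℕ} (β : M → Eu n [⋀^Fin l]→L[ℝ] ℝ) (v : Fin (l + 1) → Eu k) :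
    extDeriv (pb β (ch (Eu n) (s (ch (Eu k) (μ.proj q) (μ.proj q)) : M)).symm)
      (μ.coordMap s (ch (Eu k) (μ.proj q) (μ.proj q)) (ch (Eu k) (μ.proj q) (μ.proj q)))
      (fun i => μ.liftC m s (ch (Eu k) (μ.proj q) (μ.proj q)) (ch (Eu k) (μ.proj q) (μ.proj q))
        (v i)) =
    extDE β (q : M) (fun i => h.liftM q (v i)) := by
  have e1 : (s (ch (Eu k) (μ.proj q) (μ.proj q)) : M) = q := by rw [hs.base]
  rw [extDE_eq]
  simp only [h.liftC_self hs]
  rw [coordMap, e1]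

theorem pb_symm_self {l : ℕ} (β : M → Eu n [⋀^Fin l]→L[ℝ] ℝ) (w : Fin l → Eu n) :
    pb β (ch (Eu n) (s (ch (Eu k) (μ.proj q) (μ.proj q)) : M)).symm
      (μ.coordMap s (ch (Eu k) (μ.proj q) (μ.proj q)) (ch (Eu k) (μ.proj q) (μ.proj q))) w =
    β (q : M) w := by
  have e1 : (s (ch (Eu k) (μ.proj q) (μ.proj q)) : M) = q := by rw [hs.base]
  rw [coordMap, e1, pb, md_ch_symm_self, extChartAt_to_inv]
  rfl

theorem differentiableAt_pb_symm {l : ℕ} {β : M → Eu n [⋀^Fin l]→L[ℝ] ℝ} (hβ : SmoothForm β) :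
    DifferentiableAt ℝ (pb β (ch (Eu n) (s (ch (Eu k) (μ.proj q) (μ.proj q)) : M)).symm)
      (μ.coordMap s (ch (Eu k) (μ.proj q) (μ.proj q)) (ch (Eu k) (μ.proj q) (μ.proj q))) :=
  (hβ _).differentiableAt (by simp)

/-- If a form on the quotient is obtained from a form on `M` by evaluation on horizontal lifts,
then this relation holds between their coordinate expressions along a local section. -/
theorem pb_induced {l : ℕ} {β : M → Eu n [⋀^Fin l]→L[ℝ] ℝ}
    {β' : μ.Reduction → Eu k [⋀^Fin l]→L[ℝ] ℝ}
    (hβ : ∀ q v, β' (μ.proj q) v = β (q : M) (fun i => h.liftM q (v i))) :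
    pb β' (ch (Eu k) (μ.proj q)).symm =ᶠ[𝓝 (ch (Eu k) (μ.proj q) (μ.proj q))] fun z =>
      (pb β (ch (Eu n) (s (ch (Eu k) (μ.proj q) (μ.proj q)) : M)).symm
        (μ.coordMap s (ch (Eu k) (μ.proj q) (μ.proj q)) z)).compContinuousLinearMap
          (μ.liftC m s (ch (Eu k) (μ.proj q) (μ.proj q)) z) := by
  filter_upwards [h.eventually_pb_lift hs β, hs.proj] with z hz hz'
  ext v
  rw [hz v, ← hβ (s z), pb, hz']
  rfl

theorem extD_induced_one {β : M → Eu n [⋀^Fin 1]→L[ℝ] ℝ} (hβs : SmoothForm β)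
    {β' : μ.Reduction → Eu k [⋀^Fin 1]→L[ℝ] ℝ}
    (hβ : ∀ q v, β' (μ.proj q) v = β (q : M) (fun i => h.liftM q (v i))) (v : Fin 2 → Eu k) :
    extDE β' (μ.proj q) v =
      extDE β (q : M) (fun i => h.liftM q (v i))
      - β (q : M) ![fundE d n G (q : M)
          (secCurv m s (ch (Eu k) (μ.proj q) (μ.proj q)) (v 0) (v 1))] := by
  have e1 : (s (ch (Eu k) (μ.proj q) (μ.proj q)) : M) = q := by rw [hs.base]
  rw [extDE_eq, (h.pb_induced hs hβ).extDeriv_eq,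
    (h.isLiftAt_section hs).extDeriv_comp_one (h.differentiableAt_pb_symm hs hβs) v
      (R := secCurv m s (ch (Eu k) (μ.proj q) (μ.proj q))) (fun _ _ => rfl),
    h.extDeriv_pb_symm hs, h.pb_symm_self hs, e1]

theorem extD_induced_two {β : M → Eu n [⋀^Fin 2]→L[ℝ] ℝ} (hβs : SmoothForm β)
    {β' : μ.Reduction → Eu k [⋀^Fin 2]→L[ℝ] ℝ}
    (hβ : ∀ q v, β' (μ.proj q) v = β (q : M) (fun i => h.liftM q (v i))) (v : Fin 3 → Eu k) :
    extDE β' (μ.proj q) v =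
      extDE β (q : M) (fun i => h.liftM q (v i))
      - (β (q : M) ![fundE d n G (q : M)
            (secCurv m s (ch (Eu k) (μ.proj q) (μ.proj q)) (v 0) (v 1)), h.liftM q (v 2)]
        + β (q : M) ![fundE d n G (q : M)
            (secCurv m s (ch (Eu k) (μ.proj q) (μ.proj q)) (v 1) (v 2)), h.liftM q (v 0)]
        + β (q : M) ![fundE d n G (q : M)
            (secCurv m s (ch (Eu k) (μ.proj q) (μ.proj q)) (v 2) (v 0)), h.liftM q (v 1)]) := by
  have e1 : (s (ch (Eu k) (μ.proj q) (μ.proj q)) : M) = q := by rw [hs.base]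
  rw [extDE_eq, (h.pb_induced hs hβ).extDeriv_eq,
    (h.isLiftAt_section hs).extDeriv_comp_two (h.differentiableAt_pb_symm hs hβs) v
      (R := secCurv m s (ch (Eu k) (μ.proj q) (μ.proj q))) (fun _ _ => rfl),
    h.extDeriv_pb_symm hs]
  simp only [h.liftC_self hs]
  rw [h.pb_symm_self hs, h.pb_symm_self hs, h.pb_symm_self hs, e1]

include hS

/-- The horizontal lift of `dη̃` differs from `dη` by the vertical part of the curvature. -/
theorem dEtaE_reduced (u v : Eu k) : (h.reduced hS).dEtaE (μ.proj q) ![u, v] =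
    S.dEtaE (q : M) ![h.liftM q u, h.liftM q v]
      - S.gE (q : M) (S.reebE (q : M)) (fundE d n G (q : M)
          (secCurv m s (ch (Eu k) (μ.proj q) (μ.proj q)) u v)) := by
  have h1 := h.extD_induced_one hs S.smoothForm_eta (β' := (h.reduced hS).etaForm)
    (fun q v => by
      rw [AlmostContactMetric.etaForm_apply]
      change h.redMetric (μ.proj q) (h.redReeb (μ.proj q)) (v 0) = _
      rw [h.redMetric_proj hS, h.liftM_redReeb hS]
      rfl) ![u, v]
  refine h1.trans ?_
  congr 1
  refine congrArg (S.dEtaE (q : M)) (funext fun i => ?_)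
  fin_cases i <;> rfl

/-- The torsion form of the quotient in terms of the torsion form of `M` and the curvature of a
section. The curvature terms of `dF̃(φ·, φ·, φ·)` are
`g(φ(A*), φ(v)) = g(v, A*) - η(v) η(A*)`, by the `φ`-invariance of the curvature, and those
containing `η` cancel the curvature terms of `η̃ ∧ dη̃`. -/
theorem torsionE_reduced [T2Space M] (hN : S.IsNormal) (v : Fin 3 → Eu k) :
    (h.reduced hS).torsionE (μ.proj q) v = S.torsionE (q : M) (fun i => h.liftM q (v i))
      - (S.gE (q : M) (h.liftM q (v 0)) (fundE d n G (q : M)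
          (secCurv m s (ch (Eu k) (μ.proj q) (μ.proj q)) (v 1) (v 2)))
        + S.gE (q : M) (h.liftM q (v 1)) (fundE d n G (q : M)
          (secCurv m s (ch (Eu k) (μ.proj q) (μ.proj q)) (v 2) (v 0)))
        + S.gE (q : M) (h.liftM q (v 2)) (fundE d n G (q : M)
          (secCurv m s (ch (Eu k) (μ.proj q) (μ.proj q)) (v 0) (v 1)))) := by
  have hF : ∀ u : Fin 3 → Eu k, (h.reduced hS).dFundFormE (μ.proj q) u = _ := fun u =>
    h.extD_induced_two hs S.smoothForm_fundFormE (β' := (h.reduced hS).fundFormE)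
    (fun q v => by
      rw [AlmostContactMetric.fundFormE_apply]
      change h.redMetric (μ.proj q) (h.redPhi (μ.proj q) (v 0)) (v 1) = _
      rw [h.redMetric_proj hS, h.liftM_redPhi hS]
      rfl) u
  have hη : ∀ u, (h.reduced hS).gE (μ.proj q) ((h.reduced hS).reebE (μ.proj q)) u =
      S.gE (q : M) (S.reebE (q : M)) (h.liftM q u) := by
    intro u
    change h.redMetric (μ.proj q) (h.redReeb (μ.proj q)) u = _
    rw [h.redMetric_proj hS, h.liftM_redReeb hS]
  have hφ : ∀ u, (h.reduced hS).phiE (μ.proj q) u = h.redPhi (μ.proj q) u := fun _ => rfl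
  have hR := fun u v => (h.secCurv_of_normal hS hs hN u v).1
  have hg : ∀ a b, S.gE (q : M) (S.phiE q a) (S.phiE q b) =
      S.gE q b a - S.gE q (S.reebE q) a * S.gE q (S.reebE q) b := by
    intro a b
    refine (S.metric_phi q a b).trans ?_
    congr 1
    exact S.metric.symm _ _ _
  have hasym : ∀ u v, secCurv m s (ch (Eu k) (μ.proj q) (μ.proj q)) u v =
      -secCurv m s (ch (Eu k) (μ.proj q) (μ.proj q)) v u := fun u v => (neg_sub _ _).symm
  rw [AlmostContactMetric.torsionE_apply, AlmostContactMetric.torsionE_apply, hF]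
  simp only [hη, hφ, h.dEtaE_reduced hS hs, hR, AlmostContactMetric.fundFormE_apply,
    Matrix.cons_val_zero, Matrix.cons_val_one, h.liftM_redPhi hS, hg]
  rw [hasym (v 0) (v 2), map_neg, map_neg]
  change _ = _ + extDE S.fundFormE (q : M) _ - _
  ring

end IsReductionAtlas

end MomentMap

/-! ### The derivative of the curvature along a horizontal section -/

section AlternatingTwo

variable {E W F : Type*} [NormedAddCommGroup E] [NormedSpace ℝ E] [NormedAddCommGroup W]
  [NormedSpace ℝ W] [NormedAddCommGroup F] [NormedSpace ℝ F]

theorem alternating_two_sub_sub (β : W [⋀^Fin 2]→L[ℝ] F) (a b c e : W) :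
    β ![a - c, b - e] = β ![a, b] - β ![c, b] + β ![e, a] + β ![c, e] := by
  have h0 : ∀ x y w, β ![x - y, w] = β ![x, w] - β ![y, w] := by
    intro x y w
    have h := β.toAlternatingMap.map_update_sub ![x, w] 0 x y
    have e : ∀ t, Function.update ![x, w] 0 t = ![t, w] := fun t => by
      ext1 i; fin_cases i <;> simp
    rwa [e, e, e] at h
  have h1 : ∀ x y w, β ![w, x - y] = β ![w, x] - β ![w, y] := by
    intro x y w
    rw [alternating_two_swap β w, h0, alternating_two_swap β x, alternating_two_swap β y]
    abel
  rw [h0, h1, h1, alternating_two_swap β a e]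
  abel

/-- If `x` vanishes at `z` and its derivative pairs trivially with `y z`, then `β(x, y)` vanishes to
second order at `z`. -/
theorem hasFDerivAt_alternating_two_zero {D : E → W [⋀^Fin 2]→L[ℝ] F} {x y : E → W}
    {x' : E →L[ℝ] W} {z : E} (hD : DifferentiableAt ℝ D z) (hx : HasFDerivAt x x' z)
    (hy : DifferentiableAt ℝ y z) (hx0 : x z = 0) (hxy : ∀ w, D z ![x' w, y z] = 0) :
    HasFDerivAt (fun t => D t ![x t, y t]) (0 : E →L[ℝ] F) z := by
  have h := hD.hasFDerivAt.continuousAlternatingMap_apply (g := ![x, y])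
    (g' := ![x', fderiv ℝ y z]) (fun i => by
      fin_cases i
      · exact hx
      · exact hy.hasFDerivAt)
  have e : ∀ t, (fun i => (![x, y] : Fin 2 → E → W) i t) = ![x t, y t] := by
    intro t; ext1 i; fin_cases i <;> rfl
  simp only [e] at h
  refine h.congr_fderiv ?_
  ext1 w
  have e0 : ∀ t, Function.update ![x z, y z] 0 t = ![t, y z] := fun t => by
    ext1 i; fin_cases i <;> simp
  have e1 : ∀ t, Function.update ![x z, y z] 1 t = ![0, t] := fun t => by
    ext1 i; fin_cases i <;> simp [hx0]
  have h0 : ∀ (β : W [⋀^Fin 2]→L[ℝ] F) t, β ![0, t] = 0 := fun β t =>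
    β.toAlternatingMap.map_coord_zero (i := 0) rfl
  have h2 : ∀ (i : Fin 2) t, (D z).toContinuousLinearMap ![x z, y z] i t =
    D z (Function.update ![x z, y z] i t) := fun i t => rfl
  simp only [add_apply, ContinuousLinearMap.comp_apply, Fin.sum_univ_two, h2, e0, e1, h0]
  simp [hxy, hx0, h0]

end AlternatingTwo

namespace MomentMap

variable {d n m k : ℕ} {G : Type*} [TopologicalSpace G] [ChartedSpace (Eu d) G] [Group G]
  {M : Type*} [TopologicalSpace M] [ChartedSpace (Eu n) M]
  [IsManifold (𝓡 n) ∞ M] [MulAction G M]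
  {S : AlmostContactMetric n M} (μ : MomentMap d G S)
  [ChartedSpace (Eu m) μ.zeroLevel] [ChartedSpace (Eu k) μ.Reduction]
  [LieGroup (𝓡 d) ∞ G] [ContMDiffSMul (𝓡 d) (𝓡 n) ∞ G M]
  [IsManifold (𝓡 m) ∞ μ.zeroLevel] [IsManifold (𝓡 k) ∞ μ.Reduction]
  {E : Type*} [NormedAddCommGroup E] [NormedSpace ℝ E]

variable (m) in
/-- The connection form, as a field of `1`-forms on the model space. -/
def connForm (q : μ.zeroLevel) : Eu m [⋀^Fin 1]→L[ℝ] Eu d :=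
  ContinuousAlternatingMap.ofSubsingleton ℝ (Eu m) (Eu d) (0 : Fin 1) (μ.conn m q)

variable (m) in
/-- The exterior derivative of the connection form. -/
def dconn (q : μ.zeroLevel) : Eu m [⋀^Fin 2]→L[ℝ] Eu d := extDE (μ.connForm m) q

variable (m) in
/-- The curvature of the connection, evaluated on the derivative of a map to the zero level. -/
def curvPb (c : E → μ.zeroLevel) (z u v : E) : Eu d :=
  μ.dconn m (c z) ![μ.horE m (c z) (md E (Eu m) c z u), μ.horE m (c z) (md E (Eu m) c z v)]

namespace IsReductionAtlas

variable {μ} (h : μ.IsReductionAtlas m k) {q : μ.zeroLevel}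

include h

theorem smoothForm_dconn : SmoothForm (μ.dconn m) := SmoothForm.extD h.smoothForm_conn

theorem extDeriv_pb_conn {c : E → μ.zeroLevel} {z : E} (hc : SmoothAt E (Eu m) c z) :
    extDeriv (pb (μ.connForm m) c) z = pb (μ.dconn m) c z :=
  extDeriv_pb h.smoothForm_conn hc

/-- The derivative of the connection form on vectors tangent to a parametrisation. -/
theorem dconn_md {c : E → μ.zeroLevel} {z : E} (hc : SmoothAt E (Eu m) c z) (u v : E) :
    μ.dconn m (c z) ![md E (Eu m) c z u, md E (Eu m) c z v] =
      fderiv ℝ (μ.connPb m c) z u v - fderiv ℝ (μ.connPb m c) z v u := by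
  have h1 := extDeriv_ofSubsingleton ((h.contDiffAt_connPb hc).differentiableAt (by simp)) u v
  have h2 := congrArg (fun b => b ![u, v]) (h.extDeriv_pb_conn hc)
  rw [← h1]
  refine Eq.trans ?_ h2.symm
  refine congrArg (μ.dconn m (c z)) (funext fun i => ?_)
  fin_cases i <;> rfl

/-- Infinitesimal invariance of the connection form: `dθ` vanishes on a fundamental vector and a
horizontal vector. -/
theorem dconn_fundE (hS : Preserves G S) (q : μ.zeroLevel) (A : Eu d) {v : Eu m}
    (hv : μ.conn m q v = 0) : μ.dconn m q ![fundE d m G q A, v] = 0 := by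
  have := h.contMDiffSMul
  set a₀ : Eu d := ch (Eu d) (1 : G) 1 with ha₀
  set y₀ : Eu m := ch (Eu m) q q with hy₀
  let γ : Eu d → G := (ch (Eu d) (1 : G)).symm
  let τ : Eu m → μ.zeroLevel := (ch (Eu m) q).symm
  have hγ0 : γ a₀ = 1 := extChartAt_to_inv (1 : G)
  have hτ0 : τ y₀ = q := extChartAt_to_inv q
  -- `dθ` is evaluated in the parametrisation `(a, y) ↦ γ(a) • τ(y)`, in which the two vectors are
  -- coordinate vectors
  let Φ : Eu d × Eu m → μ.zeroLevel := fun p => γ p.1 • τ p.2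
  have hγ : SmoothAt (Eu d) (Eu d) γ a₀ := smoothAt_ch_symm_self (1 : G)
  have hτ : SmoothAt (Eu m) (Eu m) τ y₀ := smoothAt_ch_symm_self q
  have hΦ : SmoothAt (Eu d × Eu m) (Eu m) Φ (a₀, y₀) := smoothAt_smul_symm (d := d) (G := G) q
    (mem_extChartAt_target q)
  have hK := ((h.contDiffAt_connPb hΦ).differentiableAt (by simp)).hasFDerivAt
  have hΦe := hΦ.eventually_mdifferentiableAt
  have hl : ∀ a : Eu d, HasFDerivAt (fun y : Eu m => (a, y))
      (ContinuousLinearMap.inr ℝ (Eu d) (Eu m)) y₀ :=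
    fun a => hasFDerivAt_prodMk_right a y₀
  have hr : HasFDerivAt (fun a : Eu d => (a, y₀)) (ContinuousLinearMap.inl ℝ (Eu d) (Eu m)) a₀ :=
    hasFDerivAt_prodMk_left a₀ y₀
  have hda : ∀ a y, MDifferentiableAt 𝓘(ℝ, Eu d × Eu m) 𝓘(ℝ, Eu m) Φ (a, y) → ∀ α,
      md (Eu d × Eu m) (Eu m) Φ (a, y) (α, 0) = md (Eu d) (Eu m) (fun a => γ a • τ y) a α := by
    intro a y H α
    have h1 : HasFDerivAt (fun b : Eu d => (b, y)) (ContinuousLinearMap.inl ℝ (Eu d) (Eu m)) a :=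
      hasFDerivAt_prodMk_left a y
    have h2 := md_comp_of_mdifferentiableAt (f := fun b : Eu d => (b, y)) (g := Φ) H
      h1.differentiableAt.mdifferentiableAt
    rw [md_eq_fderiv, h1.fderiv] at h2
    exact (DFunLike.congr_fun h2 α).symm
  have hdy : ∀ a, MDifferentiableAt 𝓘(ℝ, Eu d × Eu m) 𝓘(ℝ, Eu m) Φ (a, y₀) → ∀ w,
      md (Eu d × Eu m) (Eu m) Φ (a, y₀) (0, w) = actE m (γ a) q w := by
    intro a H w
    have h1 : HasFDerivAt (fun y : Eu m => (a, y)) _ y₀ := hl a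
    have h2 := md_comp_of_mdifferentiableAt (f := fun y : Eu m => (a, y)) (g := Φ) H
      h1.differentiableAt.mdifferentiableAt
    rw [md_eq_fderiv, h1.fderiv] at h2
    have h3 := md_comp_apply (f := τ) (g := fun p : μ.zeroLevel => γ a • p)
      (smoothAt_const_smul d (γ a) _) hτ w
    rw [hτ0, md_ch_symm_self] at h3
    exact (DFunLike.congr_fun h2 w).symm.trans h3
  -- along the group direction the horizontal vector stays horizontal
  have e1 : fderiv ℝ (μ.connPb m Φ) (a₀, y₀) (A, 0) (0, v) = 0 := by
    have h1 : HasFDerivAt (fun a => μ.connPb m Φ (a, y₀)) _ a₀ :=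
      HasFDerivAt.comp a₀ (g := μ.connPb m Φ) hK hr
    have h2 := (hasFDerivAt_apply_const h1 (0, v)).fderiv
    have h3 : (fun a => μ.connPb m Φ (a, y₀) (0, v)) =ᶠ[𝓝 a₀] fun _ => 0 := by
      have hcont : Filter.Tendsto (fun a : Eu d => (a, y₀)) (𝓝 a₀) (𝓝 (a₀, y₀)) :=
        (Continuous.prodMk_left y₀).tendsto a₀
      filter_upwards [hcont.eventually hΦe] with a ha
      rw [connPb, ContinuousLinearMap.comp_apply, hdy a ha]
      change μ.conn m (γ a • τ y₀) _ = 0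
      rw [hτ0]
      exact h.conn_actE_of_conn hS _ hv
    rw [h3.fderiv_eq, fderiv_const_apply] at h2
    exact (DFunLike.congr_fun h2 A).symm
  -- along the zero level the fundamental field has constant value
  have e2 : fderiv ℝ (μ.connPb m Φ) (a₀, y₀) (0, v) (A, 0) = 0 := by
    have h1 : HasFDerivAt (fun y => μ.connPb m Φ (a₀, y)) _ y₀ :=
      HasFDerivAt.comp y₀ (g := μ.connPb m Φ) hK (hl a₀)
    have h2 := (hasFDerivAt_apply_const h1 (A, 0)).fderiv
    have h3 : (fun y => μ.connPb m Φ (a₀, y) (A, 0)) =ᶠ[𝓝 y₀] fun _ => A := by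
      have hcont : Filter.Tendsto (fun y : Eu m => (a₀, y)) (𝓝 y₀) (𝓝 (a₀, y₀)) :=
        (Continuous.prodMk_right a₀).tendsto y₀
      filter_upwards [hcont.eventually hΦe] with y hy
      have h4 : SmoothAt (Eu d) (Eu m) (fun g : G => g • τ y) (γ a₀) := smoothAt_orbit _ _
      rw [connPb, ContinuousLinearMap.comp_apply, hda a₀ y hy,
        md_comp_apply (f := γ) (g := fun g : G => g • τ y) h4 hγ, md_ch_symm_self]
      change μ.conn m (γ a₀ • τ y) (md _ _ _ (γ a₀) A) = A
      rw [hγ0, one_smul]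
      exact h.conn_fundE _ A
    rw [h3.fderiv_eq, fderiv_const_apply] at h2
    exact (DFunLike.congr_fun h2 v).symm
  have e3 := h.dconn_md hΦ (A, 0) (0, v)
  rw [e1, e2, sub_zero] at e3
  rw [hdy a₀ hΦe.self_of_nhds, hda a₀ y₀ hΦe.self_of_nhds] at e3
  have h4 : SmoothAt (Eu d) (Eu m) (fun g : G => g • τ y₀) (γ a₀) := smoothAt_orbit _ _
  rw [md_comp_apply (f := γ) (g := fun g : G => g • τ y₀) h4 hγ, md_ch_symm_self] at e3
  change μ.dconn m (γ a₀ • τ y₀) ![md _ _ _ (γ a₀) A, actE m (γ a₀) q v] = 0 at e3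
  rw [hγ0, hτ0, one_smul] at e3
  have h5 : actE m (1 : G) q v = v := by
    rw [actE, show (fun x : μ.zeroLevel => (1 : G) • x) = fun x => x from
      funext fun x => one_smul G x, md_id]
    rfl
  rw [h5] at e3
  exact e3

/-- At a point where `c` is horizontal, the curvature evaluated along `c` has the same derivative
as the pull-back `c^*dθ`. Indeed the horizontal part of a vector `t` is `t - x`, with `x` the
fundamental vector of `θ(t)`, which vanishes at that point; the terms `dθ(x, t)` and `dθ(x, x)`
have derivative zero there, as `dθ` vanishes on a fundamental and a horizontal vector. -/
theorem hasFDerivAt_curvPb (hS : Preserves G S) {c : E → μ.zeroLevel} {z₀ : E}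
    [FiniteDimensional ℝ E]
    (hc : SmoothAt E (Eu m) c z₀) (h0 : μ.connPb m c z₀ = 0) (u v : E) :
    HasFDerivAt (fun z => μ.curvPb m c z u v)
      ((ContinuousAlternatingMap.apply ℝ E (Eu d) ![u, v]).comp
        (fderiv ℝ (pb (μ.dconn m) c) z₀)) z₀ := by
  have := h.contMDiffSMul
  -- `τ` is the map in coordinates, `D` is `dθ` in coordinates along it, `t u` is the derivative
  -- of `τ`, and `x u` its vertical part
  set τ : E → Eu m := fun z => ch (Eu m) (c z₀) (c z) with hτ
  set D : E → Eu m [⋀^Fin 2]→L[ℝ] Eu d := fun z =>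
    pb (μ.dconn m) (ch (Eu m) (c z₀)).symm (τ z) with hD
  set x : E → E → Eu m := fun u z => fundC d m G (c z₀) (τ z) (μ.connPb m c z u) with hx
  set t : E → E → Eu m := fun u z => fderiv ℝ τ z u with ht
  have hτs : ContDiffAt ℝ ∞ τ z₀ := contDiffAt_ch_comp hc
  have hDs : DifferentiableAt ℝ D z₀ := ContDiffAt.differentiableAt
    (ContDiffAt.comp z₀ (g := pb (μ.dconn m) (ch (Eu m) (c z₀)).symm)
      (h.smoothForm_dconn (c z₀)) hτs) (n := ∞) (by simp)
  have hts : ∀ u, DifferentiableAt ℝ (t u) z₀ := fun u =>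
    ((contDiffAt_fderiv hτs).clm_apply contDiffAt_const).differentiableAt (by simp)
  have hF : ContDiffAt ℝ ∞ (fun z => fundC d m G (c z₀) (τ z)) z₀ :=
    ContDiffAt.comp z₀ (contDiffAt_fundC (c z₀) (mem_extChartAt_target (c z₀))) hτs
  have hA := (h.contDiffAt_connPb hc).differentiableAt (by simp)
  have hx' : ∀ u, HasFDerivAt (x u) ((fundC d m G (c z₀) (τ z₀)).comp
      ((fderiv ℝ (μ.connPb m c) z₀).flip u)) z₀ := by
    intro u
    have h1 := (hF.differentiableAt (by simp)).hasFDerivAt.clm_apply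
      (hasFDerivAt_apply_const hA.hasFDerivAt u)
    refine h1.congr_fderiv ?_
    ext1 w
    simp [h0]
  have hx0 : ∀ u, x u z₀ = 0 := by intro u; simp [hx, h0]
  have hDa : ∀ᶠ z in 𝓝 z₀, c z ∈ (ch (Eu m) (c z₀)).source :=
    hc.continuousAt.eventually (eventually_ch_source (E := Eu m) (c z₀))
  have hDe : ∀ z, c z ∈ (ch (Eu m) (c z₀)).source → ∀ a b, D z ![a, b] =
      μ.dconn m (c z) ![dsym (c z₀) (τ z) a, dsym (c z₀) (τ z) b] := by
    intro z hz a b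
    have hcz : (ch (Eu m) (c z₀)).symm (τ z) = c z := (ch (Eu m) (c z₀)).left_inv hz
    simp only [hD, pb, ContinuousAlternatingMap.compContinuousLinearMap_apply]
    rw [hcz]
    refine congrArg (μ.dconn m (c z)) (funext fun i => ?_)
    fin_cases i <;> rfl
  have hxe : ∀ z, c z ∈ (ch (Eu m) (c z₀)).source → ∀ u,
      dsym (c z₀) (τ z) (x u z) = fundE d m G (c z) (μ.connPb m c z u) := by
    intro z hz u
    have hcz : (ch (Eu m) (c z₀)).symm (τ z) = c z := (ch (Eu m) (c z₀)).left_inv hz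
    have hzt : τ z ∈ (ch (Eu m) (c z₀)).target := (ch (Eu m) (c z₀)).map_source hz
    simp only [hx]
    rw [fundC_eq _ hzt, ContinuousLinearMap.comp_apply]
    refine (md_symm_md_ch hzt _).trans ?_
    rw [hcz]
  have hte : ∀ z, c z ∈ (ch (Eu m) (c z₀)).source →
      MDifferentiableAt 𝓘(ℝ, E) 𝓘(ℝ, Eu m) c z → ∀ u,
      dsym (c z₀) (τ z) (t u z) = md E (Eu m) c z u := by
    intro z hz hz' u
    have hcz : (ch (Eu m) (c z₀)).symm (τ z) = c z := (ch (Eu m) (c z₀)).left_inv hz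
    have hzt : τ z ∈ (ch (Eu m) (c z₀)).target := (ch (Eu m) (c z₀)).map_source hz
    simp only [ht]
    rw [← md_eq_fderiv, md_comp_of_mdifferentiableAt (f := c) (g := ch (Eu m) (c z₀))
      (smoothAt_ch hz).mdifferentiableAt hz']
    have h1 := md_symm_md_ch hzt (md E (Eu m) c z u)
    rw [hcz] at h1
    exact h1
  have hz0 := hDa.self_of_nhds
  have hzero : ∀ u v, HasFDerivAt (fun z => D z ![x u z, t v z]) (0 : E →L[ℝ] Eu d) z₀ := by
    intro u v
    refine hasFDerivAt_alternating_two_zero hDs (hx' u) (hts v) (hx0 u) fun w => ?_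
    rw [hDe z₀ hz0, hte z₀ hz0 hc.mdifferentiableAt]
    have h1 : dsym (c z₀) (τ z₀) (((fundC d m G (c z₀) (τ z₀)).comp
        ((fderiv ℝ (μ.connPb m c) z₀).flip u)) w) =
        fundE d m G (c z₀) (fderiv ℝ (μ.connPb m c) z₀ w u) := by
      have hzt : τ z₀ ∈ (ch (Eu m) (c z₀)).target := (ch (Eu m) (c z₀)).map_source hz0
      rw [fundC_eq _ hzt]
      refine (md_symm_md_ch hzt _).trans ?_
      rw [show (ch (Eu m) (c z₀)).symm (τ z₀) = c z₀ from (ch (Eu m) (c z₀)).left_inv hz0]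
      rfl
    rw [h1]
    exact h.dconn_fundE hS _ _ (DFunLike.congr_fun h0 v)
  have hzero' : ∀ u v, HasFDerivAt (fun z => D z ![x u z, x v z]) (0 : E →L[ℝ] Eu d) z₀ := by
    intro u v
    refine hasFDerivAt_alternating_two_zero hDs (hx' u) (hx' v).differentiableAt (hx0 u) fun w => ?_
    rw [hx0]
    exact (D z₀).toAlternatingMap.map_coord_zero (i := 1) rfl
  have hP : HasFDerivAt (fun z => pb (μ.dconn m) c z ![u, v])
      ((ContinuousAlternatingMap.apply ℝ E (Eu d) ![u, v]).comp
        (fderiv ℝ (pb (μ.dconn m) c) z₀)) z₀ :=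
    (ContinuousAlternatingMap.apply ℝ E (Eu d) ![u, v]).hasFDerivAt.comp z₀
      ((h.smoothForm_dconn.contDiffAt_pb hc).differentiableAt (by simp)).hasFDerivAt
  have hsum := (((hP.sub (hzero u v)).add (hzero v u)).add (hzero' u v))
  simp only [sub_zero, add_zero] at hsum
  refine hsum.congr_of_eventuallyEq ?_
  filter_upwards [hDa, hc.eventually_mdifferentiableAt] with z hz hz'
  have e : ∀ w, μ.horE m (c z) (md E (Eu m) c z w) = dsym (c z₀) (τ z) (t w z - x w z) := by
    intro w
    rw [map_sub, hte z hz hz', hxe z hz]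
    rfl
  have e2 : pb (μ.dconn m) c z ![u, v] = D z ![t u z, t v z] := by
    rw [hDe z hz, hte z hz hz', hte z hz hz']
    refine congrArg (μ.dconn m (c z)) (funext fun i => ?_)
    fin_cases i <;> rfl
  rw [curvPb, e, e, ← hDe z hz, alternating_two_sub_sub]
  change _ = pb (μ.dconn m) c z ![u, v] - _ + _ + _
  rw [e2]

end IsReductionAtlas

end MomentMap

/-! ### The exterior derivative of the torsion form of the reduced structure -/

set_option synthInstance.maxHeartbeats 200000 in
theorem contDiffAt_bilinear_comp_right {E V W A : Type*} [NormedAddCommGroup E] [NormedSpace ℝ E]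
    [NormedAddCommGroup V] [NormedSpace ℝ V] [NormedAddCommGroup W] [NormedSpace ℝ W]
    [NormedAddCommGroup A] [NormedSpace ℝ A] {B : E → W →L[ℝ] W →L[ℝ] ℝ} {L : E → V →L[ℝ] W}
    {F : E → A →L[ℝ] W} {z : E} (hB : ContDiffAt ℝ ∞ B z) (hL : ContDiffAt ℝ ∞ L z)
    (hF : ContDiffAt ℝ ∞ F z) :
    ContDiffAt ℝ ∞ (fun y => (ContinuousLinearMap.precomp ℝ (F y)).comp ((B y).comp (L y))) z := by
  have h1 : ContDiffAt ℝ ∞ (fun y => (ContinuousLinearMap.compL ℝ A W ℝ).flip (F y)) z :=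
    contDiffAt_const.clm_apply hF
  exact h1.clm_comp (hB.clm_comp hL)

/-- The cyclic identity satisfied by the derivative of a closed `2`-form. -/
theorem fderiv_cyclic_of_extDeriv_eq_zero {E V : Type*} [NormedAddCommGroup E] [NormedSpace ℝ E]
    [NormedAddCommGroup V] [NormedSpace ℝ V] {β : E → E [⋀^Fin 2]→L[ℝ] V} {z : E}
    (h : extDeriv β z = 0) (u v w : E) :
    fderiv ℝ β z w ![u, v] + fderiv ℝ β z u ![v, w] + fderiv ℝ β z v ![w, u] = 0 := by
  have h1 := DFunLike.congr_fun h ![u, v, w]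
  rw [extDeriv, ContinuousAlternatingMap.alternatizeUncurryFin_apply] at h1
  have h2 := (Fin.sum_univ_three _).symm.trans h1
  have e0 : Fin.removeNth 0 ![u, v, w] = ![v, w] := by ext1 i; fin_cases i <;> rfl
  have e1 : Fin.removeNth 1 ![u, v, w] = ![u, w] := by ext1 i; fin_cases i <;> rfl
  have e2 : Fin.removeNth 2 ![u, v, w] = ![u, v] := by ext1 i; fin_cases i <;> rfl
  rw [e0, e1, e2] at h2
  simp at h2
  rw [alternating_two_swap _ w u, ← h2]
  abel

namespace MomentMap

variable {d n m k : ℕ} {G : Type*} [TopologicalSpace G] [ChartedSpace (Eu d) G] [Group G]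
  {M : Type*} [TopologicalSpace M] [ChartedSpace (Eu n) M]
  [IsManifold (𝓡 n) ∞ M] [MulAction G M]
  {S : AlmostContactMetric n M} (μ : MomentMap d G S)
  [ChartedSpace (Eu m) μ.zeroLevel] [ChartedSpace (Eu k) μ.Reduction]
  [LieGroup (𝓡 d) ∞ G] [ContMDiffSMul (𝓡 d) (𝓡 n) ∞ G M]
  [IsManifold (𝓡 m) ∞ μ.zeroLevel] [IsManifold (𝓡 k) ∞ μ.Reduction]
  {E : Type*} [NormedAddCommGroup E] [NormedSpace ℝ E]

variable (m) in
/-- The form `⟨α(v), A⟩ = g(v^ℋ, A*)`, as a map from the model space. -/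
def alphaE (q : μ.zeroLevel) : Eu m →L[ℝ] LieDual d :=
  (ContinuousLinearMap.precomp ℝ (fundE d n G (q : M))).comp
    ((S.gE (q : M)).comp ((μ.inclE m q).comp (μ.horE m q)))

variable (m) in
/-- The form `α`, as a field of `1`-forms on the model space. -/
def alphaForm (q : μ.zeroLevel) : Eu m [⋀^Fin 1]→L[ℝ] LieDual d :=
  ContinuousAlternatingMap.ofSubsingleton ℝ (Eu m) (LieDual d) (0 : Fin 1) (μ.alphaE m q)

variable (m) in
/-- The pull-back of `α` by a map to the zero level. -/
def alphaPb (c : E → μ.zeroLevel) (z : E) : E →L[ℝ] LieDual d :=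
  (μ.alphaE m (c z)).comp (md E (Eu m) c z)

namespace IsReductionAtlas

variable {μ} (h : μ.IsReductionAtlas m k) {q : μ.zeroLevel}

include h

theorem contDiffAt_alphaPb {c : E → μ.zeroLevel} {z₀ : E} (hc : SmoothAt E (Eu m) c z₀) :
    ContDiffAt ℝ ∞ (μ.alphaPb m c) z₀ := by
  have hg : ContDiffAt ℝ ∞ (fun z => S.metricC (c z₀ : M) (μ.coordMap c z₀ z)) z₀ :=
    ContDiffAt.comp z₀ (g := S.metricC (c z₀ : M)) (S.contDiffAt_metricC _)
      (h.contDiffAt_coordMap hc)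
  refine ContDiffAt.congr_of_eventuallyEq (contDiffAt_bilinear_comp_right hg
    (h.contDiffAt_liftC hc) (h.contDiffAt_fundC_coordMap hc)) ?_
  filter_upwards [h.eventually_liftC hc, h.eventually_coordMap hc] with z hz ⟨hz1, hz2, _⟩
  ext v A
  have h1 : dsym (c z₀ : M) (μ.coordMap c z₀ z)
      (fundC d n G (c z₀ : M) (μ.coordMap c z₀ z) A) = fundE d n G (c z : M) A := by
    rw [fundC_eq _ hz1, ContinuousLinearMap.comp_apply]
    refine (md_symm_md_ch hz1 _).trans ?_
    rw [hz2]
  change S.gE (c z : M) (μ.inclE m (c z) (μ.horE m (c z) (md E (Eu m) c z v)))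
    (fundE d n G (c z : M) A) = S.metricC (c z₀ : M) (μ.coordMap c z₀ z)
      (μ.liftC m c z₀ z v) (fundC d n G (c z₀ : M) (μ.coordMap c z₀ z) A)
  rw [AlmostContactMetric.metricC, ContinuousLinearMap.bilinearComp_apply, hz, h1, hz2]

theorem smoothForm_alphaForm : SmoothForm (μ.alphaForm m) := by
  intro x
  refine contDiffAt_alternating_iff.2 fun v => ?_
  exact (h.contDiffAt_alphaPb (smoothAt_ch_symm_self x)).clm_apply contDiffAt_const

theorem extDE_alphaForm_md {c : E → μ.zeroLevel} {z : E} (hc : SmoothAt E (Eu m) c z) (u v : E) :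
    extDE (μ.alphaForm m) (c z) ![md E (Eu m) c z u, md E (Eu m) c z v] =
      fderiv ℝ (μ.alphaPb m c) z u v - fderiv ℝ (μ.alphaPb m c) z v u := by
  have h1 := extDeriv_ofSubsingleton ((h.contDiffAt_alphaPb hc).differentiableAt (by simp)) u v
  have h2 := congrArg (fun b => b ![u, v]) (extDeriv_pb h.smoothForm_alphaForm hc)
  rw [← h1]
  refine Eq.trans ?_ h2.symm
  refine congrArg (extDE (μ.alphaForm m) (c z)) (funext fun i => ?_)
  fin_cases i <;> rfl

/-- The curvature of the connection, as a form on the tangent spaces of the quotient. -/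
def curvE (q : μ.zeroLevel) (u v : Eu k) : Eu d := μ.dconn m q ![h.hLift q u, h.hLift q v]

theorem hLift_section {s : Eu k → μ.zeroLevel} (hs : μ.IsHorSection (m := m) q s) (u : Eu k) :
    md (Eu k) (Eu m) s (ch (Eu k) (μ.proj q) (μ.proj q)) u = h.hLift q u := by
  have h1 := h.section_projE hs (h.conn_hLift q u)
  rwa [h.projE_hLift] at h1

/-- The curvature of a section is the curvature of the connection, hence independent of the
section. -/
theorem secCurv_eq {s : Eu k → μ.zeroLevel} (hs : μ.IsHorSection (m := m) q s) (u v : Eu k) :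
    secCurv m s (ch (Eu k) (μ.proj q) (μ.proj q)) u v = h.curvE q u v := by
  rw [secCurv, ← h.dconn_md (h.smoothAt_section hs), h.hLift_section hs, h.hLift_section hs,
    hs.base]
  rfl

theorem curvPb_section {s : Eu k → μ.zeroLevel} (hs : μ.IsHorSection (m := m) q s) :
    ∀ᶠ z in 𝓝 (ch (Eu k) (μ.proj q) (μ.proj q)), ∀ u v,
      h.curvE (s z) (dsym (μ.proj q) z u) (dsym (μ.proj q) z v) = μ.curvPb m s z u v := by
  filter_upwards [h.eventually_projE_section hs] with z hz u v
  rw [curvE, ← hz, ← hz, h.hLift_projE, h.hLift_projE]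
  rfl

theorem alphaPb_section {s : Eu k → μ.zeroLevel} (hs : μ.IsHorSection (m := m) q s) :
    ∀ᶠ z in 𝓝 (ch (Eu k) (μ.proj q) (μ.proj q)), ∀ u A,
      S.gE (s z : M) (h.liftM (s z) (dsym (μ.proj q) z u)) (fundE d n G (s z : M) A) =
        μ.alphaPb m s z u A := by
  filter_upwards [h.eventually_projE_section hs] with z hz u A
  rw [← hz, h.liftM_projE]
  rfl

variable (hS : Preserves G S)

/-- The formula `torsionE_reduced`, without reference to a section. It holds at every point of a
section, not only where the section is horizontal, so that it can be differentiated. -/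
theorem torsionE_reduced_curvE [T2Space M] (hN : S.IsNormal) (q : μ.zeroLevel)
    (v : Fin 3 → Eu k) :
    (h.reduced hS).torsionE (μ.proj q) v = S.torsionE (q : M) (fun i => h.liftM q (v i))
      - (S.gE (q : M) (h.liftM q (v 0)) (fundE d n G (q : M) (h.curvE q (v 1) (v 2)))
        + S.gE (q : M) (h.liftM q (v 1)) (fundE d n G (q : M) (h.curvE q (v 2) (v 0)))
        + S.gE (q : M) (h.liftM q (v 2)) (fundE d n G (q : M) (h.curvE q (v 0) (v 1)))) := by
  obtain ⟨s, hs⟩ := h.exists_section q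
  rw [h.torsionE_reduced hS hs hN, h.secCurv_eq hs, h.secCurv_eq hs, h.secCurv_eq hs]

/-- The derivative of the torsion form of the quotient. Along a section, the difference between
the lifts of the torsion forms of `M` and of the quotient is `⟨α, R⟩`, whose derivative at a
horizontal point is `⟨dα, R⟩` by the Bianchi identity; the derivative of the lift of the torsion
form of `M` contributes the contraction with the curvature. -/
theorem extDE_torsionE_reduced [T2Space M] (hN : S.IsNormal) (q : μ.zeroLevel)
    (v : Fin 4 → Eu k) {R : Fin 4 → Fin 4 → Eu d} (hR : ∀ i j, R i j = h.curvE q (v i) (v j))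
    {dα : Fin 4 → Fin 4 → LieDual d} (hdα : ∀ i j, dα i j =
      extDE (μ.alphaForm m) q ![h.hLift q (v i), h.hLift q (v j)]) :
    extDE (h.reduced hS).torsionE (μ.proj q) v =
      extDE S.torsionE (q : M) (fun i => h.liftM q (v i))
      - (S.torsionE (q : M) ![fundE d n G (q : M) (R 0 1), h.liftM q (v 2), h.liftM q (v 3)]
        - S.torsionE (q : M) ![fundE d n G (q : M) (R 0 2), h.liftM q (v 1), h.liftM q (v 3)]
        + S.torsionE (q : M) ![fundE d n G (q : M) (R 0 3), h.liftM q (v 1), h.liftM q (v 2)]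
        + S.torsionE (q : M) ![fundE d n G (q : M) (R 1 2), h.liftM q (v 0), h.liftM q (v 3)]
        - S.torsionE (q : M) ![fundE d n G (q : M) (R 1 3), h.liftM q (v 0), h.liftM q (v 2)]
        + S.torsionE (q : M) ![fundE d n G (q : M) (R 2 3), h.liftM q (v 0), h.liftM q (v 1)])
      - (dα 0 1 (R 2 3) - dα 0 2 (R 1 3) + dα 0 3 (R 1 2) + dα 1 2 (R 0 3) - dα 1 3 (R 0 2)
        + dα 2 3 (R 0 1)) := by
  obtain ⟨s, hs⟩ := h.exists_section q
  set z₀ := ch (Eu k) (μ.proj q) (μ.proj q) with hz₀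
  have hs0 : SmoothAt (Eu k) (Eu m) s z₀ := h.smoothAt_section hs
  have e1 : (s z₀ : M) = q := by rw [hs.base]
  let B : Eu k → Eu k [⋀^Fin 3]→L[ℝ] ℝ := pb (h.reduced hS).torsionE (ch (Eu k) (μ.proj q)).symm
  let Q : Eu k → Eu k [⋀^Fin 3]→L[ℝ] ℝ := fun z =>
    (pb S.torsionE (ch (Eu n) (s z₀ : M)).symm (μ.coordMap s z₀ z)).compContinuousLinearMap
      (μ.liftC m s z₀ z)
  have hB : ContDiffAt ℝ ∞ B z₀ := (h.reduced hS).smoothForm_torsionE (μ.proj q)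
  have hQ : ContDiffAt ℝ ∞ Q z₀ := contDiffAt_alternating_comp
    (ContDiffAt.comp z₀ (g := pb S.torsionE (ch (Eu n) (s z₀ : M)).symm)
      (S.smoothForm_torsionE _) (h.contDiffAt_coordMap hs0)) (h.contDiffAt_liftC hs0)
  have hQB : ∀ u : Fin 3 → Eu k, (fun z => (Q - B) z u) =ᶠ[𝓝 z₀] fun z =>
      μ.alphaPb m s z (u 0) (μ.curvPb m s z (u 1) (u 2))
      + μ.alphaPb m s z (u 1) (μ.curvPb m s z (u 2) (u 0))
      + μ.alphaPb m s z (u 2) (μ.curvPb m s z (u 0) (u 1)) := by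
    intro u
    filter_upwards [h.eventually_pb_lift hs S.torsionE, hs.proj, h.curvPb_section hs,
      h.alphaPb_section hs] with z hz1 hz2 hz3 hz4
    have h1 : B z u =
        (h.reduced hS).torsionE (μ.proj (s z)) (fun i => dsym (μ.proj q) z (u i)) := by
      rw [hz2]; rfl
    rw [← hz4, ← hz4, ← hz4, ← hz3, ← hz3, ← hz3]
    change Q z u - B z u = _
    rw [h1, h.torsionE_reduced_curvE hS hN, show Q z u = _ from hz1 u]
    ring
  -- the Bianchi identity, from `d(dθ) = 0`
  have hclosed : extDeriv (pb (μ.dconn m) s) z₀ = 0 := by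
    have h1 : pb (μ.dconn m) s =ᶠ[𝓝 z₀] extDeriv (pb (μ.connForm m) s) := by
      filter_upwards [hs.smooth] with z hz
      exact (h.extDeriv_pb_conn hz).symm
    have h2 : ContDiffAt ℝ ∞ (pb (μ.connForm m) s) z₀ :=
      SmoothForm.contDiffAt_pb (β := μ.connForm m) h.smoothForm_conn hs0
    rw [h1.extDeriv_eq]
    exact extDeriv_extDeriv_apply h2 minSmoothness_two_le
  have hmain := extDeriv_pairing (a := μ.alphaPb m s) (ρ := μ.curvPb m s) (β := Q - B) (z := z₀)
    ((hQ.sub hB).differentiableAt (by simp)) ((h.contDiffAt_alphaPb hs0).differentiableAt (by simp))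
    (h.hasFDerivAt_curvPb hS hs0 (h.connPb_section hs))
    (fun u v w => fderiv_cyclic_of_extDeriv_eq_zero hclosed u v w)
    (fun y u v => alternating_two_swap _ _ _) hQB v
    (da := fun u v => extDE (μ.alphaForm m) (s z₀)
      ![md (Eu k) (Eu m) s z₀ u, md (Eu k) (Eu m) s z₀ v])
    (fun u v => h.extDE_alphaForm_md hs0 u v)
  have hQd := (h.isLiftAt_section hs).extDeriv_comp_three
    (h.differentiableAt_pb_symm hs S.smoothForm_torsionE) v
    (R := secCurv m s (ch (Eu k) (μ.proj q) (μ.proj q))) (fun _ _ => rfl)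
  rw [h.extDeriv_pb_symm hs] at hQd
  change extDeriv Q z₀ v = _ at hQd
  have hBQ : extDeriv (Q - B) z₀ + extDeriv B z₀ = extDeriv Q z₀ := by
    rw [← extDeriv_add (ω₁ := Q - B) ((hQ.sub hB).differentiableAt (by simp))
      (hB.differentiableAt (by simp)), sub_add_cancel]
  have hρ : ∀ i j, μ.curvPb m s z₀ (v i) (v j) = R i j := by
    intro i j
    rw [curvPb, h.hLift_section hs, h.hLift_section hs, hs.base,
      h.horE_of_conn (h.conn_hLift q _), h.horE_of_conn (h.conn_hLift q _), hR]
    rfl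
  have hda : ∀ i j, extDE (μ.alphaForm m) (s z₀)
      ![md (Eu k) (Eu m) s z₀ (v i), md (Eu k) (Eu m) s z₀ (v j)] = dα i j := by
    intro i j
    rw [h.hLift_section hs, h.hLift_section hs, hs.base, hdα]
  simp only [hρ] at hmain
  have hmain' := DFunLike.congr_fun hBQ v
  rw [ContinuousAlternatingMap.add_apply, hmain, hda, hda, hda, hda, hda, hda] at hmain'
  simp only [h.secCurv_eq hs, ← hR] at hQd
  simp only [h.liftC_self hs] at hQd
  simp only [h.pb_symm_self hs] at hQd
  rw [e1] at hQd
  rw [extDE_eq]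
  change extDeriv B z₀ v = _
  rw [hQd] at hmain'
  rw [← eq_sub_iff_add_eq'] at hmain'
  exact hmain'

end IsReductionAtlas

end MomentMap

/-! ### The reduced structure with its torsion form -/

namespace MomentMap

variable {d n m k : ℕ} {G : Type*} [TopologicalSpace G] [ChartedSpace (Eu d) G] [Group G]
  {M : Type*} [TopologicalSpace M] [ChartedSpace (Eu n) M]
  [IsManifold (𝓡 n) ∞ M] [MulAction G M]
  {S : AlmostContactMetric n M} {μ : MomentMap d G S}
  [ChartedSpace (Eu m) μ.zeroLevel] [ChartedSpace (Eu k) μ.Reduction]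
  [LieGroup (𝓡 d) ∞ G] [ContMDiffSMul (𝓡 d) (𝓡 n) ∞ G M]
  [IsManifold (𝓡 m) ∞ μ.zeroLevel] [IsManifold (𝓡 k) ∞ μ.Reduction]

namespace IsReductionAtlas

variable (h : μ.IsReductionAtlas m k) (hS : Preserves G S)

include h

theorem curv_conn (q : μ.zeroLevel) (u v : Eu m) :
    μ.curv (μ.conn m) q u v = h.curvE q (μ.projE m k q u) (μ.projE m k q v) := by
  rw [curvE, h.hLift_projE, h.hLift_projE]
  rfl

theorem dAlphaH_conn (q : μ.zeroLevel) (u v : Eu m) :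
    μ.dAlphaH (μ.conn m) q u v = extDE (μ.alphaForm m) q
      ![h.hLift q (μ.projE m k q u), h.hLift q (μ.projE m k q v)] := by
  rw [h.hLift_projE, h.hLift_projE]
  rfl

theorem torsion_reduced [T2Space M] (hN : S.IsNormal) (q : μ.zeroLevel) (X : Fin 3 → Eu m) :
    (h.reduced hS).torsion (μ.proj q) (fun i => μ.projD (m := m) (k := k) q (X i)) =
      S.torsion (q : M) (fun i => μ.inclD (m := m) q (μ.hproj (m := m) (μ.conn m) q (X i)))
        - μ.alphaR (m := m) (μ.conn m) q X := by
  refine (h.torsionE_reduced_curvE hS hN q fun i => μ.projE m k q (X i)).trans ?_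
  simp only [h.liftM_projE, ← h.curv_conn]
  rfl

theorem extD_torsion_reduced [T2Space M] (hN : S.IsNormal) (q : μ.zeroLevel) (X : Fin 4 → Eu m) :
    extD (h.reduced hS).torsion (μ.proj q) (fun i => μ.projD (m := m) (k := k) q (X i)) =
      extD S.torsion (q : M) (fun i => μ.inclD (m := m) q (μ.hproj (m := m) (μ.conn m) q (X i)))
        - μ.curvTorsion (m := m) (μ.conn m) q
          (fun i => μ.hproj (m := m) (μ.conn m) q (X i))
        - μ.dAlphaR (m := m) (μ.conn m) q X := by
  refine (h.extDE_torsionE_reduced hS hN q (fun i => μ.projE m k q (X i))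
    (R := fun i j => μ.curv (m := m) (μ.conn m) q (μ.horE m q (X i)) (μ.horE m q (X j)))
    (dα := fun i j => μ.dAlphaH (m := m) (μ.conn m) q (X i) (X j)) ?_ ?_).trans ?_
  · intro i j
    rw [h.curv_conn, h.projE_horE, h.projE_horE]
  · intro i j
    exact h.dAlphaH_conn q _ _
  · have e : ∀ i j, μ.curv (m := m) (μ.conn m) q (μ.horE m q (X i)) (μ.horE m q (X j)) =
        μ.curv (m := m) (μ.conn m) q (X i) (X j) := by
      intro i j
      rw [h.curv_conn, h.curv_conn, h.projE_horE, h.projE_horE]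
    have e' : ∀ i j, μ.curv (m := m) (μ.conn m) q (μ.hproj (m := m) (μ.conn m) q (X i))
        (μ.hproj (m := m) (μ.conn m) q (X j)) = μ.curv (m := m) (μ.conn m) q (X i) (X j) := e
    simp only [e, curvTorsion, e', h.liftM_projE]
    rfl

include hS in
/-- The connection form of the horizontal distribution and the induced structure have all the
asserted properties. -/
theorem exists_induced [T2Space M] :
    ∃ θ : ∀ q : μ.zeroLevel, Tan m q →L[ℝ] LieAlg d,
      μ.IsConnectionForm θ ∧
      ∃ T : AlmostContactMetric k μ.Reduction,
        μ.IsInduced (m := m) T ∧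
        (S.IsNormal → T.IsNormal) ∧
        (S.IsST → T.IsST ∧
          (∀ (q : μ.zeroLevel) (X : Fin 3 → Tan m q),
            T.torsion (μ.proj q) (fun i => μ.projD q (X i)) =
              S.torsion (q : M) (fun i => μ.inclD q (μ.hproj θ q (X i))) - μ.alphaR θ q X) ∧
          (∀ (q : μ.zeroLevel) (X : Fin 4 → Tan m q),
            extD T.torsion (μ.proj q) (fun i => μ.projD q (X i)) =
              extD S.torsion (q : M) (fun i => μ.inclD q (μ.hproj θ q (X i)))
                - μ.curvTorsion θ q (fun i => μ.hproj θ q (X i)) - μ.dAlphaR θ q X)) :=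
  ⟨μ.conn m, h.isConnectionForm hS, h.reduced hS, h.isInduced hS, h.isNormal_reduced hS,
    fun hST => ⟨h.isST_reduced hS hST, h.torsion_reduced hS hST.1,
      h.extD_torsion_reduced hS hST.1⟩⟩

end IsReductionAtlas

end MomentMap

/-! ### Slices for the action on the zero level -/

/-- The inverse function theorem for a function smooth on an open set: the local inverse is smooth
on its whole domain. -/
theorem exists_openPartialHomeomorph_of_contDiffOn {E F : Type*} [NormedAddCommGroup E]
    [NormedSpace ℝ E] [CompleteSpace E] [NormedAddCommGroup F] [NormedSpace ℝ F] {f : E → F}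
    {U : Set E} (hU : IsOpen U) {x : E} (hx : x ∈ U) (hf : ContDiffOn ℝ ∞ f U) {f' : E ≃L[ℝ] F}
    (hf' : HasFDerivAt f (f' : E →L[ℝ] F) x) :
    ∃ e : OpenPartialHomeomorph E F, (∀ y, e y = f y) ∧ x ∈ e.source ∧ e.source ⊆ U ∧
      ∀ y ∈ e.target, ContDiffAt ℝ ∞ e.symm y := by
  have hfx : ContDiffAt ℝ ∞ f x := hf.contDiffAt (hU.mem_nhds hx)
  have hV : IsOpen (U ∩ fderiv ℝ f ⁻¹' Set.range ((↑) : (E ≃L[ℝ] F) → E →L[ℝ] F)) :=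
    (hf.continuousOn_fderiv_of_isOpen hU (by simp)).isOpen_inter_preimage hU
      ContinuousLinearEquiv.isOpen
  refine ⟨(hfx.toOpenPartialHomeomorph f hf' (by simp)).restrOpen _ hV, fun _ => rfl, ?_, ?_, ?_⟩
  · exact ⟨hfx.mem_toOpenPartialHomeomorph_source hf' (by simp), hx, f', hf'.fderiv.symm⟩
  · exact fun y hy => hy.2.1
  · intro y hy
    have h1 := OpenPartialHomeomorph.map_target _ hy
    obtain ⟨h2, g', hg'⟩ := h1.2
    have h3 : ContDiffAt ℝ ∞ f _ := hf.contDiffAt (hU.mem_nhds h2)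
    refine OpenPartialHomeomorph.contDiffAt_symm _ (f₀' := g') hy ?_ h3
    rw [hg']
    exact (h3.differentiableAt (by simp)).hasFDerivAt

/-- A surjective linear map is a projection in suitable linear coordinates. -/
theorem exists_equiv_prod_of_surjective {V W : Type*} [NormedAddCommGroup V] [NormedSpace ℝ V]
    [FiniteDimensional ℝ V] [NormedAddCommGroup W] [NormedSpace ℝ W] [FiniteDimensional ℝ W]
    {k : ℕ} {D : V →L[ℝ] W} (hD : Function.Surjective D)
    (hk : k + Module.finrank ℝ W = Module.finrank ℝ V) :
    ∃ L : V ≃L[ℝ] Eu k × W, ∀ v, (L v).2 = D v := by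
  have h1 := LinearMap.finrank_range_add_finrank_ker D.toLinearMap
  rw [LinearMap.range_eq_top.2 hD, finrank_top] at h1
  have h2 : Module.finrank ℝ (LinearMap.ker D.toLinearMap) = Module.finrank ℝ (Eu k) := by
    rw [finrank_euclideanSpace_fin]; omega
  obtain ⟨P, hP⟩ := LinearMap.exists_leftInverse_of_injective
    (LinearMap.ker D.toLinearMap).subtype (Submodule.ker_subtype _)
  let e := LinearEquiv.ofFinrankEq _ _ h2
  let L : V →ₗ[ℝ] Eu k × W := (e.toLinearMap.comp P).prod D.toLinearMap
  have hL : Function.Injective L := by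
    refine (injective_iff_map_eq_zero L).2 fun v hv => ?_
    have hv1 : e (P v) = 0 := congrArg Prod.fst hv
    have hv2 : v ∈ LinearMap.ker D.toLinearMap := congrArg Prod.snd hv
    have hv3 := LinearMap.congr_fun hP ⟨v, hv2⟩
    have hv4 : P v = ⟨v, hv2⟩ := hv3
    rw [hv4] at hv1
    exact congrArg Subtype.val (e.map_eq_zero_iff.1 hv1)
  refine ⟨(LinearEquiv.ofInjectiveOfFinrankEq L hL ?_).toContinuousLinearEquiv, fun v => rfl⟩
  rw [Module.finrank_prod, finrank_euclideanSpace_fin, hk]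

namespace MomentMap

variable {d n k : ℕ} {G : Type*} [TopologicalSpace G] [ChartedSpace (Eu d) G] [Group G]
  {M : Type*} [TopologicalSpace M] [ChartedSpace (Eu n) M]
  [IsManifold (𝓡 n) ∞ M] [MulAction G M]
  {S : AlmostContactMetric n M} (μ : MomentMap d G S)
  [LieGroup (𝓡 d) ∞ G] [ContMDiffSMul (𝓡 d) (𝓡 n) ∞ G M]

/-- On the zero level, `dμ ∘ φ` is an isomorphism on the vectors `A*`, on which `dμ` vanishes, and
`dμ` is an isomorphism on the vectors `φ(A*)`. -/
theorem phiDual_prod_dE_surjective {p : M} (hp : μ.toFun p = 0) :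
    Function.Surjective ((μ.phiDual p).prod (μ.dE p)) := by
  rintro ⟨a, b⟩
  obtain ⟨A, hA⟩ := (μ.pairingEquiv hp).surjective a
  obtain ⟨B, hB⟩ := (μ.pairingEquiv hp).surjective b
  have hA' : μ.phiDual p (fundE d n G p A) = a := hA
  have hB' : μ.dE p (S.phiE p (fundE d n G p B)) = b := hB
  refine ⟨fundE d n G p A + S.phiE p (fundE d n G p B), ?_⟩
  simp [hA', hB', μ.dE_fundE hp, μ.phiDual_phi]

theorem two_mul_dim_le {p : M} (hp : μ.toFun p = 0) : 2 * d ≤ n := by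
  have h := LinearMap.finrank_range_le ((μ.phiDual p).prod (μ.dE p)).toLinearMap
  rw [LinearMap.range_eq_top.2 (μ.phiDual_prod_dE_surjective hp), finrank_top,
    Module.finrank_prod, finrank_lieDual, finrank_euclideanSpace_fin] at h
  omega

/-- Through each point of the zero level there is a submanifold transversal to the orbit, tangent
to `ker (dμ ∘ φ)`, and parametrised in such a way that `μ` is a coordinate. -/
theorem exists_transversal (hk : k + 2 * d = n) {p : M} (hp : μ.toFun p = 0) :
    ∃ (j : Eu k × LieDual d → M) (D : Set (Eu k × LieDual d)), IsOpen D ∧ 0 ∈ D ∧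
      (∀ w ∈ D, SmoothAt (Eu k × LieDual d) (Eu n) j w) ∧ (∀ w ∈ D, μ.toFun (j w) = w.2) ∧
      j 0 = p ∧ (∀ w, μ.phiDual p (md (Eu k × LieDual d) (Eu n) j 0 w) = 0) ∧
      Function.Injective (md (Eu k × LieDual d) (Eu n) j 0) := by
  -- near `p`, the map `y ↦ (P y, dμ_p(φ y), μ(y))` is a chart; the transversal is the locus where
  -- its second component vanishes
  obtain ⟨L, hL⟩ := exists_equiv_prod_of_surjective (k := k) (μ.phiDual_prod_dE_surjective hp)
    (by rw [Module.finrank_prod, finrank_lieDual, finrank_euclideanSpace_fin]; omega)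
  set x₀ := ch (Eu n) p p with hx₀
  have hx₀p : (ch (Eu n) p).symm x₀ = p := extChartAt_to_inv p
  let P : Eu n →L[ℝ] Eu k := (ContinuousLinearMap.fst ℝ (Eu k) (LieDual d × LieDual d)).comp
    (L : Eu n →L[ℝ] Eu k × (LieDual d × LieDual d))
  let f : Eu n → Eu k × (LieDual d × LieDual d) := fun y =>
    (P (y - x₀), (μ.phiDual p (y - x₀), μ.toFun ((ch (Eu n) p).symm y)))
  have hμ : ∀ y ∈ (ch (Eu n) p).target,
      ContDiffAt ℝ ∞ (fun y => μ.toFun ((ch (Eu n) p).symm y)) y :=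
    fun y hy => smoothAt_iff_contDiffAt.1
      (ContMDiffAt.comp y (μ.smoothAt_toFun _) (smoothAt_ch_symm hy))
  have hlin : ∀ {W : Type} [NormedAddCommGroup W] [NormedSpace ℝ W] (T : Eu n →L[ℝ] W),
      ContDiff ℝ ∞ (fun y => T (y - x₀)) := fun T =>
    T.contDiff.comp (contDiff_id.sub contDiff_const)
  have hf : ContDiffOn ℝ ∞ f (ch (Eu n) p).target := fun y hy =>
    ((hlin P).contDiffAt.prodMk ((hlin _).contDiffAt.prodMk (hμ y hy))).contDiffWithinAt
  have hlin' : ∀ {W : Type} [NormedAddCommGroup W] [NormedSpace ℝ W] (T : Eu n →L[ℝ] W),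
      HasFDerivAt (fun y => T (y - x₀)) T x₀ := fun T => by
    have h1 := T.hasFDerivAt.comp x₀ ((hasFDerivAt_id x₀).sub_const x₀)
    rwa [ContinuousLinearMap.comp_id] at h1
  have hμ' : HasFDerivAt (fun y => μ.toFun ((ch (Eu n) p).symm y)) (μ.dE p) x₀ := by
    have h1 := ((hμ x₀ (mem_extChartAt_target p)).differentiableAt (by simp)).hasFDerivAt
    have h2 : fderiv ℝ (fun y => μ.toFun ((ch (Eu n) p).symm y)) x₀ = μ.dE p := by
      refine (μ.momentC_eq p (mem_extChartAt_target p)).trans ?_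
      rw [dsym, md_ch_symm_self, hx₀p]
      rfl
    rwa [h2] at h1
  have hf' : HasFDerivAt f (L : Eu n →L[ℝ] Eu k × (LieDual d × LieDual d)) x₀ := by
    refine ((hlin' P).prodMk ((hlin' (μ.phiDual p)).prodMk hμ')).congr_fderiv ?_
    ext1 v
    exact Prod.ext rfl (hL v).symm
  obtain ⟨e, hef, hxe, hes, he⟩ := exists_openPartialHomeomorph_of_contDiffOn
    (isOpen_extChartAt_target p) (mem_extChartAt_target p) hf hf'
  let ι : Eu k × LieDual d →L[ℝ] Eu k × (LieDual d × LieDual d) :=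
    (ContinuousLinearMap.fst ℝ _ _).prod ((0 : Eu k × LieDual d →L[ℝ] LieDual d).prod
      (ContinuousLinearMap.snd ℝ _ _))
  have hf0 : e x₀ = ι 0 := by
    have h1 : μ.toFun ((ch (Eu n) p).symm x₀) = 0 := by rw [hx₀p, hp]
    rw [hef, map_zero]
    simp only [f, h1, sub_self, map_zero, Prod.mk_zero_zero]
  have h0 : ι 0 ∈ e.target := hf0 ▸ e.map_source hxe
  have hi0 : e.symm (ι 0) = x₀ := by rw [← hf0, e.left_inv hxe]
  have hD : ∀ w, ι w ∈ e.target → e.symm (ι w) ∈ (ch (Eu n) p).target :=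
    fun w hw => hes (e.map_target hw)
  have hjs : ∀ w, ι w ∈ e.target → ContDiffAt ℝ ∞ (fun w => e.symm (ι w)) w := fun w hw =>
    ContDiffAt.comp w (he _ hw) ι.contDiff.contDiffAt
  have hder : md (Eu k × LieDual d) (Eu n) (fun w => (ch (Eu n) p).symm (e.symm (ι w))) 0 =
      (L.symm : Eu k × (LieDual d × LieDual d) →L[ℝ] Eu n).comp ι := by
    have h1 : HasFDerivAt e.symm (L.symm : Eu k × (LieDual d × LieDual d) →L[ℝ] Eu n) (ι 0) := by
      refine e.hasFDerivAt_symm h0 ?_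
      rw [hi0]
      exact hf'.congr_of_eventuallyEq (Filter.Eventually.of_forall hef)
    have h2 : HasFDerivAt (fun w => e.symm (ι w)) _ 0 := h1.comp 0 ι.hasFDerivAt
    have h3 := md_comp_of_mdifferentiableAt (f := fun w => e.symm (ι w)) (x := 0)
      (g := (ch (Eu n) p).symm) (smoothAt_ch_symm (hD 0 h0)).mdifferentiableAt
      h2.differentiableAt.mdifferentiableAt
    rw [h3, hi0, md_ch_symm_self, md_eq_fderiv, h2.fderiv]
    rfl
  refine ⟨fun w => (ch (Eu n) p).symm (e.symm (ι w)), ι ⁻¹' e.target,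
    e.open_target.preimage ι.continuous, h0, fun w hw => ?_, fun w hw => ?_, ?_, fun w => ?_, ?_⟩
  · exact ContMDiffAt.comp w (smoothAt_ch_symm (hD w hw)) (smoothAt_iff_contDiffAt.2 (hjs w hw))
  · have h1 := e.right_inv hw
    rw [hef] at h1
    exact congrArg (fun t => t.2.2) h1
  · simp only [hi0, hx₀p]
  · rw [hder]
    have h1 := hL (L.symm (ι w))
    rw [L.apply_symm_apply] at h1
    exact (congrArg Prod.fst h1).symm
  · rw [hder]
    intro w w' hw
    have h1 : (w.1, ((0 : LieDual d), w.2)) = (w'.1, ((0 : LieDual d), w'.2)) :=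
      L.symm.injective hw
    exact Prod.ext (Prod.mk.inj h1).1 (Prod.mk.inj (Prod.mk.inj h1).2).2

end MomentMap

namespace MomentMap

variable {d n : ℕ} {G : Type*} [TopologicalSpace G] [ChartedSpace (Eu d) G] [Group G]
  {M : Type*} [TopologicalSpace M] [ChartedSpace (Eu n) M]
  [IsManifold (𝓡 n) ∞ M] [MulAction G M]
  {S : AlmostContactMetric n M} (μ : MomentMap d G S)

variable (d G) in
/-- The centre of the preferred chart of `G` at `1`. -/
def baseG : Eu d := ch (Eu d) (1 : G) 1

variable (d G) in
/-- The inverse of the preferred chart of `G` at `1`. -/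
def parG (a : Eu d) : G := (ch (Eu d) (1 : G)).symm a

theorem parG_baseG : parG d G (baseG d G) = 1 := extChartAt_to_inv (1 : G)

/-- A slice at a point `q` of the zero level: an open piece of the manifold is parametrised by
`(a, w) ↦ γ(a) • j(w)`, where `γ` is the inverse of the chart of `G` at `1` and `j` parametrises a
transversal such that `μ (j (z, ν)) = ν`; distinct points `j (z, 0)` lie on distinct orbits. -/
structure Slice (k : ℕ) (q : μ.zeroLevel) where
  /-- the parametrisation of an open subset of `M` -/
  e : OpenPartialHomeomorph (Eu d × (Eu k × LieDual d)) M
  /-- the parametrisation of the transversal -/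
  j : Eu k × LieDual d → M
  /-- the radius of the domain -/
  r : ℝ
  r_pos : 0 < r
  source_eq : e.source = Metric.ball (baseG d G, 0) r
  apply_eq : ∀ a w, (a, w) ∈ e.source → e (a, w) = parG d G a • j w
  smooth : ∀ x ∈ e.source, SmoothAt (Eu d × (Eu k × LieDual d)) (Eu n) e x
  smooth_symm : ∀ x ∈ e.target, SmoothAt (Eu n) (Eu d × (Eu k × LieDual d)) e.symm x
  moment : ∀ w ∈ Metric.ball (0 : Eu k × LieDual d) r, μ.toFun (j w) = w.2
  base : j 0 = q
  inj : ∀ z ∈ Metric.ball (0 : Eu k) r, ∀ z' ∈ Metric.ball (0 : Eu k) r, ∀ g : G,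
    g • j (z, 0) = j (z', 0) → z = z'
  smooth_j : ∀ w ∈ Metric.ball (0 : Eu k × LieDual d) r, SmoothAt (Eu k × LieDual d) (Eu n) j w
  horizontal : ∀ w, μ.phiDual q (md (Eu k × LieDual d) (Eu n) j 0 w) = 0

section Existence

variable [LieGroup (𝓡 d) ∞ G] [ContMDiffSMul (𝓡 d) (𝓡 n) ∞ G M] {k : ℕ}

omit [IsManifold (𝓡 n) ∞ M] in
theorem smoothAt_parG_smul {j : Eu k × LieDual d → M} {a : Eu d} {w : Eu k × LieDual d}
    (ha : a ∈ (ch (Eu d) (1 : G)).target) (hj : SmoothAt (Eu k × LieDual d) (Eu n) j w) :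
    SmoothAt (Eu d × (Eu k × LieDual d)) (Eu n)
      (fun x : Eu d × (Eu k × LieDual d) => parG d G x.1 • j x.2) (a, w) := by
  refine SmoothAt.smul (d := d) ?_ ?_
  · exact ContMDiffAt.comp (g := (ch (Eu d) (1 : G)).symm) (a, w)
      (smoothAt_ch_symm ha) (smoothAt_iff_contDiffAt.2 contDiffAt_fst)
  · exact ContMDiffAt.comp (g := j) (a, w) hj (smoothAt_iff_contDiffAt.2 contDiffAt_snd)

/-- The derivative of the parametrisation `(a, w) ↦ γ(a) • j(w)` at its centre. -/
theorem md_parG_smul {j : Eu k × LieDual d → M} {p : M} (h0 : j 0 = p)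
    (hj : SmoothAt (Eu k × LieDual d) (Eu n) j 0) (A : Eu d) (w : Eu k × LieDual d) :
    md (Eu d × (Eu k × LieDual d)) (Eu n)
      (fun x : Eu d × (Eu k × LieDual d) => parG d G x.1 • j x.2) (baseG d G, 0) (A, w) =
      fundE d n G p A + md (Eu k × LieDual d) (Eu n) j 0 w := by
  have hΦ := smoothAt_parG_smul (G := G) (mem_extChartAt_target (1 : G)) hj
  have h1 : md (Eu d × (Eu k × LieDual d)) (Eu n)
      (fun x : Eu d × (Eu k × LieDual d) => parG d G x.1 • j x.2) (baseG d G, 0) (A, 0) =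
      fundE d n G p A := by
    have hl : HasFDerivAt (fun a : Eu d => (a, (0 : Eu k × LieDual d)))
        (ContinuousLinearMap.inl ℝ (Eu d) (Eu k × LieDual d)) (baseG d G) :=
      hasFDerivAt_prodMk_left _ _
    have h2 := md_comp_of_mdifferentiableAt (f := fun a : Eu d => (a, (0 : Eu k × LieDual d)))
      (x := baseG d G) hΦ.mdifferentiableAt hl.differentiableAt.mdifferentiableAt
    rw [md_eq_fderiv, hl.fderiv] at h2
    refine (DFunLike.congr_fun h2 A).symm.trans ?_
    have h3 : SmoothAt (Eu d) (Eu n) (fun g : G => g • j 0) (parG d G (baseG d G)) :=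
      smoothAt_orbit _ _
    have h4 := md_comp_apply (f := parG d G) (g := fun g : G => g • j 0) (x := baseG d G) h3
      (smoothAt_ch_symm_self (1 : G)) A
    refine h4.trans ?_
    have h5 : md (Eu d) (Eu d) (parG d G) (baseG d G) = ContinuousLinearMap.id ℝ _ :=
      md_ch_symm_self (1 : G)
    rw [h5, parG_baseG, h0]
    rfl
  have h2 : md (Eu d × (Eu k × LieDual d)) (Eu n)
      (fun x : Eu d × (Eu k × LieDual d) => parG d G x.1 • j x.2) (baseG d G, 0) (0, w) =
      md (Eu k × LieDual d) (Eu n) j 0 w := by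
    have hr : HasFDerivAt (fun w : Eu k × LieDual d => (baseG d G, w))
        (ContinuousLinearMap.inr ℝ (Eu d) (Eu k × LieDual d)) 0 :=
      hasFDerivAt_prodMk_right _ _
    have h2 := md_comp_of_mdifferentiableAt (f := fun w : Eu k × LieDual d => (baseG d G, w))
      (x := 0) hΦ.mdifferentiableAt hr.differentiableAt.mdifferentiableAt
    rw [md_eq_fderiv, hr.fderiv] at h2
    refine (DFunLike.congr_fun h2 w).symm.trans ?_
    simp only [parG_baseG, one_smul]
  rw [← h1, ← h2, ← map_add]
  simp

/-- The transversal and the group direction together parametrise a neighbourhood of `p`. -/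
theorem exists_slice_chart (hk : k + 2 * d = n) {p : M} (hp : μ.toFun p = 0)
    {j : Eu k × LieDual d → M} {D : Set (Eu k × LieDual d)} (hD : IsOpen D) (h0D : 0 ∈ D)
    (hj : ∀ w ∈ D, SmoothAt (Eu k × LieDual d) (Eu n) j w)
    (hj0 : j 0 = p) (hh : ∀ w, μ.phiDual p (md (Eu k × LieDual d) (Eu n) j 0 w) = 0)
    (hi : Function.Injective (md (Eu k × LieDual d) (Eu n) j 0)) :
    ∃ e : OpenPartialHomeomorph (Eu d × (Eu k × LieDual d)) M,
      (baseG d G, 0) ∈ e.source ∧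
      (∀ a w, (a, w) ∈ e.source → w ∈ D ∧ a ∈ (ch (Eu d) (1 : G)).target ∧
        e (a, w) = parG d G a • j w) ∧
      ∀ x ∈ e.target, SmoothAt (Eu n) (Eu d × (Eu k × LieDual d)) e.symm x := by
  let Φ : Eu d × (Eu k × LieDual d) → M := fun x => parG d G x.1 • j x.2
  have hΦs : ∀ x : Eu d × (Eu k × LieDual d), x.1 ∈ (ch (Eu d) (1 : G)).target → x.2 ∈ D →
      SmoothAt (Eu d × (Eu k × LieDual d)) (Eu n) Φ x := fun x h1 h2 =>
    smoothAt_parG_smul h1 (hj _ h2)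
  have hU₀ : IsOpen ((ch (Eu d) (1 : G)).target ×ˢ D) := (isOpen_extChartAt_target (1 : G)).prod hD
  have hΦc : ContinuousOn Φ ((ch (Eu d) (1 : G)).target ×ˢ D) := fun x hx =>
    (hΦs x hx.1 hx.2).continuousAt.continuousWithinAt
  have hU := hΦc.isOpen_inter_preimage hU₀ (isOpen_extChartAt_source (I := 𝓡 n) p)
  have hΦ0 : Φ (baseG d G, 0) = p := by simp only [Φ, parG_baseG, one_smul, hj0]
  have hb : (baseG d G, (0 : Eu k × LieDual d)) ∈
      (ch (Eu d) (1 : G)).target ×ˢ D ∩ Φ ⁻¹' (ch (Eu n) p).source :=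
    ⟨⟨mem_extChartAt_target (1 : G), h0D⟩, by
      rw [Set.mem_preimage, hΦ0]; exact mem_extChartAt_source p⟩
  have hf : ContDiffOn ℝ ∞ (fun x => ch (Eu n) p (Φ x))
      ((ch (Eu d) (1 : G)).target ×ˢ D ∩ Φ ⁻¹' (ch (Eu n) p).source) := fun x hx =>
    (smoothAt_iff_contDiffAt.1
      (ContMDiffAt.comp x (smoothAt_ch hx.2) (hΦs x hx.1.1 hx.1.2))).contDiffWithinAt
  have hder : ∀ A w, fderiv ℝ (fun x => ch (Eu n) p (Φ x)) (baseG d G, 0) (A, w) =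
      fundE d n G p A + md (Eu k × LieDual d) (Eu n) j 0 w := by
    intro A w
    rw [← md_eq_fderiv, md_comp_apply (f := Φ) (smoothAt_ch hb.2) (hΦs _ hb.1.1 hb.1.2), hΦ0,
      md_ch_self]
    exact md_parG_smul hj0 (hj 0 h0D) A w
  have hinj : Function.Injective (fderiv ℝ (fun x => ch (Eu n) p (Φ x)) (baseG d G, 0)) := by
    refine (injective_iff_map_eq_zero _).2 ?_
    rintro ⟨A, w⟩ hx
    rw [hder] at hx
    -- the transversal is annihilated by `dμ ∘ φ`, which is injective on the fundamental vectors
    have h1 := congrArg (μ.phiDual p) hx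
    rw [map_add, hh, add_zero, map_zero] at h1
    have hA : A = 0 := μ.pairing_injective hp (h1.trans (map_zero _).symm)
    rw [hA, map_zero, zero_add] at hx
    rw [hA, hi (hx.trans (map_zero _).symm)]
    rfl
  have hfin : Module.finrank ℝ (Eu d × (Eu k × LieDual d)) = Module.finrank ℝ (Eu n) := by
    rw [Module.finrank_prod, Module.finrank_prod, finrank_lieDual, finrank_euclideanSpace_fin,
      finrank_euclideanSpace_fin, finrank_euclideanSpace_fin]
    omega
  let L : (Eu d × (Eu k × LieDual d)) ≃L[ℝ] Eu n := (LinearEquiv.ofInjectiveOfFinrankEq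
    (fderiv ℝ (fun x => ch (Eu n) p (Φ x)) (baseG d G, 0)).toLinearMap hinj
    hfin).toContinuousLinearEquiv
  have hL : HasFDerivAt (fun x => ch (Eu n) p (Φ x))
      (L : (Eu d × (Eu k × LieDual d)) →L[ℝ] Eu n) (baseG d G, 0) :=
    ((hf.contDiffAt (hU.mem_nhds hb)).differentiableAt (by simp)).hasFDerivAt
  obtain ⟨e, hef, hxe, hes, he⟩ := exists_openPartialHomeomorph_of_contDiffOn hU hb hf hL
  have hsrc : ∀ x ∈ e.source, e x ∈ (chartAt (Eu n) p).target := by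
    intro x hx
    have h1 := (ch (Eu n) p).map_source (hes hx).2
    rw [hef]
    simpa using h1
  refine ⟨e.trans (chartAt (Eu n) p).symm, ?_, ?_, ?_⟩
  · exact ⟨hxe, hsrc _ hxe⟩
  · intro a w hx
    refine ⟨(hes hx.1).1.2, (hes hx.1).1.1, ?_⟩
    change (chartAt (Eu n) p).symm (e (a, w)) = _
    rw [hef]
    exact (ch (Eu n) p).left_inv (hes hx.1).2
  · intro x hx
    have hx' : x ∈ (chartAt (Eu n) p).source ∧ chartAt (Eu n) p x ∈ e.target := by
      simpa using hx
    exact ContMDiffAt.comp x (f := ch (Eu n) p) (g := e.symm)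
      (smoothAt_iff_contDiffAt.2 (he _ hx'.2)) (smoothAt_ch (by simpa using hx'.1))

variable [T2Space M] [CompactSpace G] [IsCancelSMul G M]

/-- Near a point with trivial stabiliser, points of the transversal are on the same orbit only if
they coincide: group elements away from `1` move the transversal off itself, by compactness. -/
theorem eventually_slice_inj [ContinuousSMul G M] {j : Eu k × LieDual d → M}
    (hj : ContinuousAt j 0)
    {e : OpenPartialHomeomorph (Eu d × (Eu k × LieDual d)) M} (he : (baseG d G, 0) ∈ e.source)
    (hej : ∀ a w, (a, w) ∈ e.source → e (a, w) = parG d G a • j w) :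
    ∀ᶠ z in 𝓝 (0 : Eu k × Eu k), ∀ g : G, g • j (z.1, 0) = j (z.2, 0) → z.1 = z.2 := by
  obtain ⟨r, hr, hrs⟩ := Metric.isOpen_iff.1 e.open_source _ he
  let W : Set G := (ch (Eu d) (1 : G)).source ∩ ch (Eu d) (1 : G) ⁻¹' Metric.ball (baseG d G) r
  have hW : IsOpen W := (continuousOn_extChartAt (I := 𝓡 d) (1 : G)).isOpen_inter_preimage
    (isOpen_extChartAt_source (1 : G)) Metric.isOpen_ball
  have h1W : (1 : G) ∈ W := ⟨mem_extChartAt_source (1 : G), Metric.mem_ball_self hr⟩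
  have hK : IsCompact Wᶜ := hW.isClosed_compl.isCompact
  have hι : Continuous fun z : Eu k => (z, (0 : LieDual d)) := Continuous.prodMk_left 0
  have hjι : ContinuousAt (fun z : Eu k => j (z, 0)) 0 :=
    ContinuousAt.comp (g := j) (x := (0 : Eu k)) hj hι.continuousAt
  have h1 : ∀ᶠ z in 𝓝 (0 : Eu k × Eu k), ∀ g ∈ Wᶜ, g • j (z.1, 0) ≠ j (z.2, 0) := by
    refine hK.eventually_forall_of_forall_eventually fun g hg => ?_
    have h2 : g • j (0, 0) ≠ j (0, 0) := by
      intro h3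
      refine hg ?_
      have h4 : g = 1 := IsCancelSMul.right_cancel _ _ (j (0, 0)) (by rw [h3, one_smul])
      exact h4 ▸ h1W
    have h5 : ContinuousAt (fun x : (Eu k × Eu k) × G => x.2 • j (x.1.1, 0)) (0, g) := by
      refine ContinuousAt.smul continuousAt_snd ?_
      exact ContinuousAt.comp (g := fun z : Eu k => j (z, 0)) (x := ((0 : Eu k × Eu k), g)) hjι
        (continuous_fst.fst.continuousAt)
    have h6 : ContinuousAt (fun x : (Eu k × Eu k) × G => j (x.1.2, 0)) (0, g) :=
      ContinuousAt.comp (g := fun z : Eu k => j (z, 0)) (x := ((0 : Eu k × Eu k), g)) hjι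
        (continuous_fst.snd.continuousAt)
    exact (ContinuousAt.ne_iff_eventually_ne h5 h6).1 h2
  have h2 : ∀ᶠ z in 𝓝 (0 : Eu k × Eu k), z ∈ Metric.ball (0 : Eu k × Eu k) r :=
    Metric.ball_mem_nhds _ hr
  filter_upwards [h1, h2] with z hz1 hz2 g hg
  by_cases hgW : g ∈ W
  · have hz3 : ‖z.1‖ < r ∧ ‖z.2‖ < r := by
      rwa [mem_ball_zero_iff, Prod.norm_def, max_lt_iff] at hz2
    have hs : ∀ a ∈ Metric.ball (baseG d G) r, ∀ y : Eu k, ‖y‖ < r →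
        (a, (y, (0 : LieDual d))) ∈ e.source := by
      intro a ha y hy
      refine hrs ?_
      rw [Metric.mem_ball, Prod.dist_eq, Prod.dist_eq]
      simp [Metric.mem_ball.1 ha, hy]
    have ha := hs _ hgW.2 z.1 hz3.1
    have hb := hs _ (Metric.mem_ball_self hr) z.2 hz3.2
    have h3 := hej _ _ ha
    have h4 := hej _ _ hb
    rw [parG, (ch (Eu d) (1 : G)).left_inv hgW.1, hg] at h3
    rw [parG_baseG, one_smul] at h4
    have h5 := e.injOn ha hb (h3.trans h4.symm)
    exact congrArg (fun t => t.2.1) h5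
  · exact absurd hg (hz1 g hgW)

theorem nonempty_slice (hk : k + 2 * d = n) (q : μ.zeroLevel) : Nonempty (μ.Slice k q) := by
  have : ContinuousSMul G M := ContMDiffSMul.continuousSMul (I := 𝓡 d) (I' := 𝓡 n) ∞
  obtain ⟨j, D, hD, h0D, hj, hμ, hj0, hh, hi⟩ := μ.exists_transversal hk q.2
  obtain ⟨e, he0, hej, hes⟩ := μ.exists_slice_chart hk q.2 hD h0D hj hj0 hh hi
  have hinj := eventually_slice_inj (hj 0 h0D).continuousAt he0 fun a w h => (hej a w h).2.2
  obtain ⟨r₁, hr₁, hrs⟩ := Metric.isOpen_iff.1 e.open_source _ he0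
  obtain ⟨r₂, hr₂, hri⟩ := Metric.eventually_nhds_iff_ball.1 hinj
  have hb : Metric.ball (baseG d G, (0 : Eu k × LieDual d)) (min r₁ r₂) ⊆ e.source :=
    (Metric.ball_subset_ball (min_le_left _ _)).trans hrs
  have hbw : ∀ w ∈ Metric.ball (0 : Eu k × LieDual d) (min r₁ r₂), w ∈ D := by
    intro w hw
    refine (hej (baseG d G) w (hb ?_)).1
    rw [Metric.mem_ball, Prod.dist_eq]
    simpa [hr₁, hr₂] using hw
  have hsrc : (e.restrOpen _ (Metric.isOpen_ball
      (x := (baseG d G, (0 : Eu k × LieDual d))) (ε := min r₁ r₂))).source =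
      Metric.ball (baseG d G, 0) (min r₁ r₂) := Set.inter_eq_right.2 hb
  refine ⟨⟨e.restrOpen _ Metric.isOpen_ball, j, min r₁ r₂, lt_min hr₁ hr₂, hsrc, ?_, ?_, ?_,
    fun w hw => hμ w (hbw w hw), hj0, ?_, fun w hw => hj w (hbw w hw), hh⟩⟩
  · exact fun a w h => (hej a w h.1).2.2
  · rintro ⟨a, w⟩ hx
    have h1 : SmoothAt (Eu d × (Eu k × LieDual d)) (Eu n)
        (fun x : Eu d × (Eu k × LieDual d) => parG d G x.1 • j x.2) (a, w) :=
      smoothAt_parG_smul (hej a w hx.1).2.1 (hj w (hej a w hx.1).1)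
    refine ContMDiffAt.congr_of_eventuallyEq h1 ?_
    filter_upwards [e.open_source.mem_nhds hx.1] with y hy
    exact (hej y.1 y.2 hy).2.2
  · intro x hx
    refine hes x ?_
    have h1 := OpenPartialHomeomorph.map_target _ hx
    have h2 := e.map_source h1.1
    have h3 : e ((e.restrOpen _ Metric.isOpen_ball).symm x) = x :=
      (e.restrOpen _ Metric.isOpen_ball).right_inv hx
    exact h3 ▸ h2
  · intro z hz z' hz' g hg
    refine hri (z, z') ?_ g hg
    have h1 := Metric.ball_subset_ball (min_le_right r₁ r₂) hz
    have h2 := Metric.ball_subset_ball (min_le_right r₁ r₂) hz'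
    rw [Metric.mem_ball] at h1 h2 ⊢
    rw [Prod.dist_eq]
    exact max_lt h1 h2

end Existence

end MomentMap

/-! ### Charts of the zero level and of the quotient -/

namespace MomentMap

variable {d n k : ℕ} {G : Type*} [TopologicalSpace G] [ChartedSpace (Eu d) G] [Group G]
  {M : Type*} [TopologicalSpace M] [ChartedSpace (Eu n) M]
  [IsManifold (𝓡 n) ∞ M] [MulAction G M]
  {S : AlmostContactMetric n M} {μ : MomentMap d G S}

theorem toFun_smul_eq_zero_iff (g : G) (x : M) : μ.toFun (g • x) = 0 ↔ μ.toFun x = 0 := by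
  have h : ∀ (g : G) (x : M), μ.toFun x = 0 → μ.toFun (g • x) = 0 := by
    intro g x hx
    ext A
    rw [μ.equivariant, hx]
    rfl
  refine ⟨fun hx => ?_, h g x⟩
  have h1 := h g⁻¹ _ hx
  rwa [inv_smul_smul] at h1

theorem coe_smul_zeroLevel (g : G) (q : μ.zeroLevel) : ((g • q : μ.zeroLevel) : M) = g • (q : M) :=
  rfl

theorem proj_smul (g : G) (q : μ.zeroLevel) : μ.proj (g • q) = μ.proj q :=
  Quotient.sound ⟨g, rfl⟩

theorem proj_eq_iff {q q' : μ.zeroLevel} : μ.proj q = μ.proj q' ↔ ∃ g : G, g • q' = q :=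
  ⟨fun h => Quotient.exact h, fun h => Quotient.sound h⟩

instance [ContinuousSMul G M] : ContinuousSMul G μ.zeroLevel :=
  ⟨Continuous.subtype_mk (continuous_fst.smul (continuous_subtype_val.comp continuous_snd)) _⟩

namespace Slice

variable {q : μ.zeroLevel} (σ : μ.Slice k q)

theorem mem_source_iff (x : Eu d × (Eu k × LieDual d)) :
    x ∈ σ.e.source ↔ ‖x.1 - baseG d G‖ < σ.r ∧ ‖x.2.1‖ < σ.r ∧ ‖x.2.2‖ < σ.r := by
  rw [σ.source_eq, mem_ball_iff_norm, Prod.norm_def, Prod.norm_def, max_lt_iff, max_lt_iff]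
  simp

theorem mem_source {x : Eu d × Eu k} (hx : x ∈ Metric.ball (baseG d G, (0 : Eu k)) σ.r) :
    (x.1, (x.2, (0 : LieDual d))) ∈ σ.e.source := by
  rw [mem_ball_iff_norm, Prod.norm_def, max_lt_iff] at hx
  rw [mem_source_iff]
  simpa [σ.r_pos] using hx

theorem mem_source_base {z : Eu k} (hz : z ∈ Metric.ball (0 : Eu k) σ.r) :
    (baseG d G, (z, (0 : LieDual d))) ∈ σ.e.source := by
  rw [mem_ball_zero_iff] at hz
  rw [mem_source_iff]
  simpa [σ.r_pos] using hz

theorem mem_ball_of_mem_source {x : Eu d × (Eu k × LieDual d)} (hx : x ∈ σ.e.source) :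
    x.2 ∈ Metric.ball (0 : Eu k × LieDual d) σ.r := by
  rw [mem_source_iff] at hx
  rw [mem_ball_zero_iff, Prod.norm_def]
  exact max_lt hx.2.1 hx.2.2

theorem mem_ball_prod {z : Eu k} (hz : z ∈ Metric.ball (0 : Eu k) σ.r) :
    (z, (0 : LieDual d)) ∈ Metric.ball (0 : Eu k × LieDual d) σ.r := by
  rw [mem_ball_zero_iff] at hz ⊢
  rw [Prod.norm_mk, norm_zero]
  exact max_lt hz σ.r_pos

open Classical in
/-- The section of the slice over the quotient, with values in the zero level; the value outside
the ball of radius `r` is irrelevant. -/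
def sec (z : Eu k) : μ.zeroLevel := if h : μ.toFun (σ.j (z, 0)) = 0 then ⟨_, h⟩ else q

theorem coe_sec {z : Eu k} (hz : z ∈ Metric.ball (0 : Eu k) σ.r) : (σ.sec z : M) = σ.j (z, 0) := by
  have h : μ.toFun (σ.j (z, 0)) = 0 := σ.moment _ (σ.mem_ball_prod hz)
  rw [sec, dif_pos h]

theorem sec_zero : σ.sec 0 = q := by
  refine Subtype.ext ?_
  rw [σ.coe_sec (Metric.mem_ball_self σ.r_pos)]
  exact σ.base

/-- The coordinates of the slice along the zero level, as functions on `M`. -/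
def coord (x : M) : Eu d × Eu k := ((σ.e.symm x).1, (σ.e.symm x).2.1)

theorem smoothAt_coord {x : M} (hx : x ∈ σ.e.target) : SmoothAt (Eu n) (Eu d × Eu k) σ.coord x := by
  have h1 : SmoothAt (Eu d × (Eu k × LieDual d)) (Eu d × Eu k)
      (fun y : Eu d × (Eu k × LieDual d) => (y.1, y.2.1)) (σ.e.symm x) :=
    smoothAt_iff_contDiffAt.2
      (contDiffAt_fst.prodMk (contDiffAt_fst.comp (σ.e.symm x) contDiffAt_snd))
  exact ContMDiffAt.comp x h1 (σ.smooth_symm x hx)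

/-- In a slice, the zero level is the coordinate subspace where the last component vanishes. -/
theorem moment_symm {y : M} (hy : y ∈ σ.e.target) (h0 : μ.toFun y = 0) :
    (σ.e.symm y).2.2 = 0 := by
  have h1 := σ.e.map_target hy
  have h2 : σ.e (σ.e.symm y) = _ := σ.apply_eq (σ.e.symm y).1 (σ.e.symm y).2 h1
  rw [σ.e.right_inv hy] at h2
  rw [h2, toFun_smul_eq_zero_iff, σ.moment _ (σ.mem_ball_of_mem_source h1)] at h0
  exact h0

theorem symm_eq {y : M} (hy : y ∈ σ.e.target) (h0 : μ.toFun y = 0) :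
    σ.e.symm y = ((σ.coord y).1, ((σ.coord y).2, 0)) :=
  Prod.ext rfl (Prod.ext rfl (σ.moment_symm hy h0))

theorem coord_mem {y : M} (hy : y ∈ σ.e.target) : σ.coord y ∈ Metric.ball (baseG d G, 0) σ.r := by
  have h1 := (σ.mem_source_iff _).1 (σ.e.map_target hy)
  rw [mem_ball_iff_norm, Prod.norm_def]
  refine max_lt h1.1 ?_
  simpa [coord] using h1.2.1

theorem snd_mem_ball {x : Eu d × Eu k} (hx : x ∈ Metric.ball (baseG d G, (0 : Eu k)) σ.r) :
    x.2 ∈ Metric.ball (0 : Eu k) σ.r := by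
  rw [Metric.mem_ball, Prod.dist_eq, max_lt_iff] at hx
  exact hx.2

theorem coe_smul_sec {x : Eu d × Eu k} (hx : x ∈ Metric.ball (baseG d G, (0 : Eu k)) σ.r) :
    ((parG d G x.1 • σ.sec x.2 : μ.zeroLevel) : M) = σ.e (x.1, (x.2, 0)) := by
  rw [coe_smul_zeroLevel, σ.coe_sec (σ.snd_mem_ball hx), σ.apply_eq _ _ (σ.mem_source hx)]

theorem coe_sec' {z : Eu k} (hz : z ∈ Metric.ball (0 : Eu k) σ.r) [LieGroup (𝓡 d) ∞ G] :
    (σ.sec z : M) = σ.e (baseG d G, (z, 0)) := by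
  rw [σ.coe_sec hz, σ.apply_eq _ _ (σ.mem_source_base hz), parG_baseG, one_smul]

/-- The chart of the zero level given by a slice. -/
def levelHomeo : OpenPartialHomeomorph μ.zeroLevel (Eu d × Eu k) where
  toFun y := σ.coord y
  invFun x := parG d G x.1 • σ.sec x.2
  source := {y | (y : M) ∈ σ.e.target}
  target := Metric.ball (baseG d G, 0) σ.r
  map_source' y hy := σ.coord_mem hy
  map_target' x hx := by
    rw [Set.mem_ofPred_eq, σ.coe_smul_sec hx]
    exact σ.e.map_source (σ.mem_source hx)
  left_inv' y hy := by
    refine Subtype.ext ?_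
    rw [σ.coe_smul_sec (σ.coord_mem hy), ← σ.symm_eq hy y.2, σ.e.right_inv hy]
  right_inv' x hx := by
    rw [σ.coe_smul_sec hx, coord, σ.e.left_inv (σ.mem_source hx)]
  open_source := σ.e.open_target.preimage continuous_subtype_val
  open_target := Metric.isOpen_ball
  continuousOn_toFun := fun y hy => ((σ.smoothAt_coord hy).continuousAt.comp (f := Subtype.val)
    continuous_subtype_val.continuousAt).continuousWithinAt
  continuousOn_invFun := by
    refine Topology.IsInducing.subtypeVal.continuousOn_iff.2 ?_
    have h1 : ContinuousOn (fun x : Eu d × Eu k => σ.e (x.1, (x.2, (0 : LieDual d))))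
        (Metric.ball (baseG d G, 0) σ.r) := σ.e.continuousOn.comp
      (Continuous.continuousOn (by fun_prop)) fun x hx => σ.mem_source hx
    exact h1.congr fun x hx => σ.coe_smul_sec hx

theorem smoothAt_coe_levelHomeo_symm {x : Eu d × Eu k} (hx : x ∈ σ.levelHomeo.target) :
    SmoothAt (Eu d × Eu k) (Eu n) (fun y => (σ.levelHomeo.symm y : M)) x := by
  have h1 : SmoothAt (Eu d × Eu k) (Eu d × (Eu k × LieDual d))
      (fun x : Eu d × Eu k => (x.1, (x.2, (0 : LieDual d)))) x :=
    smoothAt_iff_contDiffAt.2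
      (contDiffAt_fst.prodMk (contDiffAt_snd.prodMk contDiffAt_const))
  refine ContMDiffAt.congr_of_eventuallyEq
    (ContMDiffAt.comp x (σ.smooth _ (σ.mem_source hx)) h1) ?_
  filter_upwards [σ.levelHomeo.open_target.mem_nhds hx] with y hy
  exact σ.coe_smul_sec hy

theorem contDiffAt_levelHomeo_symm_levelHomeo {q' : μ.zeroLevel} (σ' : μ.Slice k q')
    {x : Eu d × Eu k} (hx : x ∈ σ.levelHomeo.target)
    (hx' : σ.levelHomeo.symm x ∈ σ'.levelHomeo.source) :
    ContDiffAt ℝ ∞ (fun y => σ'.levelHomeo (σ.levelHomeo.symm y)) x :=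
  smoothAt_iff_contDiffAt.1
    (ContMDiffAt.comp x (f := fun y => (σ.levelHomeo.symm y : M)) (g := σ'.coord)
      (σ'.smoothAt_coord hx') (σ.smoothAt_coe_levelHomeo_symm hx))

theorem mem_levelHomeo_source [LieGroup (𝓡 d) ∞ G] : q ∈ σ.levelHomeo.source := by
  have h0 := Metric.mem_ball_self (x := (0 : Eu k)) σ.r_pos
  have h1 := σ.e.map_source (σ.mem_source_base h0)
  rw [← σ.coe_sec' h0, σ.sec_zero] at h1
  exact h1

theorem injOn_proj_sec : Set.InjOn (fun z => μ.proj (σ.sec z)) (Metric.ball (0 : Eu k) σ.r) := by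
  intro z hz z' hz' h
  obtain ⟨g, hg⟩ := proj_eq_iff.1 h
  have h1 := congrArg Subtype.val hg
  rw [coe_smul_zeroLevel, σ.coe_sec hz, σ.coe_sec hz'] at h1
  exact (σ.inj z' hz' z hz g h1).symm

theorem continuousOn_sec : ContinuousOn σ.sec (Metric.ball (0 : Eu k) σ.r) := by
  refine Topology.IsInducing.subtypeVal.continuousOn_iff.2 fun z hz => ?_
  have h1 : ContinuousAt (fun z : Eu k => σ.j (z, 0)) z :=
    ContinuousAt.comp (g := σ.j) (x := z) (σ.smooth_j _ (σ.mem_ball_prod hz)).continuousAt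
      (Continuous.prodMk_left (0 : LieDual d)).continuousAt
  exact h1.continuousWithinAt.congr (fun y hy => σ.coe_sec hy) (σ.coe_sec hz)

theorem isOpen_image_proj_sec [ContinuousSMul G M] {V : Set (Eu k)} (hV : IsOpen V)
    (hVr : V ⊆ Metric.ball (0 : Eu k) σ.r) : IsOpen ((fun z => μ.proj (σ.sec z)) '' V) := by
  have h1 : IsOpen (σ.levelHomeo.symm '' (Metric.ball (baseG d G) σ.r ×ˢ V)) := by
    refine σ.levelHomeo.isOpen_image_symm_of_subset_target (Metric.isOpen_ball.prod hV) ?_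
    rintro ⟨a, z⟩ ⟨ha, hz⟩
    change _ ∈ Metric.ball _ _
    rw [← ball_prod_same]
    exact ⟨ha, hVr hz⟩
  have h2 : IsOpenMap μ.proj := isOpenMap_quotient_mk'_mul (Γ := G) (T := μ.zeroLevel)
  convert h2 _ h1 using 1
  ext y
  constructor
  · rintro ⟨z, hz, rfl⟩
    exact ⟨_, ⟨(baseG d G, z), ⟨Metric.mem_ball_self σ.r_pos, hz⟩, rfl⟩, proj_smul _ _⟩
  · rintro ⟨_, ⟨⟨a, z⟩, ⟨-, hz⟩, rfl⟩, rfl⟩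
    exact ⟨z, hz, (proj_smul _ _).symm⟩

/-- The chart of the quotient given by a slice: the inverse of `z ↦ π(j(z, 0))`. -/
def quotHomeo [ContinuousSMul G M] : OpenPartialHomeomorph μ.Reduction (Eu k) :=
  (OpenPartialHomeomorph.ofContinuousOpenRestrict σ.injOn_proj_sec.toPartialEquiv
    ((continuous_quotient_mk' (s := MulAction.orbitRel G μ.zeroLevel)).comp_continuousOn
      σ.continuousOn_sec)
    (fun V hV => by
      obtain ⟨V', hV', rfl⟩ := hV
      have h1 := σ.isOpen_image_proj_sec (hV'.inter Metric.isOpen_ball)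
        (Set.inter_subset_right (s := V') (t := Metric.ball (0 : Eu k) σ.r))
      convert h1 using 1
      ext y
      constructor
      · rintro ⟨⟨z, hz⟩, hz', rfl⟩
        exact ⟨z, ⟨hz', hz⟩, rfl⟩
      · rintro ⟨z, ⟨hz', hz⟩, rfl⟩
        exact ⟨⟨z, hz⟩, hz', rfl⟩)
    Metric.isOpen_ball).symm

section Quot

variable [ContinuousSMul G M]

theorem quotHomeo_symm (z : Eu k) : σ.quotHomeo.symm z = μ.proj (σ.sec z) := rfl

theorem quotHomeo_proj_sec {z : Eu k} (hz : z ∈ Metric.ball (0 : Eu k) σ.r) :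
    σ.quotHomeo (μ.proj (σ.sec z)) = z := σ.quotHomeo.right_inv hz

/-- The chart of the quotient in terms of the coordinates of the slice. -/
theorem quotHomeo_proj {y : μ.zeroLevel} {g : G} (hy : g • (y : M) ∈ σ.e.target) :
    σ.quotHomeo (μ.proj y) = (σ.coord (g • (y : M))).2 := by
  have h1 : g • y ∈ σ.levelHomeo.source := hy
  have h2 := congrArg μ.proj (σ.levelHomeo.left_inv h1)
  rw [proj_smul] at h2
  rw [← h2]
  have h3 : μ.proj (σ.levelHomeo.symm (σ.levelHomeo (g • y))) =
      μ.proj (σ.sec (σ.coord (g • y)).2) :=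
    proj_smul _ _
  rw [h3, σ.quotHomeo_proj_sec (σ.snd_mem_ball (σ.coord_mem hy))]

theorem exists_smul_mem_target [LieGroup (𝓡 d) ∞ G] {y : μ.zeroLevel}
    (hy : μ.proj y ∈ σ.quotHomeo.source) : ∃ g : G, g • (y : M) ∈ σ.e.target := by
  have h1 : σ.quotHomeo (μ.proj y) ∈ Metric.ball (0 : Eu k) σ.r := σ.quotHomeo.map_source hy
  have h2 := σ.quotHomeo.left_inv hy
  rw [quotHomeo_symm] at h2
  obtain ⟨g, hg⟩ := proj_eq_iff.1 h2
  refine ⟨g, ?_⟩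
  rw [← coe_smul_zeroLevel, hg, σ.coe_sec' h1]
  exact σ.e.map_source (σ.mem_source_base h1)

theorem mem_quotHomeo_source : μ.proj q ∈ σ.quotHomeo.source := by
  have h1 := σ.quotHomeo.map_target (Metric.mem_ball_self (x := (0 : Eu k)) σ.r_pos)
  rwa [quotHomeo_symm, σ.sec_zero] at h1

theorem smoothAt_coe_sec {z : Eu k} (hz : z ∈ Metric.ball (0 : Eu k) σ.r) :
    SmoothAt (Eu k) (Eu n) (fun y => (σ.sec y : M)) z := by
  have h1 : SmoothAt (Eu k) (Eu k × LieDual d) (fun z : Eu k => (z, (0 : LieDual d))) z :=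
    smoothAt_iff_contDiffAt.2 (contDiffAt_id.prodMk contDiffAt_const)
  have h2 : SmoothAt (Eu k × LieDual d) (Eu n) σ.j (z, 0) := σ.smooth_j _ (σ.mem_ball_prod hz)
  have h3 : SmoothAt (Eu k) (Eu n) (fun z => σ.j (z, 0)) z := ContMDiffAt.comp z h2 h1
  refine ContMDiffAt.congr_of_eventuallyEq h3 ?_
  filter_upwards [Metric.isOpen_ball.mem_nhds hz] with y hy
  exact σ.coe_sec hy

/-- Changes of charts of the quotient are smooth: locally they move a section by a group element
into the other slice and take coordinates there. -/
theorem contDiffAt_quotHomeo_symm_quotHomeo [LieGroup (𝓡 d) ∞ G]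
    [ContMDiffSMul (𝓡 d) (𝓡 n) ∞ G M] {q' : μ.zeroLevel} (σ' : μ.Slice k q')
    {z : Eu k} (hz : z ∈ σ.quotHomeo.target) (hz' : σ.quotHomeo.symm z ∈ σ'.quotHomeo.source) :
    ContDiffAt ℝ ∞ (fun y => σ'.quotHomeo (σ.quotHomeo.symm y)) z := by
  obtain ⟨g, hg⟩ := σ'.exists_smul_mem_target hz'
  have h1 : SmoothAt (Eu k) (Eu n) (fun y => g • (σ.sec y : M)) z :=
    ContMDiffAt.comp z (smoothAt_const_smul d g _) (σ.smoothAt_coe_sec hz)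
  have h2 : SmoothAt (Eu k) (Eu d × Eu k) (fun y => σ'.coord (g • (σ.sec y : M))) z :=
    ContMDiffAt.comp z (σ'.smoothAt_coord hg) h1
  refine ContDiffAt.congr_of_eventuallyEq (contDiffAt_snd.comp z (smoothAt_iff_contDiffAt.1 h2)) ?_
  filter_upwards [h1.continuousAt.eventually (σ'.e.open_target.mem_nhds hg)] with y hy
  exact σ'.quotHomeo_proj hy

end Quot

end Slice

end MomentMap

/-! ### The manifold structures of the zero level and of the quotient -/

namespace MomentMap

variable {d n m k : ℕ} {G : Type*} [TopologicalSpace G] [ChartedSpace (Eu d) G] [Group G]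
  [LieGroup (𝓡 d) ∞ G] [CompactSpace G] {M : Type*} [TopologicalSpace M] [T2Space M]
  [ChartedSpace (Eu n) M] [IsManifold (𝓡 n) ∞ M] [MulAction G M]
  [ContMDiffSMul (𝓡 d) (𝓡 n) ∞ G M] [IsCancelSMul G M]
  {S : AlmostContactMetric n M} (μ : MomentMap d G S)

theorem continuousSMul_of_contMDiffSMul (d n : ℕ) (G M : Type*) [TopologicalSpace G]
    [ChartedSpace (Eu d) G] [Group G] [TopologicalSpace M] [ChartedSpace (Eu n) M] [MulAction G M]
    [ContMDiffSMul (𝓡 d) (𝓡 n) ∞ G M] : ContinuousSMul G M :=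
  ContMDiffSMul.continuousSMul (I := 𝓡 d) (I' := 𝓡 n) ∞

/-- An action of a compact group on a Hausdorff space is proper. -/
theorem properSMul_of_compactSpace {G X : Type*} [TopologicalSpace G] [Group G] [CompactSpace G]
    [TopologicalSpace X] [T2Space X] [MulAction G X] [ContinuousSMul G X] : ProperSMul G X := by
  refine properSMul_iff_continuousSMul_ultrafilter_tendsto_t2.2 ⟨inferInstance, fun 𝒰 _ _ _ => ?_⟩
  obtain ⟨g, -, hg⟩ := isCompact_univ.ultrafilter_le_nhds (𝒰.map Prod.fst) (by simp)
  exact ⟨g, hg⟩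

/-- An identification of the model spaces of the chart given by a slice and of the zero level. -/
def levelModel (hkm : k + d = m) : (Eu d × Eu k) ≃L[ℝ] Eu m :=
  ContinuousLinearEquiv.ofFinrankEq (by
    rw [Module.finrank_prod, finrank_euclideanSpace_fin, finrank_euclideanSpace_fin,
      finrank_euclideanSpace_fin, ← hkm, add_comm])

/-- An identification of the model spaces of the chart given by a slice and of `M`. -/
def ambientModel (hkn : k + 2 * d = n) : (Eu d × (Eu k × LieDual d)) ≃L[ℝ] Eu n :=
  ContinuousLinearEquiv.ofFinrankEq (by
    rw [Module.finrank_prod, Module.finrank_prod, finrank_lieDual, finrank_euclideanSpace_fin,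
      finrank_euclideanSpace_fin, finrank_euclideanSpace_fin, ← hkn]
    omega)

-- `m` and `k` have to be the dimensions of the zero level and of the quotient only if there is a
-- point
variable (H : ∀ _ : μ.zeroLevel, k + 2 * d = n ∧ k + d = m)

/-- A choice of a slice at each point of the zero level. -/
def slice (q : μ.zeroLevel) : μ.Slice k q := (μ.nonempty_slice (H q).1 q).some

/-- The chart of the zero level given by the slice at `q`. -/
def levelChart (q : μ.zeroLevel) : OpenPartialHomeomorph μ.zeroLevel (Eu m) :=
  (μ.slice H q).levelHomeo.transHomeomorph (levelModel (H q).2).toHomeomorph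

/-- The chart of `M` given by the slice at `q`. -/
def ambientChart (q : μ.zeroLevel) : OpenPartialHomeomorph M (Eu n) :=
  (μ.slice H q).e.symm.transHomeomorph (ambientModel (H q).1).toHomeomorph

/-- The chart of the quotient given by the slice at `q`. -/
def quotChart (q : μ.zeroLevel) : OpenPartialHomeomorph μ.Reduction (Eu k) :=
  have := continuousSMul_of_contMDiffSMul d n G M
  (μ.slice H q).quotHomeo

/-- The zero level, with the charts given by the slices. -/
abbrev levelCharted : ChartedSpace (Eu m) μ.zeroLevel where
  atlas := Set.range (μ.levelChart H)
  chartAt := μ.levelChart H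
  mem_chart_source q := (μ.slice H q).mem_levelHomeo_source
  chart_mem_atlas q := ⟨q, rfl⟩

/-- The quotient, with the charts given by the slices at all points of the zero level. -/
abbrev quotCharted : ChartedSpace (Eu k) μ.Reduction where
  atlas := Set.range (μ.quotChart H)
  chartAt y := μ.quotChart H y.out
  mem_chart_source y := by
    have := continuousSMul_of_contMDiffSMul d n G M
    have h1 := (μ.slice H y.out).mem_quotHomeo_source
    rwa [show μ.proj y.out = y from Quotient.out_eq y] at h1
  chart_mem_atlas y := ⟨y.out, rfl⟩

theorem isManifold_level :
    letI := μ.levelCharted H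
    IsManifold (𝓡 m) ∞ μ.zeroLevel := by
  let := μ.levelCharted H
  refine isManifold_of_contDiffOn (𝓡 m) ∞ μ.zeroLevel ?_
  rintro _ _ ⟨q, rfl⟩ ⟨q', rfl⟩ x ⟨⟨hx1, hx2⟩, -⟩
  refine ContDiffAt.contDiffWithinAt ?_
  have h1 := (μ.slice H q).contDiffAt_levelHomeo_symm_levelHomeo (μ.slice H q') hx1 hx2
  exact ((levelModel (H q').2).contDiff.contDiffAt).comp x
    (h1.comp x (levelModel (H q).2).symm.contDiff.contDiffAt)

theorem isManifold_quot :
    letI := μ.quotCharted H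
    IsManifold (𝓡 k) ∞ μ.Reduction := by
  let := μ.quotCharted H
  have := continuousSMul_of_contMDiffSMul d n G M
  refine isManifold_of_contDiffOn (𝓡 k) ∞ μ.Reduction ?_
  rintro _ _ ⟨q, rfl⟩ ⟨q', rfl⟩ x ⟨⟨hx1, hx2⟩, -⟩
  exact ((μ.slice H q).contDiffAt_quotHomeo_symm_quotHomeo (μ.slice H q') hx1 hx2).contDiffWithinAt

theorem ambientChart_mem_maximalAtlas (q : μ.zeroLevel) :
    μ.ambientChart H q ∈ IsManifold.maximalAtlas (𝓡 n) ∞ M := by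
  refine OpenPartialHomeomorph.mem_maximalAtlas_of_contMDiffOn _ ?_ ?_
  · intro x hx
    refine ContMDiffAt.contMDiffWithinAt ?_
    have h1 : SmoothAt (Eu d × (Eu k × LieDual d)) (Eu n) (ambientModel (H q).1)
      ((μ.slice H q).e.symm x) :=
      smoothAt_iff_contDiffAt.2 (ambientModel (H q).1).contDiff.contDiffAt
    have h2 : SmoothAt (Eu n) (Eu n) (fun y => ambientModel (H q).1 ((μ.slice H q).e.symm y)) x :=
      ContMDiffAt.comp (f := (μ.slice H q).e.symm) (g := ambientModel (H q).1) x h1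
        ((μ.slice H q).smooth_symm x hx)
    exact h2
  · intro x hx
    refine ContMDiffAt.contMDiffWithinAt ?_
    have h1 : SmoothAt (Eu n) (Eu d × (Eu k × LieDual d)) (ambientModel (H q).1).symm x :=
      smoothAt_iff_contDiffAt.2 (ambientModel (H q).1).symm.contDiff.contDiffAt
    have h2 : SmoothAt (Eu n) (Eu n)
        (fun y => (μ.slice H q).e ((ambientModel (H q).1).symm y)) x :=
      ContMDiffAt.comp (f := (ambientModel (H q).1).symm) (g := (μ.slice H q).e) x
        ((μ.slice H q).smooth _ hx) h1
    exact h2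

/-- In the charts given by a slice, the inclusion is `(a, z) ↦ (a, z, 0)`. -/
theorem isSmoothEmbedding_incl :
    letI := μ.levelCharted H
    Manifold.IsSmoothEmbedding (𝓡 m) (𝓡 n) ∞ μ.incl := by
  let := μ.levelCharted H
  have := μ.isManifold_level H
  refine ⟨⟨LieDual d, inferInstance, inferInstance, fun q => ?_⟩, Topology.IsEmbedding.subtypeVal⟩
  refine Manifold.IsImmersionAtOfComplement.mk_of_continuousAt continuous_subtype_val.continuousAt
    ((((levelModel (H q).2).symm.prodCongr (ContinuousLinearEquiv.refl ℝ (LieDual d))).trans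
      (ContinuousLinearEquiv.prodAssoc ℝ (Eu d) (Eu k) (LieDual d))).trans (ambientModel (H q).1))
    (μ.levelChart H q) (μ.ambientChart H q) (μ.slice H q).mem_levelHomeo_source
    (μ.slice H q).mem_levelHomeo_source (IsManifold.chart_mem_maximalAtlas q)
    (μ.ambientChart_mem_maximalAtlas H q) ?_
  intro x hx
  have hx' : (levelModel (H q).2).symm x ∈ (μ.slice H q).levelHomeo.target := by
    simpa [levelChart] using hx
  have h1 : (μ.slice H q).e.symm
      ((μ.slice H q).levelHomeo.symm ((levelModel (H q).2).symm x) : M) =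
      (((levelModel (H q).2).symm x).1, (((levelModel (H q).2).symm x).2, 0)) := by
    rw [show ((μ.slice H q).levelHomeo.symm ((levelModel (H q).2).symm x) : M) = _ from
      (μ.slice H q).coe_smul_sec hx', (μ.slice H q).e.left_inv ((μ.slice H q).mem_source hx')]
  exact congrArg (ambientModel (H q).1) h1

theorem continuous_proj : Continuous μ.proj := continuous_quotient_mk'

/-- In the charts given by a slice, the projection is `(a, z) ↦ z`. -/
theorem isSubmersion_proj :
    letI := μ.levelCharted H
    letI := μ.quotCharted H
    Manifold.IsSubmersion (𝓡 m) (𝓡 k) ∞ μ.proj := by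
  let := μ.levelCharted H
  let := μ.quotCharted H
  have := μ.isManifold_level H
  have := μ.isManifold_quot H
  have := continuousSMul_of_contMDiffSMul d n G M
  refine ⟨Eu d, inferInstance, inferInstance, fun q => ?_⟩
  refine Manifold.IsSubmersionAtOfComplement.mk_of_continuousAt μ.continuous_proj.continuousAt
    ((levelModel (H q).2).symm.trans (ContinuousLinearEquiv.prodComm ℝ (Eu d) (Eu k)))
    (μ.levelChart H q) (μ.quotChart H q) (μ.slice H q).mem_levelHomeo_source
    (μ.slice H q).mem_quotHomeo_source (IsManifold.chart_mem_maximalAtlas q)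
    (IsManifold.subset_maximalAtlas ⟨q, rfl⟩) ?_
  intro x hx
  have hx' : (levelModel (H q).2).symm x ∈ (μ.slice H q).levelHomeo.target := by
    simpa [levelChart] using hx
  have h1 : (μ.slice H q).quotHomeo
      (μ.proj ((μ.slice H q).levelHomeo.symm ((levelModel (H q).2).symm x))) =
      ((levelModel (H q).2).symm x).2 := by
    rw [show μ.proj ((μ.slice H q).levelHomeo.symm ((levelModel (H q).2).symm x)) = _ from
      proj_smul _ _, (μ.slice H q).quotHomeo_proj_sec ((μ.slice H q).snd_mem_ball hx')]
  exact h1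

theorem t2Space_reduction : T2Space μ.Reduction := by
  have := continuousSMul_of_contMDiffSMul d n G M
  have : ProperSMul G μ.zeroLevel := properSMul_of_compactSpace
  exact t2Space_quotient_mulAction_of_properSMul

theorem secondCountableTopology_reduction [SecondCountableTopology M] :
    SecondCountableTopology μ.Reduction := by
  have := continuousSMul_of_contMDiffSMul d n G M
  exact ContinuousConstSMul.secondCountableTopology

end MomentMap

/-! ### Horizontal sections given by slices -/

namespace MomentMap

variable {d n m k : ℕ} {G : Type*} [TopologicalSpace G] [ChartedSpace (Eu d) G] [Group G]
  [LieGroup (𝓡 d) ∞ G] [CompactSpace G] {M : Type*} [TopologicalSpace M] [T2Space M]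
  [ChartedSpace (Eu n) M] [IsManifold (𝓡 n) ∞ M] [MulAction G M]
  [ContMDiffSMul (𝓡 d) (𝓡 n) ∞ G M] [IsCancelSMul G M]
  {S : AlmostContactMetric n M} (μ : MomentMap d G S)

namespace Slice

variable {μ} {q : μ.zeroLevel} (σ : μ.Slice k q)

/-- The section of a slice, translated by `g`, is horizontal at the base point. -/
theorem phiDual_md_smul_sec (hS : Preserves G S) (g : G) (u : Eu k) :
    μ.phiDual (g • q : M) (md (Eu k) (Eu n) (fun z => g • (σ.sec z : M)) 0 u) = 0 := by
  have h0 : SmoothAt (Eu k) (Eu k × LieDual d) (fun z : Eu k => (z, (0 : LieDual d))) 0 :=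
    smoothAt_iff_contDiffAt.2 (contDiffAt_id.prodMk contDiffAt_const)
  have hj : SmoothAt (Eu k × LieDual d) (Eu n) σ.j ((0 : Eu k), (0 : LieDual d)) :=
    σ.smooth_j _ (σ.mem_ball_prod (Metric.mem_ball_self σ.r_pos))
  have := continuousSMul_of_contMDiffSMul d n G M
  have hsec := σ.smoothAt_coe_sec (Metric.mem_ball_self σ.r_pos)
  have h1 : md (Eu k) (Eu n) (fun z => (σ.sec z : M)) 0 =
      md (Eu k) (Eu n) (fun z => σ.j (z, 0)) 0 := by
    refine md_congr ?_
    filter_upwards [Metric.ball_mem_nhds (0 : Eu k) σ.r_pos] with y hy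
    exact σ.coe_sec hy
  have h2 := md_comp_apply (f := fun z => (σ.sec z : M)) (g := fun x : M => g • x)
    (smoothAt_const_smul d g _) hsec u
  have h3 := md_comp_apply (f := fun z : Eu k => (z, (0 : LieDual d))) (g := σ.j) hj h0 u
  rw [h2, h1, h3, σ.sec_zero]
  ext A
  refine (μ.phiDual_smul hS g (q : M) _ A).trans ?_
  rw [show ((0 : Eu k), (0 : LieDual d)) = 0 from rfl, σ.horizontal]
  rfl

end Slice

variable (H : ∀ _ : μ.zeroLevel, k + 2 * d = n ∧ k + d = m)

/-- The chart of the zero level given by a slice extends to a smooth map near the point in `M`. -/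
theorem injective_inclE (q : μ.zeroLevel) :
    letI := μ.levelCharted H
    Function.Injective (μ.inclE m q) := by
  let := μ.levelCharted H
  have := μ.isManifold_level H
  have h1 : SmoothAt (Eu n) (Eu m) (fun x => levelModel (H q).2 ((μ.slice H q).coord x)) (q : M) :=
    ContMDiffAt.comp (q : M) (f := (μ.slice H q).coord) (g := levelModel (H q).2)
      (smoothAt_iff_contDiffAt.2 (levelModel (H q).2).contDiff.contDiffAt)
      ((μ.slice H q).smoothAt_coord (μ.slice H q).mem_levelHomeo_source)
  refine (injective_iff_map_eq_zero _).2 fun u hu => ?_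
  have h2 := md_comp_apply (f := μ.incl) (g := fun x => levelModel (H q).2 ((μ.slice H q).coord x))
    (x := q) h1 ((μ.isSmoothEmbedding_incl H).isImmersion.contMDiff q) u
  have h3 : md (Eu m) (Eu n) μ.incl q u = 0 := hu
  rw [h3, map_zero] at h2
  have h4 := congrArg (fun L => L u) (md_ch_self (E := Eu m) q)
  exact h4.symm.trans h2

/-- The chart at the class of `q` comes from a slice at a representative of the class, so its
section has to be translated to `q`. -/
theorem exists_isHorSection (hS : Preserves G S) (q : μ.zeroLevel) :
    letI := μ.levelCharted H
    letI := μ.quotCharted H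
    ∃ s, μ.IsHorSection (m := m) (k := k) q s := by
  let := μ.levelCharted H
  let := μ.quotCharted H
  have := μ.isManifold_level H
  have := continuousSMul_of_contMDiffSMul d n G M
  obtain ⟨g, hg⟩ := proj_eq_iff.1 (Quotient.out_eq (μ.proj q)).symm
  set σ := μ.slice H (μ.proj q).out with hσ
  have h0 := Metric.mem_ball_self (x := (0 : Eu k)) σ.r_pos
  have hch : ch (Eu k) (μ.proj q) (μ.proj q) = 0 := by
    have h1 := σ.quotHomeo_proj_sec h0
    rw [σ.sec_zero, show μ.proj (μ.proj q).out = μ.proj q from Quotient.out_eq _] at h1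
    exact h1
  have himm := (μ.isSmoothEmbedding_incl H).isImmersion
  have hsm : ∀ z ∈ Metric.ball (0 : Eu k) σ.r,
      SmoothAt (Eu k) (Eu n) (fun y => g • (σ.sec y : M)) z := fun z hz =>
    ContMDiffAt.comp z (smoothAt_const_smul d g _) (σ.smoothAt_coe_sec hz)
  have hsm' : ∀ z ∈ Metric.ball (0 : Eu k) σ.r,
      SmoothAt (Eu k) (Eu m) (fun y => g • σ.sec y) z := by
    intro z hz
    refine (ContMDiffAt.iff_comp_isImmersionAt (f := fun y => g • σ.sec y) (x := z)
      (himm.isImmersionAt (g • σ.sec z))).2 ⟨?_, hsm z hz⟩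
    exact Topology.IsInducing.subtypeVal.continuousAt_iff.2 (hsm z hz).continuousAt
  refine ⟨fun z => g • σ.sec z, ?_, ?_, ?_, ?_⟩
  · rw [hch]
    filter_upwards [Metric.ball_mem_nhds (0 : Eu k) σ.r_pos] with z hz using hsm' z hz
  · rw [hch, σ.sec_zero]
    exact hg
  · exact Filter.Eventually.of_forall fun z => proj_smul g (σ.sec z)
  · intro u
    rw [hch]
    have h2 := md_comp_apply (f := fun z => g • σ.sec z) (g := μ.incl)
      (himm.contMDiff _) (hsm' 0 h0) u
    rw [σ.sec_zero, hg] at h2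
    have h3 := σ.phiDual_md_smul_sec hS g u
    rw [← coe_smul_zeroLevel, hg] at h3
    exact (congrArg (μ.phiDual (q : M)) h2).symm.trans h3

theorem isReductionAtlas (hS : Preserves G S) :
    letI := μ.levelCharted H
    letI := μ.quotCharted H
    haveI := μ.isManifold_level H
    haveI := μ.isManifold_quot H
    μ.IsReductionAtlas m k := by
  let := μ.levelCharted H
  let := μ.quotCharted H
  have := μ.isManifold_level H
  have := μ.isManifold_quot H
  exact
    { embedding := μ.isSmoothEmbedding_incl H
      proj_smooth := (μ.isSubmersion_proj H).contMDiff
      inclE_injective := μ.injective_inclE H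
      dim_level := fun q => by have := H q; omega
      dim_quotient := fun q => (H q).2
      exists_section := μ.exists_isHorSection H hS }

end MomentMap

end STReduction

end

theorem mainTheorem3 {d n : ℕ}
    {G : Type*} [TopologicalSpace G] [ChartedSpace (STReduction.Eu d) G] [Group G]
    [LieGroup (𝓡 d) ∞ G] [T2Space G] [CompactSpace G]
    {M : Type*} [TopologicalSpace M] [T2Space M] [SecondCountableTopology M]
    [ChartedSpace (STReduction.Eu n) M] [IsManifold (𝓡 n) ∞ M]
    [MulAction G M] [ContMDiffSMul (𝓡 d) (𝓡 n) ∞ G M] [IsCancelSMul G M]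
    (S : STReduction.AlmostContactMetric n M) (hS : STReduction.Preserves G S)
    (μ : STReduction.MomentMap d G S) :
    ∃ (_ : ChartedSpace (STReduction.Eu (n - d)) μ.zeroLevel)
      (_ : IsManifold (𝓡 (n - d)) ∞ μ.zeroLevel)
      (_ : ChartedSpace (STReduction.Eu (n - 2 * d)) μ.Reduction)
      (_ : IsManifold (𝓡 (n - 2 * d)) ∞ μ.Reduction),
      Manifold.IsSmoothEmbedding (𝓡 (n - d)) (𝓡 n) ∞ μ.incl ∧
      T2Space μ.Reduction ∧ SecondCountableTopology μ.Reduction ∧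
      Manifold.IsSubmersion (𝓡 (n - d)) (𝓡 (n - 2 * d)) ∞ μ.proj ∧
      ∃ θ : ∀ q : μ.zeroLevel, STReduction.Tan (n - d) q →L[ℝ] STReduction.LieAlg d,
        μ.IsConnectionForm θ ∧
        ∃ T : STReduction.AlmostContactMetric (n - 2 * d) μ.Reduction,
          μ.IsInduced (m := n - d) T ∧
          (S.IsNormal → T.IsNormal) ∧
          (S.IsST → T.IsST ∧
            (∀ (q : μ.zeroLevel) (X : Fin 3 → STReduction.Tan (n - d) q),
              T.torsion (μ.proj q) (fun i => μ.projD q (X i)) =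
                S.torsion (q : M) (fun i => μ.inclD q (μ.hproj θ q (X i))) - μ.alphaR θ q X) ∧
            (∀ (q : μ.zeroLevel) (X : Fin 4 → STReduction.Tan (n - d) q),
              STReduction.extD T.torsion (μ.proj q) (fun i => μ.projD q (X i)) =
                STReduction.extD S.torsion (q : M) (fun i => μ.inclD q (μ.hproj θ q (X i)))
                  - μ.curvTorsion θ q (fun i => μ.hproj θ q (X i)) - μ.dAlphaR θ q X)) := by
  have H : ∀ _ : μ.zeroLevel, (n - 2 * d) + 2 * d = n ∧ (n - 2 * d) + d = n - d := fun q => by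
    have := μ.two_mul_dim_le q.2
    omega
  let := μ.levelCharted H
  let := μ.quotCharted H
  have := μ.isManifold_level H
  have := μ.isManifold_quot H
  exact ⟨μ.levelCharted H, μ.isManifold_level H, μ.quotCharted H, μ.isManifold_quot H,
    μ.isSmoothEmbedding_incl H, μ.t2Space_reduction, μ.secondCountableTopology_reduction,
    μ.isSubmersion_proj H, (μ.isReductionAtlas H hS).exists_induced hS⟩
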